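/- **Theorem (variable-time amplitude estimation).** *Variable-time algorithms.* Let $0=t_0<t_1<\dots<t_m$ be integers, let $\mathcal H_F=\bigotimes_{i=1}^m\mathcal H_{F_i}$, where each $\mathcal H_{F_i}$ has orthonormal basis $\{|\mathrm{stop}\rangle,|\mathrm{cont}\rangle\}$, and let $\mathcal H_C$ be a Hilbert space with a unit vector $|0\rangle$. A variable-time algorithm with stopping times $t_1<\dots<t_m$ is a product $U=U_m\cdots U_1$ of unitaries on $\mathcal H_F\otimes\mathcal H_C$, where $U_i$ acts on $\mathcal H_{F_i}\otimes\mathcal H_C$ controlled on the first $i-1$ flag registers being $|\mathrm{cont}\rangle^{\otimes (i-1)}$, and has time complexity $t_i-t_{i-1}$. Put $T_{\max}(U)=t_m$, $|\mathrm{init}\rangle=|\mathrm{cont}\rangle^{\otimes m}|0\rangle$, $|\psi\rangle=U|\mathrm{init}\rangle$, and let $\Pi_{\mathrm{stop}}=(I-(|\mathrm{cont}\rangle\langle\mathrm{cont}|)^{\otimes m})\otimes I$. Let $p_{\mathrm{stop},i}=\|\Pi_{\mathrm{stop}}U_i\cdots U_1|\mathrm{init}\rangle\|^2-\|\Pi_{\mathrm{stop}}U_{i-1}\cdots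 U_1|\mathrm{init}\rangle\|^2$ and $T_{\ell_2}(U)=\bigl(\sum_{i=1}^m p_{\mathrm{stop},i}t_i^2\bigr)^{1/2}$. All computations are assumed to be finished after the last step, i.e. $\Pi_{\mathrm{stop}}|\psi\rangle=|\psi\rangle$. *Model.* A quantum algorithm holds the registers of $\mathcal H_F\otimes\mathcal H_C$ and finitely many work qubits, starting in $|\mathrm{init}\rangle$ and $|0\cdots0\rangle$. It adaptively performs two-qubit gates on flag and work qubits, measurements of these qubits, controlled versions of the reflections $I-2\Pi_C$ and $I-2|0\rangle\langle 0|$ on $\mathcal H_C$, preparations of a fresh initial memory (each of these taking time $1$), and controlled versions of $U_i$ and $U_i^{-1}$ (taking time $t_i-t_{i-1}$); finally it outputs a real number. Its time complexity is the maximal total time over all measurement results; classical processing is not charged. *Statement.* There are a quantum algorithm and an absolute constant $C>0$ such that the following holds for all stopping times with $T_{\max}=t_m\ge 2$ and all reals $t,T_{\ell_2}>1$ and $0<\epsilon,\delta<1$. The algorithm takes as input the stopping times, $t,T_{\ell_2},\epsilon,\delta$, and access in the above sense to a variable-time algorithm $U$ with these stopping times and to an orthogonal projector $\Pi_C$ on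 $\mathcal H_C$. Its time complexity is at most $$C\left(\min\left(T_{\max},\,t\,T_{\ell_2}\,\epsilon^{-1/2}\right)+t\,T_{\ell_2}\right)\epsilon^{-1}\,\log_2^4(T_{\max})\,\max\left(1,\log_2\frac{\log_2 T_{\max}}{\delta}\right).$$ If $T_{\ell_2}\ge T_{\ell_2}(U)$, then with probability at least $1-\delta$ the output $\widetilde p$ satisfies all of the following, where $p=\langle\psi|\Pi|\psi\rangle$ and $\Pi=(I-(|\mathrm{cont}\rangle\langle\mathrm{cont}|)^{\otimes m})\otimes\Pi_C$: 1. $\widetilde p\le 2p$, for any $t$; 2. $|\widetilde p-p|\le\epsilon p$, when $t\ge 2/\sqrt p$; 3. $\widetilde p=0$, when $t<1/\sqrt{2p}$; here $2/\sqrt p=1/\sqrt{2p}=+\infty$ if $p=0$. -/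

import Mathlib

universe u

noncomputable section

namespace VarTime

/-- Stopping times `t_1 < ... < t_m` (positive integers, as numbers of gates), together with
`t_0 = 0`. -/
structure StoppingTimes (m : ℕ) where
  time : Fin (m + 1) → ℕ
  time_zero : time 0 = 0
  strictMono : StrictMono time

namespace StoppingTimes

variable {m : ℕ}

/-- The maximal running time `t_m`. -/
def Tmax (τ : StoppingTimes m) : ℕ := τ.time (Fin.last m)

/-- The time complexity `t_i - t_{i-1}` of the `i`-th step. -/
def duration (τ : StoppingTimes m) (i : Fin m) : ℕ := τ.time i.succ - τ.time i.castSucc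

end StoppingTimes

/-! ### The Hilbert spaces

`H` is the space `H_C`.  In a flag register, `true` stands for `|stop⟩` and `false` for `|cont⟩`.
The tensor product of a finite family of qubits with a Hilbert space `E` is the `ℓ²`-direct sum
of copies of `E` indexed by the computational basis states of the qubits. -/

/-- `H_{F_i} ⊗ H_C` for a single flag register. -/
abbrev FlagSpace (H : Type u) : Type u := PiLp 2 (fun _ : Bool => H)

/-- `H_F ⊗ H_C` with `m` flag registers. -/
abbrev Sys (m : ℕ) (H : Type u) : Type u := PiLp 2 (fun _ : Fin m → Bool => H)

/-- The whole quantum memory of an algorithm: `w` work qubits and `H_F ⊗ H_C`. -/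
abbrev Mem (m w : ℕ) (H : Type u) : Type u := PiLp 2 (fun _ : Fin w → Bool => Sys m H)

section System

variable {m : ℕ} {H : Type u} [NormedAddCommGroup H] [InnerProductSpace ℂ H]

/-- The operator on `H_F ⊗ H_C` that applies `V` to `H_{F_i} ⊗ H_C`, controlled on all the earlier
flag registers being `|cont⟩`. -/
def stepOp (i : Fin m) (V : FlagSpace H ≃ₗᵢ[ℂ] FlagSpace H) (ψ : Sys m H) : Sys m H :=
  WithLp.toLp 2 fun f =>
    if ∀ j < i, f j = false then
      V (WithLp.toLp 2 fun b => ψ (Function.update f i b)) (f i)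
    else ψ f

/-- The projector `Π_stop` on the states containing `|stop⟩`. -/
def stopProj (ψ : Sys m H) : Sys m H :=
  WithLp.toLp 2 fun f => if ∃ j, f j = true then ψ f else 0

/-- The projector `(I - |cont⟩⟨cont|^{⊗ m}) ⊗ P`. -/
def acceptProj (P : H →L[ℂ] H) (ψ : Sys m H) : Sys m H :=
  WithLp.toLp 2 fun f => if ∃ j, f j = true then P (ψ f) else 0

end System

/-- A variable-time algorithm `U = U_m ⋯ U_1` on `H_F ⊗ H_C`: the operator `U_i` is given by the
unitary `unitary i` on `H_{F_i} ⊗ H_C`, which is applied under the control of the earlier flags;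
`zero` is the initial state `|0⟩` of `H_C`. -/
structure VariableTimeAlgorithm (m : ℕ) (H : Type u)
    [NormedAddCommGroup H] [InnerProductSpace ℂ H] where
  unitary : Fin m → (FlagSpace H ≃ₗᵢ[ℂ] FlagSpace H)
  zero : H
  norm_zero : ‖zero‖ = 1

namespace VariableTimeAlgorithm

variable {m : ℕ} {H : Type u} [NormedAddCommGroup H] [InnerProductSpace ℂ H]

/-- `|init⟩ = |cont⟩^{⊗ m} |0⟩`. -/
def init (U : VariableTimeAlgorithm m H) : Sys m H :=
  WithLp.toLp 2 fun f => if ∀ j, f j = false then U.zero else 0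

/-- `U_k ⋯ U_1 |init⟩`. -/
def stateAfter (U : VariableTimeAlgorithm m H) : ℕ → Sys m H
  | 0 => U.init
  | k + 1 =>
    if h : k < m then stepOp ⟨k, h⟩ (U.unitary ⟨k, h⟩) (U.stateAfter k) else U.stateAfter k

/-- `|ψ⟩ = U |init⟩`. -/
def final (U : VariableTimeAlgorithm m H) : Sys m H := U.stateAfter m

/-- All branches of the computation have stopped after the last step. -/
def Halts (U : VariableTimeAlgorithm m H) : Prop := stopProj U.final = U.final

/-- The probability to stop at step `i` (the index `i : Fin m` is the step number minus one). -/
def pStop (U : VariableTimeAlgorithm m H) (i : Fin m) : ℝ :=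
  ‖stopProj (U.stateAfter (i + 1))‖ ^ 2 - ‖stopProj (U.stateAfter i)‖ ^ 2

/-- The `ℓ₂`-average running time. -/
def Tl2 (U : VariableTimeAlgorithm m H) (τ : StoppingTimes m) : ℝ :=
  Real.sqrt (∑ i : Fin m, U.pStop i * (τ.time i.succ : ℝ) ^ 2)

/-- `p = ⟨ψ| (I - |cont⟩⟨cont|^{⊗ m}) ⊗ P |ψ⟩`. -/
def acceptProb (U : VariableTimeAlgorithm m H) (P : H →L[ℂ] H) : ℝ :=
  (inner ℂ U.final (acceptProj P U.final)).re

end VariableTimeAlgorithm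

/-! ### Quantum algorithms with access to a variable-time algorithm and a projector

A quantum algorithm is a sequence of elementary operations on the quantum memory, chosen
adaptively from the results of measurements; it ends by the output of a real number. -/

/-- The unitary operations: arbitrary two-qubit gates on the flag and work qubits, and the versions
controlled by a work qubit `c` of `U_i`, of `U_i⁻¹`, of the reflection `I - 2 P` and of the
reflection `I - 2 |0⟩⟨0|` on `H_C`. -/
inductive Instr (m w : ℕ) : Type
  | gate (q r : Fin m ⊕ Fin w) (hqr : q ≠ r) (M : Matrix.unitaryGroup (Bool × Bool) ℂ)
  | call (c : Fin w) (i : Fin m)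
  | callInv (c : Fin w) (i : Fin m)
  | reflProj (c : Fin w)
  | reflZero (c : Fin w)

/-- A call to `U_i` or `U_i⁻¹` takes time `t_i - t_{i-1}`, all other operations are
elementary gates. -/
def Instr.cost {m w : ℕ} (τ : StoppingTimes m) : Instr m w → ℕ
  | .gate _ _ _ _ => 1
  | .call _ i => τ.duration i
  | .callInv _ i => τ.duration i
  | .reflProj _ => 1
  | .reflZero _ => 1

section Semantics

variable {m w : ℕ} {H : Type u} [NormedAddCommGroup H] [InnerProductSpace ℂ H]

/-- The component of the memory state at the basis state `z` of the flag and work qubits. -/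
def component (ψ : Mem m w H) (z : Fin m ⊕ Fin w → Bool) : H :=
  ψ (fun j => z (Sum.inr j)) (fun j => z (Sum.inl j))

/-- The memory state with given components. -/
def ofComponents (φ : (Fin m ⊕ Fin w → Bool) → H) : Mem m w H :=
  WithLp.toLp 2 fun x => WithLp.toLp 2 fun f => φ (Sum.elim f x)

/-- A two-qubit gate with matrix `M` on the qubits `q` and `r`. -/
def gateOp (q r : Fin m ⊕ Fin w) (M : Matrix (Bool × Bool) (Bool × Bool) ℂ) (ψ : Mem m w H) :
    Mem m w H :=
  ofComponents fun z =>
    ∑ a : Bool, ∑ b : Bool,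
      M (z q, z r) (a, b) • component ψ (Function.update (Function.update z q a) r b)

/-- An operation on `H_F ⊗ H_C` controlled by the work qubit `c`. -/
def controlled (c : Fin w) (A : Sys m H → Sys m H) (ψ : Mem m w H) : Mem m w H :=
  WithLp.toLp 2 fun x => if x c = true then A (ψ x) else ψ x

/-- An operation on `H_C` acting on `H_F ⊗ H_C`. -/
def onC (A : H → H) (ψ : Sys m H) : Sys m H := WithLp.toLp 2 fun f => A (ψ f)

/-- The unnormalised state after the result `b` of the measurement of the qubit `q`. -/
def measured (q : Fin m ⊕ Fin w) (b : Bool) (ψ : Mem m w H) : Mem m w H :=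
  ofComponents fun z => if z q = b then component ψ z else 0

/-- The effect of an instruction, for the variable-time algorithm `U` and the projector `P`. -/
def Instr.apply (U : VariableTimeAlgorithm m H) (P : H →L[ℂ] H) :
    Instr m w → Mem m w H → Mem m w H
  | .gate q r _ M, ψ => gateOp q r M.1 ψ
  | .call c i, ψ => controlled c (stepOp i (U.unitary i)) ψ
  | .callInv c i, ψ => controlled c (stepOp i (U.unitary i).symm) ψ
  | .reflProj c, ψ => controlled c (onC fun v => v - (2 : ℂ) • P v) ψ
  | .reflZero c, ψ => controlled c (onC fun v => v - (2 * inner ℂ U.zero v) • U.zero) ψ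

/-- The initial memory: the work qubits are `|0⟩` and the system is in the state `|init⟩`. -/
def initMem (w : ℕ) (U : VariableTimeAlgorithm m H) : Mem m w H :=
  WithLp.toLp 2 fun x => if ∀ j, x j = false then U.init else 0

end Semantics

/-- Adaptive quantum programs: output a number, apply an operation, measure a qubit and branch on
the result, or discard the quantum memory and prepare a fresh initial one. -/
inductive Program (m w : ℕ) : Type
  | output (r : ℝ) : Program m w
  | apply (g : Instr m w) (k : Program m w) : Program m w
  | measure (q : Fin m ⊕ Fin w) (k : Bool → Program m w) : Program m w
  | restart (k : Program m w) : Program m w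

namespace Program

variable {m w : ℕ}

/-- The worst-case running time, over all results of the measurements. -/
def cost (τ : StoppingTimes m) : Program m w → ℕ
  | output _ => 0
  | apply g k => g.cost τ + k.cost τ
  | measure _ k => 1 + max ((k false).cost τ) ((k true).cost τ)
  | restart k => 1 + k.cost τ

variable {H : Type u} [NormedAddCommGroup H] [InnerProductSpace ℂ H]

/-- For a program started in the (unnormalised) state `ψ`, the probability that its output lies in
the set `S`, multiplied by `‖ψ‖ ^ 2`. -/
def weight (U : VariableTimeAlgorithm m H) (P : H →L[ℂ] H) (S : Set ℝ) :
    Program m w → Mem m w H → ℝ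
  | output r, ψ => S.indicator (fun _ => ‖ψ‖ ^ 2) r
  | apply g k, ψ => k.weight U P S (g.apply U P ψ)
  | measure q k, ψ =>
      (k false).weight U P S (measured q false ψ) + (k true).weight U P S (measured q true ψ)
  | restart k, ψ => ‖ψ‖ ^ 2 * k.weight U P S (initMem w U)

/-- The probability that the output of the program lies in `S`. -/
def prob (A : Program m w) (U : VariableTimeAlgorithm m H) (P : H →L[ℂ] H) (S : Set ℝ) : ℝ :=
  A.weight U P S (initMem w U)

end Program

/-- An estimation algorithm: the number of work qubits and the program are determined by the
stopping times and the real parameters `t`, `T`, `ε`, `δ`.  The space `H_C`, the unitaries and the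
projector are accessed only through the instructions of the program. -/
def EstimationAlgorithm : Type :=
  ∀ m : ℕ, StoppingTimes m → (t T ε δ : ℝ) → (w : ℕ) × Program m w

end VarTime

end

/-! Call a branch good if it has not stopped, or has stopped and lies in the range of the projector.
Let `a_j` be the norm of the good part of the state at time `2 ^ (j - 1)` (`amplitude`, with `a_0 =
1`). Stopped branches are frozen, so `a_j` is nonincreasing. Once everything has stopped its square
is `p`, and a second-moment tail bound gives `a_(j+1) ^ 2 ≤ p + T ^ 2 / 4 ^ j` (`goodProb_le`).
Running up to time about `2 * cutoff` therefore yields `p` up to an error `ε / (4 * t ^ 2)`, and the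
final threshold `2 / t ^ 2` absorbs this error (`estimate_spec`).

The good amplitude is estimated along a chain of `L` stages with doubling times. A stage starts from
a circuit whose good part is an exact multiple `γ` of the true good part, with `‖γ‖ * a_j` of order
`u = 1 / (16 * L)`. It appends the steps up to time `2 ^ j`, estimates the angle of the new good
part to relative accuracy of order `ε`, and amplifies back to order `u`. Amplification multiplies
the good part exactly by a Dirichlet kernel, up to sign (`extProj_amplify`), and the good part after
further steps depends only on the good part before (`goodProj_stepOp`). The factor `γ` thus stays a
scalar, and the algorithm only has to track its modulus by a number `b`. The extra scaling qubit
makes the chain start at amplitude `u` instead of `1`.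

The small target `u` serves two purposes. At angles at most `u` the kernel is nearly constant, so an
angle error of relative size `ε` changes it only by a factor `1 ± O(ε * u ^ 2)`. Moreover `2 * k +
1` times the cost buys at least `(2 * k + 1) * (1 - u ^ 2)` times the amplitude
(`amplifyIter_spec`). Since `L * u ^ 2 ≤ 1 / 16`, both losses stay bounded over all stages. The
ratio of circuit cost to `‖γ‖` is then bounded by a multiple of `costSum`, that is of `(1 + ∑ 2 ^ i
* a_i) / u`, and the tail bound makes the sum at most of order `2 ^ L * √p + L * T`.

A stage needs about cost / (`ε` * angle) operations. For `t * √p ≥ 2` this fits into one budget for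
all `p`, by the previous bound. For smaller `t` the output `0` is admissible, so giving up when the
budget is too small does no harm (`le_prob_stage`, `le_prob_stages`).

Angles are found without phase estimation. If an interval contains the angle, some odd multiple of
it lies in a single monotone branch of `sin ^ 2` and has length bounded below (`exists_window`). A
constant-accuracy frequency estimate, certified by a Chernoff bound (`le_prob_sample`), then halves
the interval. The numbers of repetitions grow linearly in the number of rounds left, so no extra
logarithm of the accuracy appears (`cost_estimate`). -/

noncomputable section
namespace VarTime
open Function (update)

/-! ### Two-qubit gates and reversible Boolean gates built from them. -/

section Gates

variable {m w : ℕ} {H : Type u} [NormedAddCommGroup H] [InnerProductSpace ℂ H]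

/-- The matrix of the two-qubit gate that applies `M a` to the second qubit if the first one is in
the basis state `a`. -/
def blockMatrix (M : Bool → Matrix Bool Bool ℂ) : Matrix (Bool × Bool) (Bool × Bool) ℂ :=
  fun p q => if p.1 = q.1 then M p.1 p.2 q.2 else 0

theorem blockMatrix_mem (M : Bool → Matrix.unitaryGroup Bool ℂ) :
    blockMatrix (fun a => (M a : Matrix Bool Bool ℂ)) ∈ Matrix.unitaryGroup (Bool × Bool) ℂ := by
  have hM : ∀ a i j, ∑ k, (M a).1 i k * star ((M a).1 j k) = if i = j then 1 else 0 := by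
    intro a i j
    have h := congrFun (congrFun (Matrix.mem_unitaryGroup_iff.1 (M a).2) i) j
    rw [Matrix.mul_apply, Matrix.one_apply] at h
    simpa [Matrix.star_apply] using h
  rw [Matrix.mem_unitaryGroup_iff]
  ext ⟨a, i⟩ ⟨b, j⟩
  rw [Matrix.mul_apply, Fintype.sum_prod_type, Matrix.one_apply]
  simp only [blockMatrix, Matrix.star_apply]
  rw [Finset.sum_eq_single a (by intro c _ hc; simp [Ne.symm hc]) (by simp)]
  by_cases hab : a = b
  · subst hab
    simpa using hM a i j
  · simp [hab, Ne.symm hab]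

/-- The instruction applying `M a` to the qubit `t` if the qubit `c` is in the state `a`
(nothing happens if `c = t`). -/
def ctrlGate (c t : Fin m ⊕ Fin w) (M : Bool → Matrix.unitaryGroup Bool ℂ) : List (Instr m w) :=
  if h : c ≠ t then [.gate c t h ⟨_, blockMatrix_mem M⟩] else []

/-- The effect of a list of instructions. -/
def run (U : VariableTimeAlgorithm m H) (P : H →L[ℂ] H) (l : List (Instr m w)) (ψ : Mem m w H) :
    Mem m w H :=
  l.foldl (fun ψ g => g.apply U P ψ) ψ

variable (U : VariableTimeAlgorithm m H) (P : H →L[ℂ] H)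

@[simp] theorem run_nil (ψ : Mem m w H) : run U P [] ψ = ψ := rfl

@[simp] theorem run_cons (g : Instr m w) (l : List (Instr m w)) (ψ : Mem m w H) :
    run U P (g :: l) ψ = run U P l (g.apply U P ψ) := rfl

@[simp] theorem run_append (l l' : List (Instr m w)) (ψ : Mem m w H) :
    run U P (l ++ l') ψ = run U P l' (run U P l ψ) := by
  simp [run, List.foldl_append]

@[simp] theorem component_ofComponents (φ : (Fin m ⊕ Fin w → Bool) → H)
    (z : Fin m ⊕ Fin w → Bool) : component (ofComponents φ) z = φ z := by
  simp only [component, ofComponents]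
  congr 1
  ext (i | i) <;> rfl

theorem ext_component {ψ ψ' : Mem m w H} (h : ∀ z, component ψ z = component ψ' z) : ψ = ψ' := by
  ext x f
  simpa [component] using h (Sum.elim f x)

theorem component_ctrlGate {c t : Fin m ⊕ Fin w} (h : c ≠ t)
    (M : Bool → Matrix.unitaryGroup Bool ℂ) (ψ : Mem m w H) (z : Fin m ⊕ Fin w → Bool) :
    component (run U P (ctrlGate c t M) ψ) z =
      ∑ b, (M (z c)).1 (z t) b • component ψ (update z t b) := by
  simp only [ctrlGate, dif_pos h, run_cons, run_nil, Instr.apply, gateOp, component_ofComponents,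
    blockMatrix]
  rw [Finset.sum_eq_single (z c) (by intro a _ ha; simp [Ne.symm ha]) (by simp)]
  simp

/-- The Pauli matrix `X`. -/
def pauliX : Matrix.unitaryGroup Bool ℂ :=
  ⟨.of fun a b => if a = b then 0 else 1, by
    rw [Matrix.mem_unitaryGroup_iff]
    ext a b
    cases a <;> cases b <;> simp [Matrix.mul_apply, Matrix.star_apply]⟩

/-- The Pauli matrix `Z`. -/
def pauliZ : Matrix.unitaryGroup Bool ℂ :=
  ⟨.of fun a b => if a = b then (if a then -1 else 1) else 0, by
    rw [Matrix.mem_unitaryGroup_iff]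
    ext a b
    cases a <;> cases b <;> simp [Matrix.mul_apply, Matrix.star_apply]⟩

/-- A square root of the Pauli matrix `X`. -/
def sqrtX : Matrix.unitaryGroup Bool ℂ :=
  ⟨.of fun a b => if a = b then (1 + Complex.I) / 2 else (1 - Complex.I) / 2, by
    rw [Matrix.mem_unitaryGroup_iff]
    ext a b
    cases a <;> cases b <;>
      simp [Matrix.mul_apply, Matrix.star_apply, Complex.ext_iff, Complex.conj_ofNat] <;> norm_num⟩

/-- The Hadamard matrix. -/
def hadamard : Matrix.unitaryGroup Bool ℂ :=
  ⟨.of fun a b => if a && b then -((√2 : ℝ) : ℂ)⁻¹ else ((√2 : ℝ) : ℂ)⁻¹, by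
    have h : ((√2 : ℝ) : ℂ)⁻¹ * ((√2 : ℝ) : ℂ)⁻¹ = 1 / 2 := by
      rw [← mul_inv, ← Complex.ofReal_mul, Real.mul_self_sqrt (by norm_num)]; norm_num
    rw [Matrix.mem_unitaryGroup_iff]
    ext a b
    cases a <;> cases b <;>
      simp [Matrix.mul_apply, Matrix.star_apply, Complex.conj_ofReal, h] <;> norm_num⟩

/-- The rotation by the angle `x`. -/
def rotation (x : ℝ) : Matrix.unitaryGroup Bool ℂ :=
  ⟨.of fun a b => if a = b then (Real.cos x : ℂ) else
    (if a then (Real.sin x : ℂ) else -(Real.sin x : ℂ)),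
  by
    have h : (Real.cos x : ℂ) * Real.cos x + Real.sin x * Real.sin x = 1 := by
      norm_cast
      nlinarith [Real.sin_sq_add_cos_sq x]
    rw [Matrix.mem_unitaryGroup_iff]
    ext a b
    cases a <;> cases b <;>
      simp only [Matrix.mul_apply, Matrix.star_apply, Fintype.sum_bool, Matrix.one_apply] <;>
      simp [-Complex.ofReal_cos, -Complex.ofReal_sin, Complex.conj_ofReal] <;> first | ring1 | linear_combination h⟩

/-- Negation of a qubit (`c` is any other qubit). -/
def notGate (c t : Fin m ⊕ Fin w) : List (Instr m w) := ctrlGate c t fun _ => pauliX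

/-- The `CNOT` gate. -/
def cnot (c t : Fin m ⊕ Fin w) : List (Instr m w) :=
  ctrlGate c t fun b => if b then pauliX else 1

/-- The Toffoli gate, from two-qubit gates. -/
def toffoli (a b t : Fin m ⊕ Fin w) : List (Instr m w) :=
  ctrlGate b t (fun x => if x then sqrtX else 1) ++ cnot a b ++
    ctrlGate b t (fun x => if x then sqrtX⁻¹ else 1) ++ cnot a b ++
    ctrlGate a t (fun x => if x then sqrtX else 1)

/-- The instructions `l` add the value `F` to the qubit `t`. -/
def Toggles (l : List (Instr m w)) (t : Fin m ⊕ Fin w)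
    (F : (Fin m ⊕ Fin w → Bool) → Bool) : Prop :=
  ∀ ψ z, component (run U P l ψ) z = component ψ (update z t (xor (z t) (F z)))

theorem toggles_not {c t : Fin m ⊕ Fin w} (h : c ≠ t) :
    Toggles U P (notGate c t) t fun _ => true := by
  intro ψ z
  rw [notGate, component_ctrlGate U P h]
  cases z t <;> simp [pauliX]

theorem toggles_cnot {c t : Fin m ⊕ Fin w} (h : c ≠ t) :
    Toggles U P (cnot c t) t fun z => z c := by
  intro ψ z
  rw [cnot, component_ctrlGate U P h]
  cases hc : z c <;> cases ht : z t <;> simp [pauliX, hc, ht]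

/-- The target undergoes `√X` to the power `b - (a ⊕ b) + a = 2 * a * b`, that is, `X` exactly if
both controls are set. -/
theorem toggles_toffoli {a b t : Fin m ⊕ Fin w} (hab : a ≠ b) (hat : a ≠ t) (hbt : b ≠ t) :
    Toggles U P (toffoli a b t) t fun z => z a && z b := by
  intro ψ z
  have hc := toggles_cnot U P (H := H) hab
  -- The two `cnot`s restore `b`, so the accumulated updates collapse to a single one at `t`.
  have hu : ∀ c₁ c₂ c₃ c₄ c₅ : Bool, z b = c₄ →
      update (update (update (update (update z t c₁) b c₂) t c₃) b c₄) t c₅ = update z t c₅ := by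
    rintro c₁ c₂ c₃ c₄ c₅ rfl
    ext x
    by_cases hxt : x = t <;> by_cases hxb : x = b <;>
      simp_all [Function.update_apply]
  simp only [toffoli, run_append]
  rw [component_ctrlGate U P hat]
  simp only [hc _ _, component_ctrlGate U P hbt]
  cases ha : z a <;> cases hb : z b <;> cases ht : z t <;>
    simp only [ne_eq, hat, hbt, hbt.symm, hab, not_false_eq_true, Function.update_of_ne, ha, hb,
      Function.update_self, Fintype.sum_bool, sqrtX, Matrix.of_apply, Bool.false_xor,
      Bool.true_xor, Bool.not_true, Bool.not_false, Bool.and_true, Bool.and_false, if_true,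
      Matrix.UnitaryGroup.inv_val, Matrix.star_apply, hu, Bool.xor_false] <;>
    simp only [Bool.false_eq_true, if_false, Submonoid.coe_one, OneMemClass.coe_one,
      Matrix.one_apply, reduceCtorEq, zero_smul, one_smul, zero_add, add_zero, if_true,
      Matrix.star_apply, Matrix.of_apply, hu]
  all_goals (match_scalars <;> simp [Complex.ext_iff, Complex.conj_ofNat] <;> norm_num)

end Gates

/-! ### Work qubits whose contents are functions of the flags and the scaling qubit. -/

section Layout

variable {m : ℕ} {H : Type u} [NormedAddCommGroup H] [InnerProductSpace ℂ H]

/-- `H_F ⊗ H_C` with one more qubit, which scales amplitudes down. -/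
abbrev Ext (m : ℕ) (H : Type u) : Type u := PiLp 2 (fun _ : Bool => Sys m H)

/-- The work qubits: `0, …, m` are used for conjunctions of flags, `m + 1` is the scaling qubit,
`m + 2` is always in the state `1`, and `m + 3` is used in tests. -/
def anc (m i : ℕ) : Fin (m + 4) := ⟨min i (m + 3), by omega⟩

theorem anc_inj {i j : ℕ} (hi : i ≤ m + 3) (hj : j ≤ m + 3) : anc m i = anc m j ↔ i = j := by
  simp only [anc, Fin.mk.injEq]
  omega

/-- The work qubit `i` as a qubit. -/
abbrev wq (m i : ℕ) : Fin m ⊕ Fin (m + 4) := Sum.inr (anc m i)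

theorem wq_ne {i j : ℕ} (hi : i ≤ m + 3) (hj : j ≤ m + 3) (h : i ≠ j) : wq m i ≠ wq m j := by
  simpa [wq, anc_inj hi hj] using h

/-- Contents of the work qubits, as a function of the scaling qubit and the flags. -/
abbrev Content (m : ℕ) : Type := Bool → (Fin m → Bool) → Fin (m + 4) → Bool

/-- The memory state `∑ |A b f⟩|f⟩ ψ(b, f)`. -/
def emb (A : Content m) (ψ : Ext m H) : Mem m (m + 4) H :=
  WithLp.toLp 2 fun x => WithLp.toLp 2 fun f =>
    if x = A (x (anc m (m + 1))) f then ψ (x (anc m (m + 1))) f else 0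

theorem component_emb (A : Content m) (ψ : Ext m H) (z : Fin m ⊕ Fin (m + 4) → Bool) :
    component (emb A ψ) z =
      if (z ∘ Sum.inr) = A (z (wq m (m + 1))) (z ∘ Sum.inl)
      then ψ (z (wq m (m + 1))) (z ∘ Sum.inl) else 0 := rfl

/-- The basis state of all qubits given by contents of the work qubits. -/
def Content.state (A : Content m) (b : Bool) (f : Fin m → Bool) : Fin m ⊕ Fin (m + 4) → Bool :=
  Sum.elim f (A b f)

/-- Contents of the work qubits after adding `F` to the work qubit `i`. -/
def Content.toggle (A : Content m) (i : ℕ) (F : (Fin m ⊕ Fin (m + 4) → Bool) → Bool) : Content m :=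
  fun b f => update (A b f) (anc m i) (xor (A b f (anc m i)) (F (A.state b f)))

variable (U : VariableTimeAlgorithm m H) (P : H →L[ℂ] H)

/-- The instructions `l` transform the contents `A` to `A'`. -/
def Moves (l : List (Instr m (m + 4))) (A A' : Content m) : Prop :=
  ∀ ψ : Ext m H, run U P l (emb A ψ) = emb A' ψ

/-- Contents of work qubits that are consistent with the scaling qubit. -/
def Content.Ok (A : Content m) : Prop := ∀ b f, A b f (anc m (m + 1)) = b

variable {U P}

theorem Moves.trans {l l' : List (Instr m (m + 4))} {A A' A'' : Content m}
    (h : Moves U P l A A') (h' : Moves U P l' A' A'') : Moves U P (l ++ l') A A'' := by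
  intro ψ
  rw [run_append, h ψ, h' ψ]

/-- As `F` ignores the target qubit, adding it is an involution, so the basis states in the support
correspond one to one. The bound `i ≤ m` keeps the target away from the scaling qubit, which indexes
the components of `ψ`. -/
theorem moves_toggle {l : List (Instr m (m + 4))} {i : ℕ} (hi : i ≤ m)
    {F : (Fin m ⊕ Fin (m + 4) → Bool) → Bool} (hl : Toggles U P l (wq m i) F)
    (hF : ∀ z b, F (update z (wq m i) b) = F z) (A : Content m) :
    Moves U P l A (A.toggle i F) := by
  intro ψ
  apply ext_component
  intro z
  have hs : wq m (m + 1) ≠ wq m i := wq_ne (by omega) (by omega) (by omega)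
  have hs' : anc m (m + 1) ≠ anc m i := by rw [Ne, anc_inj] <;> omega
  obtain ⟨f, x, rfl⟩ : ∃ f x, z = Sum.elim f x :=
    ⟨z ∘ Sum.inl, z ∘ Sum.inr, (Sum.elim_comp_inl_inr z).symm⟩
  rw [hl, component_emb, component_emb, Function.update_of_ne hs]
  have e3 : ∀ (y : Fin (m + 4) → Bool) c, update (Sum.elim f y) (wq m i) c =
      Sum.elim f (update y (anc m i) c) := fun y c => Sum.update_elim_inr
  have hF' : ∀ (y : Fin (m + 4) → Bool) c, F (Sum.elim f (update y (anc m i) c)) =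
      F (Sum.elim f y) := fun y c => by rw [← e3, hF]
  rw [e3, Sum.elim_comp_inl, Sum.elim_comp_inr, Sum.elim_comp_inl, Sum.elim_comp_inr]
  congr 1
  simp only [Sum.elim_inr, eq_iff_iff]
  constructor
  · intro h
    simp only [Content.toggle, Content.state, ← h, hF']
    simp
  · intro h
    have hA : x = update (A (x (anc m (m + 1))) f) (anc m i)
      (xor (A (x (anc m (m + 1))) f (anc m i)) (F (Sum.elim f (A (x (anc m (m + 1))) f)))) := h
    have h2 : F (Sum.elim f x) = F (Sum.elim f (A (x (anc m (m + 1))) f)) := by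
      conv_lhs => rw [hA]
      exact hF' _ _
    have h3 : x (anc m i) = xor (A (x (anc m (m + 1))) f (anc m i))
        (F (Sum.elim f (A (x (anc m (m + 1))) f))) := by
      conv_lhs => rw [hA]
      simp
    rw [h2, h3]
    simp only [Bool.xor_assoc, Bool.xor_self, Bool.xor_false]
    generalize A (x (anc m (m + 1))) f = y at hA
    rw [hA]; simp

theorem moves_toggle' {l : List (Instr m (m + 4))} {i : ℕ} (hi : i ≤ m)
    {F : (Fin m ⊕ Fin (m + 4) → Bool) → Bool} (hl : Toggles U P l (wq m i) F)
    (hF : ∀ z b, F (update z (wq m i) b) = F z) (A : Content m) :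
    Moves U P l (A.toggle i F) A := by
  have h := moves_toggle hi hl hF (A.toggle i F)
  convert h using 1
  funext b f
  have e3 : ∀ (y : Fin (m + 4) → Bool) c, update (Sum.elim f y) (wq m i) c =
      Sum.elim f (update y (anc m i) c) := fun y c => Sum.update_elim_inr
  simp only [Content.toggle, Content.state]
  rw [← e3, hF]
  simp

/-- `l` transforms the contents `A` to `A'`, and `l'` reverses this. -/
def Computes (U : VariableTimeAlgorithm m H) (P : H →L[ℂ] H) (l l' : List (Instr m (m + 4)))
    (A A' : Content m) : Prop := Moves U P l A A' ∧ Moves U P l' A' A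

theorem Computes.trans {l₁ l₁' l₂ l₂' : List (Instr m (m + 4))} {A A' A'' : Content m}
    (h : Computes U P l₁ l₁' A A') (h' : Computes U P l₂ l₂' A' A'') :
    Computes U P (l₁ ++ l₂) (l₂' ++ l₁') A A'' :=
  ⟨h.1.trans h'.1, h'.2.trans h.2⟩

theorem computes_toggle {l : List (Instr m (m + 4))} {i : ℕ} (hi : i ≤ m)
    {F : (Fin m ⊕ Fin (m + 4) → Bool) → Bool} (hl : Toggles U P l (wq m i) F)
    (hF : ∀ z b, F (update z (wq m i) b) = F z) (A : Content m) :
    Computes U P l l A (A.toggle i F) :=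
  ⟨moves_toggle hi hl hF A, moves_toggle' hi hl hF A⟩

/-- The result of `cnot (wq m j) (wq m i)`. -/
abbrev Content.cnot (A : Content m) (j i : ℕ) : Content m := A.toggle i fun z => z (wq m j)

theorem computes_cnot {i j : ℕ} (hi : i ≤ m) (hj : j ≤ m + 3) (h : j ≠ i) (A : Content m) :
    Computes U P (cnot (wq m j) (wq m i)) (cnot (wq m j) (wq m i)) A (A.cnot j i) := by
  have hne : wq m j ≠ wq m i := wq_ne hj (by omega) h
  exact computes_toggle hi (toggles_cnot U P hne)
    (fun z b => by rw [Function.update_of_ne hne]) A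

theorem computes_not {i : ℕ} (hi : i ≤ m) (A : Content m) :
    Computes U P (notGate (wq m (m + 3)) (wq m i)) (notGate (wq m (m + 3)) (wq m i)) A
      (A.toggle i fun _ => true) :=
  computes_toggle hi (toggles_not U P (wq_ne (by omega) (by omega) (by omega)))
    (fun z b => rfl) A

/-- Compute into the work qubit `k` the conjunction of the work qubit `0` and the negations of the
first `k` flags. -/
def andFlags (m : ℕ) : ℕ → List (Instr m (m + 4))
  | 0 => []
  | k + 1 => andFlags m k ++ if h : k < m then
      toffoli (wq m k) (Sum.inl ⟨k, h⟩) (wq m (k + 1)) ++ cnot (wq m k) (wq m (k + 1)) else []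

/-- The inverse of `andFlags`. -/
def andFlagsInv (m : ℕ) : ℕ → List (Instr m (m + 4))
  | 0 => []
  | k + 1 => (if h : k < m then
      cnot (wq m k) (wq m (k + 1)) ++ toffoli (wq m k) (Sum.inl ⟨k, h⟩) (wq m (k + 1)) else []) ++
      andFlagsInv m k

/-- Each round turns a clean qubit into `(w ∧ f) ⊕ w = w ∧ ¬f`, where `w` is the previous
conjunction and `f` the next flag. The contents `A'` are chosen before `U` and `P`, because the
circuit must not depend on them. -/
theorem exists_computes_andFlags (k : ℕ) (hk : k ≤ m) (A : Content m)
    (hA : ∀ b f i, 1 ≤ i → i ≤ m → A b f (anc m i) = false) :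
    ∃ A' : Content m,
      (∀ (U : VariableTimeAlgorithm m H) (P : H →L[ℂ] H),
        Computes U P (andFlags m k) (andFlagsInv m k) A A') ∧
      (∀ b f, A' b f (anc m k) = (A b f (anc m 0) && decide (∀ j : Fin m, j < k → f j = false))) ∧
      (∀ b f i, i = 0 ∨ k < i → i ≤ m + 3 → A' b f (anc m i) = A b f (anc m i)) := by
  induction k with
  | zero =>
    refine ⟨A, fun U P => ⟨fun ψ => rfl, fun ψ => rfl⟩, fun b f => ?_, fun b f i _ _ => rfl⟩
    simp
  | succ k ih =>
    obtain ⟨A', h1, h2, h3⟩ := ih (by omega)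
    have hk' : k < m := by omega
    have hne : wq m k ≠ wq m (k + 1) := wq_ne (by omega) (by omega) (by omega)
    have hne' : anc m k ≠ anc m (k + 1) := by rw [Ne, anc_inj] <;> omega
    refine ⟨(A'.toggle (k + 1) fun z => z (wq m k) && z (Sum.inl ⟨k, hk'⟩)).cnot k (k + 1),
      fun U P => ?_, fun b f => ?_, fun b f i hi hi' => ?_⟩
    · rw [andFlags, andFlagsInv, dif_pos hk', dif_pos hk']
      refine (h1 U P).trans (Computes.trans ?_ (computes_cnot hk (by omega) (by omega) _))
      exact computes_toggle hk (toggles_toffoli U P (by simp) hne (by simp))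
        (fun z b => by rw [Function.update_of_ne hne, Function.update_of_ne (by simp)]) _
    · have h4 : A' b f (anc m (k + 1)) = false := by
        rw [h3 b f _ (by omega) (by omega), hA b f _ (by omega) hk]
      simp only [Content.cnot, Content.toggle, Content.state, Function.update_self,
        Sum.elim_inr, Sum.elim_inl, Function.update_of_ne hne', h2, h4]
      have h5 : (∀ j : Fin m, (j : ℕ) < k + 1 → f j = false) ↔
          (∀ j : Fin m, (j : ℕ) < k → f j = false) ∧ f ⟨k, hk'⟩ = false := by
        constructor
        · exact fun h => ⟨fun j hj => h j (by omega), h _ (by simp)⟩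
        · rintro ⟨h, h'⟩ j hj
          by_cases hjk : (j : ℕ) = k
          · rw [← h']; congr 1; exact Fin.ext hjk
          · exact h j (by omega)
      rw [show decide (∀ j : Fin m, (j : ℕ) < k + 1 → f j = false) =
        (decide (∀ j : Fin m, (j : ℕ) < k → f j = false) && !f ⟨k, hk'⟩) by
          rw [decide_eq_decide.2 h5, Bool.decide_and]; cases f ⟨k, hk'⟩ <;> rfl]
      generalize decide (∀ j : Fin m, (j : ℕ) < k → f j = false) = y
      cases A b f (anc m 0) <;> cases y <;> cases f ⟨k, hk'⟩ <;> rfl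
    · have hne2 : anc m i ≠ anc m (k + 1) := by rw [Ne, anc_inj] <;> omega
      simp only [Content.cnot, Content.toggle, Function.update_of_ne hne2]
      exact h3 b f i (by omega) hi'

/-- The state of `Ext m H` with given components. -/
def extMk (φ : Bool → (Fin m → Bool) → H) : Ext m H :=
  WithLp.toLp 2 fun b => WithLp.toLp 2 fun f => φ b f

@[simp] theorem extMk_apply (φ : Bool → (Fin m → Bool) → H) (b f) : extMk φ b f = φ b f := rfl

theorem ext_ext {ψ ψ' : Ext m H} (h : ∀ b f, ψ b f = ψ' b f) : ψ = ψ' := by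
  ext b f
  exact h b f

theorem run_reflProj (A : Content m) (i : ℕ) (ψ : Ext m H) :
    run U P [.reflProj (anc m i)] (emb A ψ) = emb A (extMk fun b f =>
      if A b f (anc m i) then ψ b f - (2 : ℂ) • P (ψ b f) else ψ b f) := by
  apply ext_component
  intro z
  simp only [run_cons, run_nil, Instr.apply, component, controlled, onC, emb, extMk]
  by_cases h : (fun j => z (Sum.inr j)) = A (z (wq m (m + 1))) (fun j => z (Sum.inl j))
  · have h' := congrFun h (anc m i)
    by_cases h2 : A (z (wq m (m + 1))) (fun j => z (Sum.inl j)) (anc m i) <;> simp [h, h', h2]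
  · by_cases h2 : z (Sum.inr (anc m i)) <;> simp [h, h2]

theorem run_reflZero (A : Content m) (i : ℕ) (ψ : Ext m H) :
    run U P [.reflZero (anc m i)] (emb A ψ) = emb A (extMk fun b f =>
      if A b f (anc m i) then ψ b f - (2 * inner ℂ U.zero (ψ b f)) • U.zero else ψ b f) := by
  apply ext_component
  intro z
  simp only [run_cons, run_nil, Instr.apply, component, controlled, onC, emb, extMk]
  by_cases h : (fun j => z (Sum.inr j)) = A (z (wq m (m + 1))) (fun j => z (Sum.inl j))
  · have h' := congrFun h (anc m i)
    by_cases h2 : A (z (wq m (m + 1))) (fun j => z (Sum.inl j)) (anc m i) <;> simp [h, h', h2]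
  · by_cases h2 : z (Sum.inr (anc m i)) <;> simp [h, h2]

/-- The gate `Z`. -/
def zGate (m i : ℕ) : List (Instr m (m + 4)) := ctrlGate (wq m (m + 3)) (wq m i) fun _ => pauliZ

theorem run_zGate (A : Content m) {i : ℕ} (hi : i ≤ m) (ψ : Ext m H) :
    run U P (zGate m i) (emb A ψ) = emb A (extMk fun b f =>
      if A b f (anc m i) then -ψ b f else ψ b f) := by
  apply ext_component
  intro z
  rw [zGate, component_ctrlGate _ _ (wq_ne (by omega) (by omega) (by omega))]
  have h1 : ∑ b, (pauliZ.1 (z (wq m i)) b) • component (emb A ψ) (update z (wq m i) b) =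
      if z (wq m i) then -component (emb A ψ) z else component (emb A ψ) z := by
    have h2 := Function.update_eq_self (wq m i) z
    cases h : z (wq m i) <;> rw [h] at h2 <;> simp [pauliZ, h2]
  rw [h1, component_emb, component_emb]
  by_cases h : z ∘ Sum.inr = A (z (wq m (m + 1))) (z ∘ Sum.inl)
  · have h' := congrFun h (anc m i)
    simp only [Function.comp_apply] at h'
    rw [if_pos h, if_pos h, extMk_apply, h']
  · simp [h]

end Layout

/-! ### Unitarity of steps, reflections and rotations. -/

section Isometries

variable {m : ℕ} {H : Type u} [NormedAddCommGroup H] [InnerProductSpace ℂ H]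

/-- Every string is reached from both values of its bit `i`, hence the factor `2`. This lets norms
be compared on pairs of basis states that differ only in flag `i`, where a step acts as an isometry.
-/
theorem sum_sum_update (i : Fin m) (F : (Fin m → Bool) → ℝ) :
    ∑ f : Fin m → Bool, ∑ b, F (update f i b) = 2 * ∑ f, F f := by
  have h : ∀ b, ∑ f : Fin m → Bool, F (update f i (xor (f i) b)) = ∑ f, F f := by
    intro b
    refine Fintype.sum_equiv (Function.Involutive.toPerm
      (fun f : Fin m → Bool => update f i (xor (f i) b)) ?_) _ _ (fun f => rfl)
    intro f
    simp [Bool.xor_assoc]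
  have h' : ∀ f : Fin m → Bool, ∑ b, F (update f i b) = ∑ b, F (update f i (xor (f i) b)) := by
    intro f
    cases f i <;> simp [add_comm]
  simp_rw [h']
  rw [Finset.sum_comm]
  simp_rw [h]
  simp

theorem stepOp_update (i : Fin m) (V : FlagSpace H ≃ₗᵢ[ℂ] FlagSpace H) (ψ : Sys m H)
    (f : Fin m → Bool) (b : Bool) : stepOp i V ψ (update f i b) =
      if ∀ j < i, f j = false then V (WithLp.toLp 2 fun b => ψ (update f i b)) b
      else ψ (update f i b) := by
  have : (∀ j < i, update f i b j = false) ↔ ∀ j < i, f j = false :=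
    forall₂_congr fun j hj => by rw [Function.update_of_ne hj.ne]
  simp [stepOp, this]

theorem stepOp_stepOp (i : Fin m) (V V' : FlagSpace H ≃ₗᵢ[ℂ] FlagSpace H)
    (h : ∀ x, V (V' x) = x) (ψ : Sys m H) : stepOp i V (stepOp i V' ψ) = ψ := by
  ext f
  rw [← Function.update_eq_self i f, stepOp_update]
  split_ifs with hf
  · simp_rw [stepOp_update, if_pos hf]
    exact congrArg (fun x : FlagSpace H => x (f i)) (h _)
  · rw [stepOp_update, if_neg hf]

theorem norm_stepOp (i : Fin m) (V : FlagSpace H ≃ₗᵢ[ℂ] FlagSpace H) (ψ : Sys m H) :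
    ‖stepOp i V ψ‖ = ‖ψ‖ := by
  rw [← sq_eq_sq₀ (norm_nonneg _) (norm_nonneg _), PiLp.norm_sq_eq_of_L2, PiLp.norm_sq_eq_of_L2]
  have h := sum_sum_update i fun f => ‖stepOp i V ψ f‖ ^ 2
  rw [← mul_right_inj' (two_ne_zero (α := ℝ)), ← h, ← sum_sum_update i]
  refine Finset.sum_congr rfl fun f _ => ?_
  simp_rw [stepOp_update]
  split_ifs with hf
  · have h2 := V.norm_map (WithLp.toLp 2 fun b => ψ (update f i b))
    rw [← sq_eq_sq₀ (norm_nonneg _) (norm_nonneg _), PiLp.norm_sq_eq_of_L2,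
      PiLp.norm_sq_eq_of_L2] at h2
    exact h2
  · rfl

/-- The operator `stepOp i V` as a unitary. -/
def stepIso (i : Fin m) (V : FlagSpace H ≃ₗᵢ[ℂ] FlagSpace H) : Sys m H ≃ₗᵢ[ℂ] Sys m H where
  toFun := stepOp i V
  invFun := stepOp i V.symm
  map_add' ψ ψ' := by
    ext f
    simp only [stepOp, PiLp.add_apply]
    split_ifs with hf
    · rw [← PiLp.add_apply, ← map_add]; rfl
    · rfl
  map_smul' c ψ := by
    ext f
    simp only [stepOp, PiLp.smul_apply, RingHom.id_apply]
    split_ifs with hf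
    · rw [← PiLp.smul_apply, ← map_smul]; rfl
    · rfl
  left_inv := stepOp_stepOp i _ _ (by simp)
  right_inv := stepOp_stepOp i _ _ (by simp)
  norm_map' := norm_stepOp i V

@[simp] theorem stepIso_apply (i : Fin m) (V : FlagSpace H ≃ₗᵢ[ℂ] FlagSpace H) (ψ : Sys m H) :
    stepIso i V ψ = stepOp i V ψ := rfl

/-- A linear isometric involution. -/
def isoOfInvolutive {E : Type*} [NormedAddCommGroup E] [InnerProductSpace ℂ E] (f : E →ₗ[ℂ] E)
    (hf : ∀ x, f (f x) = x) (hn : ∀ x, ‖f x‖ = ‖x‖) : E ≃ₗᵢ[ℂ] E where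
  toFun := f
  invFun := f
  map_add' := f.map_add
  map_smul' := f.map_smul
  left_inv := hf
  right_inv := hf
  norm_map' := hn

/-- The hypothesis holds when `y` is the orthogonal projection of `x`; both reflections are
instances. -/
theorem norm_sub_two_smul {E : Type*} [NormedAddCommGroup E] [InnerProductSpace ℂ E] {x y : E}
    (h : inner ℂ y x = inner ℂ y y) : ‖x - (2 : ℂ) • y‖ = ‖x‖ := by
  have h1 : RCLike.re (inner ℂ x y) = ‖y‖ ^ 2 := by
    rw [inner_re_symm, h, inner_self_eq_norm_sq]
  rw [← sq_eq_sq₀ (norm_nonneg _) (norm_nonneg _), norm_sub_sq (𝕜 := ℂ), inner_smul_right,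
    norm_smul]
  have h2 : RCLike.re ((2 : ℂ) * inner ℂ x y) = 2 * ‖y‖ ^ 2 := by
    rw [← h1]; simp
  rw [h2]
  norm_num
  ring

/-- The reflection `I - 2|0⟩⟨0|`. -/
def reflZeroIso (U : VariableTimeAlgorithm m H) : H ≃ₗᵢ[ℂ] H :=
  have h : inner ℂ U.zero U.zero = (1 : ℂ) := by
    rw [inner_self_eq_norm_sq_to_K, U.norm_zero]; simp
  isoOfInvolutive (LinearMap.id - (2 : ℂ) • (LinearMap.toSpanSingleton ℂ H U.zero).comp
      (innerSL ℂ U.zero).toLinearMap)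
    (fun x => by
      simp [inner_sub_right, inner_smul_right, h, -inner_self_eq_norm_sq_to_K]
      module)
    (fun x => norm_sub_two_smul (by
      simp [inner_smul_left, inner_smul_right, h, -inner_self_eq_norm_sq_to_K]))

theorem reflZeroIso_apply (U : VariableTimeAlgorithm m H) (v : H) :
    reflZeroIso U v = v - (2 * inner ℂ U.zero v) • U.zero := by
  simp [reflZeroIso, isoOfInvolutive, smul_smul]

/-- The unitary of `Ext m H` that applies `e b f` to the component at `b`, `f`. -/
def diagIso (e : Bool → (Fin m → Bool) → (H ≃ₗᵢ[ℂ] H)) : Ext m H ≃ₗᵢ[ℂ] Ext m H :=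
  LinearIsometryEquiv.piLpCongrRight 2 fun b => LinearIsometryEquiv.piLpCongrRight 2 (e b)

theorem diagIso_apply (e : Bool → (Fin m → Bool) → (H ≃ₗᵢ[ℂ] H)) (ψ : Ext m H) (b f) :
    diagIso e ψ b f = e b f (ψ b f) := rfl

theorem norm_rotation {E : Type*} [NormedAddCommGroup E] [InnerProductSpace ℂ E] (c s : ℝ)
    (h : s ^ 2 + c ^ 2 = 1) (x y : E) :
    ‖(c : ℂ) • x + (-(s : ℂ)) • y‖ ^ 2 + ‖(s : ℂ) • x + (c : ℂ) • y‖ ^ 2 = ‖x‖ ^ 2 + ‖y‖ ^ 2 := by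
  rw [norm_add_sq (𝕜 := ℂ), norm_add_sq (𝕜 := ℂ), inner_smul_left, inner_smul_left,
    inner_smul_right, inner_smul_right]
  simp only [norm_smul, norm_neg, Complex.norm_real, Real.norm_eq_abs, mul_pow, sq_abs,
    Complex.conj_ofReal]
  have h1 : RCLike.re ((c : ℂ) * (-(s : ℂ) * inner ℂ x y)) +
      RCLike.re ((s : ℂ) * ((c : ℂ) * inner ℂ x y)) = 0 := by
    simp
    ring
  linear_combination (‖x‖ ^ 2 + ‖y‖ ^ 2) * h + 2 * h1

theorem norm_rotate {E : Type*} [NormedAddCommGroup E] [InnerProductSpace ℂ E] (x : ℝ)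
    (ψ : PiLp 2 fun _ : Bool => E) :
    ‖(WithLp.toLp 2 fun a => ∑ b, (rotation x).1 a b • ψ b : PiLp 2 fun _ : Bool => E)‖ = ‖ψ‖ := by
  rw [← sq_eq_sq₀ (norm_nonneg _) (norm_nonneg _), PiLp.norm_sq_eq_of_L2, PiLp.norm_sq_eq_of_L2]
  have h := norm_rotation (Real.cos x) (Real.sin x) (Real.sin_sq_add_cos_sq x) (ψ false) (ψ true)
  have e1 : (rotation x).1 false false = (Real.cos x : ℂ) := rfl
  have e2 : (rotation x).1 false true = -(Real.sin x : ℂ) := rfl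
  have e3 : (rotation x).1 true false = (Real.sin x : ℂ) := rfl
  have e4 : (rotation x).1 true true = (Real.cos x : ℂ) := rfl
  simp only [Fintype.sum_bool, e1, e2, e3, e4]
  rw [add_comm ((-(Real.sin x : ℂ)) • ψ true), add_comm ((Real.cos x : ℂ) • ψ true)]
  linarith only [h]

theorem rotate_rotate_neg {E : Type*} [NormedAddCommGroup E] [InnerProductSpace ℂ E] (x : ℝ)
    (ψ : PiLp 2 fun _ : Bool => E) (a : Bool) :
    ∑ b, (rotation x).1 a b • ∑ c, (rotation (-x)).1 b c • ψ c = ψ a := by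
  have h := Complex.sin_sq_add_cos_sq x
  cases a <;> simp [rotation] <;> match_scalars <;>
    first | ring1 | linear_combination h

/-- The rotation of a qubit. -/
def rotIso {E : Type*} [NormedAddCommGroup E] [InnerProductSpace ℂ E] (x : ℝ) :
    (PiLp 2 fun _ : Bool => E) ≃ₗᵢ[ℂ] (PiLp 2 fun _ : Bool => E) where
  toFun ψ := WithLp.toLp 2 fun a => ∑ b, (rotation x).1 a b • ψ b
  invFun ψ := WithLp.toLp 2 fun a => ∑ b, (rotation (-x)).1 a b • ψ b
  map_add' ψ ψ' := by
    ext a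
    simp
    module
  map_smul' c ψ := by
    ext a
    simp
    module
  left_inv ψ := by
    ext a
    have h := rotate_rotate_neg (-x) ψ a
    rw [neg_neg] at h
    exact h
  right_inv ψ := by
    ext a
    exact rotate_rotate_neg x ψ a
  norm_map' ψ := norm_rotate x ψ

theorem rotIso_apply {E : Type*} [NormedAddCommGroup E] [InnerProductSpace ℂ E] (x : ℝ)
    (ψ : PiLp 2 fun _ : Bool => E) (a : Bool) :
    rotIso x ψ a = ∑ b, (rotation x).1 a b • ψ b := rfl

theorem rotIso_neg {E : Type*} [NormedAddCommGroup E] [InnerProductSpace ℂ E] (x : ℝ) :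
    rotIso (E := E) (-x) = (rotIso x).symm := by
  ext ψ : 1
  rfl

variable [CompleteSpace H]

theorem starProjection_apply_apply {P : H →L[ℂ] H} (hP : IsStarProjection P) (x : H) :
    P (P x) = P x := congrArg (fun Q : H →L[ℂ] H => Q x) hP.isIdempotentElem

theorem starProjection_inner {P : H →L[ℂ] H} (hP : IsStarProjection P) (x y : H) :
    inner ℂ (P x) y = inner ℂ x (P y) := by
  rw [← ContinuousLinearMap.adjoint_inner_right, ← ContinuousLinearMap.star_eq_adjoint,
    hP.isSelfAdjoint.star_eq]

/-- The reflection `I - 2P`. -/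
def reflProjIso {P : H →L[ℂ] H} (hP : IsStarProjection P) : H ≃ₗᵢ[ℂ] H :=
  isoOfInvolutive (LinearMap.id - (2 : ℂ) • P.toLinearMap)
    (fun x => by
      simp [starProjection_apply_apply hP]
      module)
    (fun x => norm_sub_two_smul (by
      simp [starProjection_inner hP, starProjection_apply_apply hP,
        -inner_self_eq_norm_sq_to_K]))

theorem reflProjIso_apply {P : H →L[ℂ] H} (hP : IsStarProjection P) (v : H) :
    reflProjIso hP v = v - (2 : ℂ) • P v := by
  simp [reflProjIso, isoOfInvolutive]

end Isometries

/-! ### Elementary operations on the system with a scaling qubit, and their implementation. -/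

section Operations

variable {m : ℕ} {H : Type u} [NormedAddCommGroup H] [InnerProductSpace ℂ H]

/-- Operations on `Ext m H`: rotations of the scaling qubit, the steps and their inverses,
the reflection about the states that are not known to be bad after `n` steps, and the reflection
about the initial state, for the first `n` flags. -/
inductive Op (m : ℕ) : Type
  | rot (x : ℝ)
  | call (i : Fin m)
  | callInv (i : Fin m)
  | reflGood (n : ℕ)
  | reflInit (n : ℕ)

/-- The inverse operation. -/
def Op.inv : Op m → Op m
  | rot x => rot (-x)
  | call i => callInv i
  | callInv i => call i
  | reflGood n => reflGood n
  | reflInit n => reflInit n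

/-- The operation uses only the first `n` steps. -/
def Op.Below (n : ℕ) : Op m → Prop
  | rot _ => True
  | call i => i < n
  | callInv i => i < n
  | reflGood k => k ≤ m
  | reflInit k => k ≤ m

/-- Implementation of an operation by instructions. -/
def Op.compile : Op m → List (Instr m (m + 4))
  | rot x => ctrlGate (wq m (m + 2)) (wq m (m + 1)) fun _ => rotation x
  | call i => [.call (anc m (m + 2)) i]
  | callInv i => [.callInv (anc m (m + 2)) i]
  | reflGood n => (cnot (wq m (m + 1)) (wq m 0) ++ andFlags m n) ++
      (zGate m n ++ (cnot (wq m (m + 1)) (wq m n) ++ [.reflProj (anc m n)] ++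
        cnot (wq m (m + 1)) (wq m n))) ++ (andFlagsInv m n ++ cnot (wq m (m + 1)) (wq m 0))
  | reflInit n => (cnot (wq m (m + 1)) (wq m 0) ++ notGate (wq m (m + 3)) (wq m 0) ++
      andFlags m n) ++ [.reflZero (anc m n)] ++ (andFlagsInv m n ++
        (notGate (wq m (m + 3)) (wq m 0) ++ cnot (wq m (m + 1)) (wq m 0)))

/-- The contents of the work qubits between operations. -/
def baseContent (m : ℕ) : Content m :=
  fun b _ i => if i = anc m (m + 1) then b else decide (i = anc m (m + 2))

theorem baseContent_of_le (b : Bool) (f : Fin m → Bool) {i : ℕ} (hi : i ≤ m) :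
    baseContent m b f (anc m i) = false := by
  have h1 : anc m i ≠ anc m (m + 1) := by rw [Ne, anc_inj] <;> omega
  have h2 : anc m i ≠ anc m (m + 2) := by rw [Ne, anc_inj] <;> omega
  simp [baseContent, h1, h2]

theorem baseContent_scale (b : Bool) (f : Fin m → Bool) :
    baseContent m b f (anc m (m + 1)) = b := by
  simp [baseContent]

theorem baseContent_one (b : Bool) (f : Fin m → Bool) :
    baseContent m b f (anc m (m + 2)) = true := by
  have h1 : anc m (m + 2) ≠ anc m (m + 1) := by rw [Ne, anc_inj] <;> omega
  simp [baseContent, h1]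

theorem baseContent_test (b : Bool) (f : Fin m → Bool) :
    baseContent m b f (anc m (m + 3)) = false := by
  have h1 : anc m (m + 3) ≠ anc m (m + 1) := by rw [Ne, anc_inj] <;> omega
  have h2 : anc m (m + 3) ≠ anc m (m + 2) := by rw [Ne, anc_inj] <;> omega
  simp [baseContent, h1, h2]

variable (U : VariableTimeAlgorithm m H) (P : H →L[ℂ] H)

theorem run_conj {l l' D : List (Instr m (m + 4))} {A A' : Content m}
    (h : Computes U P l l' A A') {ψ ψ' : Ext m H} (hD : run U P D (emb A' ψ) = emb A' ψ') :
    run U P (l ++ D ++ l') (emb A ψ) = emb A ψ' := by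
  rw [run_append, run_append, h.1, hD, h.2]

/-- The flags `f` do not show a stop within the first `n` steps. -/
abbrev Running (n : ℕ) (f : Fin m → Bool) : Prop := ∀ j : Fin m, (j : ℕ) < n → f j = false

theorem exists_computes_scaled (n : ℕ) (hn : n ≤ m) :
    ∃ A : Content m, (∀ (U : VariableTimeAlgorithm m H) (P : H →L[ℂ] H),
        Computes U P (cnot (wq m (m + 1)) (wq m 0) ++ andFlags m n)
          (andFlagsInv m n ++ cnot (wq m (m + 1)) (wq m 0)) (baseContent m) A) ∧
      (∀ b f, A b f (anc m n) = (b && decide (Running n f))) ∧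
      (∀ b f i, m < i → i ≤ m + 3 → A b f (anc m i) = baseContent m b f (anc m i)) := by
  obtain ⟨A, h1, h2, h3⟩ := exists_computes_andFlags (H := H) n hn
    ((baseContent m).cnot (m + 1) 0) (by
      intro b f i hi hi'
      have h : anc m i ≠ anc m 0 := by rw [Ne, anc_inj] <;> omega
      simp [Content.cnot, Content.toggle, h, baseContent_of_le b f hi'])
  refine ⟨A, fun U P => (computes_cnot (by omega) (by omega) (by omega) _).trans (h1 U P),
    fun b f => ?_, fun b f i hi hi' => ?_⟩
  · rw [h2]
    simp [Content.cnot, Content.toggle, Content.state, baseContent_of_le, baseContent_scale]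
  · rw [h3 b f i (by omega) hi']
    have h : anc m i ≠ anc m 0 := by rw [Ne, anc_inj] <;> omega
    simp [Content.cnot, Content.toggle, h]

/-- Work qubit `0` holds the negated scaling qubit here, so qubit `n` controls on scaling qubit `0`
and no stop flag among the first `n`. -/
theorem run_reflInit (n : ℕ) (hn : n ≤ m) (ψ : Ext m H) :
    run U P (Op.reflInit n).compile (emb (baseContent m) ψ) = emb (baseContent m) (extMk fun b f =>
      if b = false ∧ Running n f then ψ b f - (2 * inner ℂ U.zero (ψ b f)) • U.zero
      else ψ b f) := by
  obtain ⟨A, h1, h2, h3⟩ := exists_computes_andFlags (H := H) n hn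
    (((baseContent m).cnot (m + 1) 0).toggle 0 fun _ => true) (by
      intro b f i hi hi'
      have h : anc m i ≠ anc m 0 := by rw [Ne, anc_inj] <;> omega
      simp [Content.cnot, Content.toggle, h, baseContent_of_le b f hi'])
  have hc := ((computes_cnot (U := U) (P := P) (show 0 ≤ m by omega) (show m + 1 ≤ m + 3 by omega)
    (by omega) (baseContent m)).trans (computes_not (by omega) _)).trans (h1 U P)
  refine run_conj U P hc ((run_reflZero A n ψ).trans ?_)
  congr 1
  refine ext_ext fun b f => ?_
  rw [extMk_apply, extMk_apply, h2]
  simp [Content.cnot, Content.toggle, Content.state, baseContent_of_le, baseContent_scale]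

/-- Qubit `n` holds `b ∧ Running n f`. The `Z` gate gives the sign `-1` to the running branches; the
`cnot` from the scaling qubit turns the content into `b ∧ ¬ Running n f`, which controls the
reflection `I - 2P` on the stopped ones. -/
theorem run_reflGood (n : ℕ) (hn : n ≤ m) (ψ : Ext m H) :
    run U P (Op.reflGood n).compile (emb (baseContent m) ψ) = emb (baseContent m) (extMk fun b f =>
      if b then (if Running n f then -ψ b f else ψ b f - (2 : ℂ) • P (ψ b f)) else ψ b f) := by
  obtain ⟨A, h1, h2, h3⟩ := exists_computes_scaled (H := H) n hn
  refine run_conj U P (h1 U P) ?_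
  rw [run_append, run_zGate A hn]
  refine (run_conj U P (computes_cnot hn (by omega) (by omega) A) (run_reflProj _ n _)).trans ?_
  congr 1
  refine ext_ext fun b f => ?_
  simp only [extMk_apply, Content.cnot, Content.toggle, Content.state, Function.update_self, h2,
    Sum.elim_inr, h3 b f (m + 1) (by omega) (by omega), baseContent_scale]
  by_cases h : Running n f
  · simp only [if_pos h, decide_eq_true h]
    cases b <;> simp
  · simp only [if_neg h, decide_eq_false h]
    cases b <;> simp

theorem run_rot (x : ℝ) (ψ : Ext m H) :
    run U P (Op.rot x).compile (emb (baseContent m) ψ) = emb (baseContent m) (rotIso x ψ) := by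
  apply ext_component
  intro z
  rw [Op.compile, component_ctrlGate _ _ (wq_ne (by omega) (by omega) (by omega))]
  simp only [component_emb, Function.update_self]
  have h1 : ∀ b, update z (wq m (m + 1)) b ∘ Sum.inl = z ∘ Sum.inl := by
    intro b; ext j; simp
  have h2 : ∀ b, (update z (wq m (m + 1)) b ∘ Sum.inr = baseContent m b (z ∘ Sum.inl)) ↔
      z ∘ Sum.inr = baseContent m (z (wq m (m + 1))) (z ∘ Sum.inl) := by
    intro b
    simp only [funext_iff, Function.comp_apply]
    refine forall_congr' fun i => ?_
    by_cases h : i = anc m (m + 1)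
    · subst h; simp [baseContent]
    · have : (Sum.inr i : Fin m ⊕ Fin (m + 4)) ≠ wq m (m + 1) := by simpa using h
      simp [Function.update_of_ne this, baseContent, h]
  simp only [h1, h2]
  by_cases h : z ∘ Sum.inr = baseContent m (z (wq m (m + 1))) (z ∘ Sum.inl)
  · simp only [if_pos h, rotIso_apply]
    simp
  · simp [h]

theorem stepOp_zero (i : Fin m) (V : FlagSpace H ≃ₗᵢ[ℂ] FlagSpace H) :
    stepOp i V (0 : Sys m H) = 0 := map_zero (stepIso i V)

theorem emb_apply_base (ψ : Ext m H) (x : Fin (m + 4) → Bool) :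
    emb (baseContent m) ψ x =
      if x = baseContent m (x (anc m (m + 1))) (fun _ => false) then ψ (x (anc m (m + 1)))
      else 0 := by
  ext f
  simp only [emb]
  have : baseContent m (x (anc m (m + 1))) f =
    baseContent m (x (anc m (m + 1))) (fun _ => false) := rfl
  rw [this]
  split_ifs <;> rfl

/-- Qubit `m + 2` always contains `1`, so the compulsory control of the instructions is void. Since
`baseContent` does not depend on the flags, `A` acts on whole components. -/
theorem controlled_emb (A : Sys m H → Sys m H) (hA : A 0 = 0) (ψ : Ext m H) :
    controlled (anc m (m + 2)) A (emb (baseContent m) ψ) =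
      emb (baseContent m) (WithLp.toLp 2 fun b => A (ψ b)) := by
  ext x : 1
  simp only [controlled, emb_apply_base]
  by_cases h : x = baseContent m (x (anc m (m + 1))) (fun _ => false)
  · have h2 := congrFun h (anc m (m + 2))
    rw [baseContent_one] at h2
    simp [← h, h2]
  · simp [h, hA]

variable [CompleteSpace H] {P} (hP : IsStarProjection P)

/-- The unitary of an operation. -/
def Op.iso : Op m → Ext m H ≃ₗᵢ[ℂ] Ext m H
  | rot x => rotIso x
  | call i => LinearIsometryEquiv.piLpCongrRight 2 fun _ => stepIso i (U.unitary i)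
  | callInv i => LinearIsometryEquiv.piLpCongrRight 2 fun _ => (stepIso i (U.unitary i)).symm
  | reflGood n => diagIso fun b f =>
      if b then (if Running n f then LinearIsometryEquiv.neg ℂ else reflProjIso hP)
      else LinearIsometryEquiv.refl ℂ H
  | reflInit n => diagIso fun b f =>
      if b = false ∧ Running n f then reflZeroIso U else LinearIsometryEquiv.refl ℂ H

theorem reflGood_apply (n : ℕ) (ψ : Ext m H) (b : Bool) (f : Fin m → Bool) :
    (Op.reflGood n).iso U hP ψ b f =
      if b then (if Running n f then -ψ b f else ψ b f - (2 : ℂ) • P (ψ b f)) else ψ b f := by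
  simp only [Op.iso, diagIso_apply]
  split_ifs <;> simp [reflProjIso_apply]

theorem reflInit_apply (n : ℕ) (ψ : Ext m H) (b : Bool) (f : Fin m → Bool) :
    (Op.reflInit n).iso U hP ψ b f =
      if b = false ∧ Running n f then ψ b f - (2 * inner ℂ U.zero (ψ b f)) • U.zero
      else ψ b f := by
  simp only [Op.iso, diagIso_apply]
  split_ifs <;> simp [reflZeroIso_apply]

theorem iso_inv (o : Op m) (ψ : Ext m H) : o.inv.iso U hP (o.iso U hP ψ) = ψ := by
  cases o with
  | rot x => simp [Op.inv, Op.iso, rotIso_neg]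
  | call i => ext b : 1; exact (stepIso i (U.unitary i)).symm_apply_apply _
  | callInv i => ext b : 1; exact (stepIso i (U.unitary i)).apply_symm_apply _
  | reflGood n =>
    refine ext_ext fun b f => ?_
    simp only [Op.inv, reflGood_apply]
    split_ifs
    · simp
    · simp [starProjection_apply_apply hP]
      module
    · rfl
  | reflInit n =>
    refine ext_ext fun b f => ?_
    have h : inner ℂ U.zero U.zero = (1 : ℂ) := by
      rw [inner_self_eq_norm_sq_to_K, U.norm_zero]; simp
    simp only [Op.inv, reflInit_apply]
    split_ifs
    · simp [inner_sub_right, inner_smul_right, h, -inner_self_eq_norm_sq_to_K]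
      module
    · rfl

theorem run_compile (o : Op m) {n : ℕ} (ho : o.Below n) (ψ : Ext m H) :
    run U P o.compile (emb (baseContent m) ψ) = emb (baseContent m) (o.iso U hP ψ) := by
  cases o with
  | rot x => exact run_rot U P x ψ
  | call i => exact controlled_emb _ (stepOp_zero i _) ψ
  | callInv i => exact controlled_emb _ (stepOp_zero i _) ψ
  | reflGood k =>
    rw [run_reflGood U P k ho]
    congr 1
    exact ext_ext fun b f => (reflGood_apply U hP k ψ b f).symm
  | reflInit k =>
    rw [run_reflInit U P k ho]
    congr 1
    exact ext_ext fun b f => (reflInit_apply U hP k ψ b f).symm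

end Operations

/-! ### The good part of the state, and amplitude amplification. -/

section Circuits

variable {m : ℕ} {H : Type u} [NormedAddCommGroup H] [InnerProductSpace ℂ H]

/-- A state of the system in which the flags from `n` on are `|cont⟩`. -/
def SuppBelow (n : ℕ) (ψ : Sys m H) : Prop :=
  ∀ f, (∃ j : Fin m, n ≤ j ∧ f j = true) → ψ f = 0

theorem SuppBelow.mono {n k : ℕ} (h : n ≤ k) {ψ : Sys m H} (hψ : SuppBelow n ψ) :
    SuppBelow k ψ := fun f ⟨j, hj, hf⟩ => hψ f ⟨j, h.trans hj, hf⟩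

theorem SuppBelow.stepOp {n : ℕ} {i : Fin m} (hi : (i : ℕ) < n)
    (V : FlagSpace H ≃ₗᵢ[ℂ] FlagSpace H) {ψ : Sys m H} (hψ : SuppBelow n ψ) :
    SuppBelow n (stepOp i V ψ) := by
  rintro f ⟨j, hj, hf⟩
  have h : ∀ b, ψ (update f i b) = 0 := fun b => hψ _ ⟨j, hj, by
    rw [Function.update_of_ne (by intro h; omega), hf]⟩
  have h0 : (WithLp.toLp 2 fun b => ψ (update f i b) : FlagSpace H) = 0 := by
    ext b; exact h b
  simp only [VarTime.stepOp, h0, map_zero]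
  split_ifs
  · rfl
  · exact hψ f ⟨j, hj, hf⟩

/-- The projector on the states that are not known to be bad. -/
def goodProj (P : H →L[ℂ] H) : Sys m H →ₗ[ℂ] Sys m H where
  toFun ψ := WithLp.toLp 2 fun f => if ∃ j, f j = true then P (ψ f) else ψ f
  map_add' ψ ψ' := by
    ext f
    simp only [PiLp.add_apply]
    split_ifs <;> simp
  map_smul' c ψ := by
    ext f
    simp only [PiLp.smul_apply, RingHom.id_apply]
    split_ifs <;> simp

theorem goodProj_apply (P : H →L[ℂ] H) (ψ : Sys m H) (f : Fin m → Bool) :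
    goodProj P ψ f = if ∃ j, f j = true then P (ψ f) else ψ f := rfl

theorem SuppBelow.goodProj {n : ℕ} (P : H →L[ℂ] H) {ψ : Sys m H} (hψ : SuppBelow n ψ) :
    SuppBelow n (goodProj P ψ) := by
  intro f hf
  rw [goodProj_apply, hψ f hf]
  simp

/-- `goodProj` under the control of the scaling qubit. -/
def extProj (P : H →L[ℂ] H) : Ext m H →ₗ[ℂ] Ext m H where
  toFun ψ := WithLp.toLp 2 fun b => if b then VarTime.goodProj P (ψ b) else 0
  map_add' ψ ψ' := by
    ext b : 1
    simp only [PiLp.add_apply]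
    split_ifs <;> simp
  map_smul' c ψ := by
    ext b : 1
    simp only [PiLp.smul_apply, RingHom.id_apply]
    split_ifs <;> simp

theorem extProj_true (P : H →L[ℂ] H) (ψ : Ext m H) :
    extProj P ψ true = VarTime.goodProj P (ψ true) := rfl

theorem extProj_false (P : H →L[ℂ] H) (ψ : Ext m H) : extProj P ψ false = 0 := rfl

theorem norm_extProj (P : H →L[ℂ] H) (ψ : Ext m H) :
    ‖extProj P ψ‖ = ‖VarTime.goodProj P (ψ true)‖ := by
  rw [← sq_eq_sq₀ (norm_nonneg _) (norm_nonneg _), PiLp.norm_sq_eq_of_L2]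
  simp [extProj_true, extProj_false]

variable (U : VariableTimeAlgorithm m H)

/-- The initial state of `Ext m H`. -/
def extInit : Ext m H := WithLp.toLp 2 fun b => if b then 0 else U.init

theorem norm_init : ‖U.init‖ = 1 := by
  rw [← sq_eq_sq₀ (norm_nonneg _) zero_le_one, PiLp.norm_sq_eq_of_L2,
    Finset.sum_eq_single (fun _ => false)]
  · simp [VariableTimeAlgorithm.init, U.norm_zero]
  · intro f _ hf
    have : ¬ ∀ j, f j = false := fun h => hf (funext h)
    simp [VariableTimeAlgorithm.init, this]
  · simp

theorem norm_extInit : ‖extInit U‖ = 1 := by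
  rw [← sq_eq_sq₀ (norm_nonneg _) zero_le_one, PiLp.norm_sq_eq_of_L2]
  simp [extInit, norm_init]

theorem suppBelow_init : SuppBelow 0 U.init := by
  rintro f ⟨j, _, hf⟩
  have : ¬ ∀ j, f j = false := fun h => by simp [h j] at hf
  simp [VariableTimeAlgorithm.init, this]

theorem goodProj_init (P : H →L[ℂ] H) : goodProj P U.init = U.init := by
  ext f
  rw [goodProj_apply]
  split_ifs with h
  · obtain ⟨j, hj⟩ := h
    rw [suppBelow_init U f ⟨j, by omega, hj⟩, map_zero]
  · rfl

theorem suppBelow_stateAfter {n : ℕ} : SuppBelow n (U.stateAfter n) := by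
  induction n with
  | zero => exact suppBelow_init U
  | succ n ih =>
    rw [VariableTimeAlgorithm.stateAfter]
    split_ifs with h
    · exact (ih.mono (Nat.le_succ n)).stepOp (by simp) _
    · exact ih.mono (Nat.le_succ n)

variable [CompleteSpace H] {P : H →L[ℂ] H} (hP : IsStarProjection P)

include hP in
theorem goodProj_goodProj (ψ : Sys m H) : goodProj P (goodProj P ψ) = goodProj P ψ := by
  ext f
  simp only [goodProj_apply]
  split_ifs
  · exact starProjection_apply_apply hP _
  · rfl

include hP in
theorem inner_goodProj (ψ : Sys m H) : inner ℂ ψ (goodProj P ψ) = (‖goodProj P ψ‖ : ℂ) ^ 2 := by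
  have h := inner_self_eq_norm_sq_to_K (𝕜 := ℂ) (goodProj P ψ)
  rw [← Complex.coe_algebraMap, ← h, PiLp.inner_apply, PiLp.inner_apply]
  refine Finset.sum_congr rfl fun f _ => ?_
  rw [goodProj_apply]
  split_ifs
  · rw [starProjection_inner hP, starProjection_apply_apply hP]
  · rfl

include hP in
theorem extProj_extProj (ψ : Ext m H) : extProj P (extProj P ψ) = extProj P ψ := by
  ext b : 1
  cases b
  · rfl
  · exact goodProj_goodProj hP _

include hP in
theorem inner_extProj (ψ : Ext m H) : inner ℂ ψ (extProj P ψ) = (‖extProj P ψ‖ : ℂ) ^ 2 := by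
  rw [norm_extProj, PiLp.inner_apply]
  simp [extProj_true, extProj_false, inner_goodProj hP]

include hP in
/-- Stopped bad branches stay bad. -/
theorem goodProj_stepOp {n : ℕ} (hn : n < m) (V : FlagSpace H ≃ₗᵢ[ℂ] FlagSpace H) {ψ : Sys m H}
    (hψ : SuppBelow n ψ) :
    goodProj P (stepOp ⟨n, hn⟩ V ψ) = goodProj P (stepOp ⟨n, hn⟩ V (goodProj P ψ)) := by
  have hb : ∀ f, (ψ - goodProj P ψ) f = if ∃ j, f j = true then ψ f - P (ψ f) else 0 := by
    intro f
    rw [PiLp.sub_apply, goodProj_apply]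
    split_ifs <;> simp
  have hs : SuppBelow n (ψ - goodProj P ψ) := by
    intro f hf
    rw [PiLp.sub_apply, hψ f hf, hψ.goodProj P f hf, sub_zero]
  -- The bad part has a stop flag before position `n`, so the control of step `n` is off and the
  -- step fixes it.
  have h1 : stepOp ⟨n, hn⟩ V (ψ - goodProj P ψ) = ψ - goodProj P ψ := by
    ext f
    simp only [stepOp]
    split_ifs with hf
    · have h0 : ∀ f', (∀ j < (⟨n, hn⟩ : Fin m), f' j = false) → (ψ - goodProj P ψ) f' = 0 := by
        intro f' hf'
        by_cases h : ∃ j, f' j = true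
        · obtain ⟨j, hj⟩ := h
          refine hs f' ⟨j, ?_, hj⟩
          by_contra hlt
          rw [hf' j (by rw [Fin.lt_def]; simpa using hlt)] at hj
          cases hj
        · rw [hb, if_neg h]
      have h2 : (WithLp.toLp 2 fun b => (ψ - goodProj P ψ) (update f ⟨n, hn⟩ b) :
          FlagSpace H) = 0 := by
        ext b
        exact h0 _ fun j hj => by rw [Function.update_of_ne hj.ne, hf j hj]
      rw [h2, map_zero, h0 f hf]
      rfl
    · rfl
  have h2 : goodProj P (ψ - goodProj P ψ) = 0 := by
    rw [map_sub, goodProj_goodProj hP, sub_self]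
  have h3 : stepOp ⟨n, hn⟩ V ψ = stepOp ⟨n, hn⟩ V (goodProj P ψ) + (ψ - goodProj P ψ) := by
    rw [← h1, ← stepIso_apply, ← stepIso_apply, ← stepIso_apply, ← map_add, add_sub_cancel]
  rw [h3, map_add, h2, add_zero]

/-- The unitary of a sequence of operations. -/
def circuitIso : List (Op m) → (Ext m H ≃ₗᵢ[ℂ] Ext m H)
  | [] => LinearIsometryEquiv.refl ℂ _
  | o :: c => (o.iso U hP).trans (circuitIso c)

theorem circuitIso_append (c c' : List (Op m)) (ψ : Ext m H) :
    circuitIso U hP (c ++ c') ψ = circuitIso U hP c' (circuitIso U hP c ψ) := by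
  induction c generalizing ψ with
  | nil => rfl
  | cons o c ih => exact ih _

theorem circuitIso_cons (o : Op m) (c : List (Op m)) (ψ : Ext m H) :
    circuitIso U hP (o :: c) ψ = circuitIso U hP c (o.iso U hP ψ) := rfl

/-- The inverse sequence of operations. -/
def invCircuit (c : List (Op m)) : List (Op m) := (c.map Op.inv).reverse

theorem circuitIso_inv_apply (c : List (Op m)) (ψ : Ext m H) :
    circuitIso U hP (invCircuit c) (circuitIso U hP c ψ) = ψ := by
  induction c generalizing ψ with
  | nil => rfl
  | cons o c ih =>
    rw [invCircuit, List.map_cons, List.reverse_cons, circuitIso_append,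
      circuitIso_cons U hP o c ψ]
    rw [invCircuit] at ih
    rw [ih]
    exact iso_inv U hP o ψ

theorem circuitIso_inv (c : List (Op m)) (ψ : Ext m H) :
    circuitIso U hP (invCircuit c) ψ = (circuitIso U hP c).symm ψ := by
  conv_lhs => rw [← (circuitIso U hP c).apply_symm_apply ψ]
  exact circuitIso_inv_apply U hP c _

/-- The circuit uses only the first `n` steps. -/
def Below (n : ℕ) (c : List (Op m)) : Prop := ∀ o ∈ c, o.Below n

omit [CompleteSpace H] in
theorem Below.mono {n k : ℕ} (h : n ≤ k) {c : List (Op m)} (hc : Below n c) : Below k c := by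
  intro o ho
  have := hc o ho
  cases o <;> simp only [Op.Below] at * <;> omega

theorem Below.append {n : ℕ} {c c' : List (Op m)} (hc : Below n c) (hc' : Below n c') :
    Below n (c ++ c') := by
  intro o ho
  rcases List.mem_append.1 ho with h | h
  exacts [hc o h, hc' o h]

theorem Below.inv {n : ℕ} {c : List (Op m)} (hc : Below n c) : Below n (invCircuit c) := by
  intro o ho
  simp only [invCircuit, List.mem_reverse, List.mem_map] at ho
  obtain ⟨o', ho', rfl⟩ := ho
  have := hc o' ho'
  cases o' <;> simpa [Op.Below, Op.inv] using this

theorem run_circuit {n : ℕ} {c : List (Op m)} (hc : Below n c) (ψ : Ext m H) :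
    run U P (c.flatMap Op.compile) (emb (baseContent m) ψ) =
      emb (baseContent m) (circuitIso U hP c ψ) := by
  induction c generalizing ψ with
  | nil => rfl
  | cons o c ih =>
    rw [List.flatMap_cons, run_append, run_compile U hP o (hc o (by simp)),
      ih fun o ho => hc o (by simp [ho])]
    rfl

/-- Both branches of the scaling qubit have support below `n`. -/
def ExtSupp (n : ℕ) (ψ : Ext m H) : Prop := ∀ b, SuppBelow n (ψ b)

theorem ExtSupp.op {n : ℕ} {o : Op m} (ho : o.Below n) {ψ : Ext m H} (hψ : ExtSupp n ψ) :
    ExtSupp n (o.iso U hP ψ) := by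
  intro b
  cases o with
  | rot x =>
    intro f hf
    simp [Op.iso, rotIso_apply, hψ _ f hf]
  | call i => exact (hψ b).stepOp ho _
  | callInv i => exact (hψ b).stepOp ho _
  | reflGood k =>
    intro f hf
    rw [reflGood_apply, hψ b f hf]
    simp
  | reflInit k =>
    intro f hf
    rw [reflInit_apply, hψ b f hf]
    simp

theorem ExtSupp.circuit {n : ℕ} {c : List (Op m)} (hc : Below n c) {ψ : Ext m H}
    (hψ : ExtSupp n ψ) : ExtSupp n (circuitIso U hP c ψ) := by
  induction c generalizing ψ with
  | nil => exact hψ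
  | cons o c ih =>
    exact ih (fun o ho => hc o (by simp [ho])) (hψ.op U hP (hc o (by simp)))

theorem ExtSupp.mono {n k : ℕ} (h : n ≤ k) {ψ : Ext m H} (hψ : ExtSupp n ψ) : ExtSupp k ψ :=
  fun b => (hψ b).mono h

theorem extSupp_init (n : ℕ) : ExtSupp n (extInit U) := by
  intro b
  cases b
  · exact (suppBelow_init U).mono (Nat.zero_le n)
  · intro f _; rfl

/-- When all flags from `n` on are `|cont⟩`, inspecting `n` flags decides whether a branch has
stopped. The cost of the reflection then scales with `n` instead of `m`. -/
theorem reflGood_eq {n : ℕ} {ψ : Ext m H} (hψ : ExtSupp n ψ) :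
    (Op.reflGood n).iso U hP ψ = ψ - (2 : ℂ) • extProj P ψ := by
  refine ext_ext fun b f => ?_
  rw [reflGood_apply, PiLp.sub_apply, PiLp.smul_apply, PiLp.sub_apply, PiLp.smul_apply]
  cases b
  · simp [extProj_false]
  · rw [extProj_true, goodProj_apply, if_pos rfl]
    by_cases hs : ∃ j : Fin m, n ≤ (j : ℕ) ∧ f j = true
    · simp [hψ true f hs]
    · have : Running n f ↔ ¬ ∃ j, f j = true := by
        constructor
        · rintro h ⟨j, hj⟩
          by_cases hjn : (j : ℕ) < n
          · simp [h j hjn] at hj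
          · exact hs ⟨j, by omega, hj⟩
        · intro h j _
          by_contra hj
          exact h ⟨j, by simpa using hj⟩
      by_cases h : Running n f
      · rw [if_pos h, if_neg (this.1 h)]
        module
      · rw [if_neg h, if_pos (by by_contra h'; exact h (this.2 h'))]

theorem inner_extInit (ψ : Ext m H) :
    inner ℂ (extInit U) ψ = inner ℂ U.zero (ψ false fun _ => false) := by
  rw [PiLp.inner_apply]
  simp only [Fintype.sum_bool, extInit, if_true, inner_zero_left, zero_add, Bool.false_eq_true,
    if_false]
  rw [PiLp.inner_apply, Finset.sum_eq_single (fun _ => false)]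
  · simp [VariableTimeAlgorithm.init]
  · intro f _ hf
    have : ¬ ∀ j, f j = false := fun h => hf (funext h)
    simp [VariableTimeAlgorithm.init, this]
  · simp

theorem reflInit_eq {n : ℕ} {ψ : Ext m H} (hψ : ExtSupp n ψ) :
    (Op.reflInit n).iso U hP ψ = ψ - (2 * inner ℂ (extInit U) ψ) • extInit U := by
  refine ext_ext fun b f => ?_
  rw [reflInit_apply, PiLp.sub_apply, PiLp.smul_apply, PiLp.sub_apply, PiLp.smul_apply,
    inner_extInit]
  cases b
  · by_cases hf : f = fun _ => false
    · subst hf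
      simp [extInit, VariableTimeAlgorithm.init]
    · have h0 : extInit U false f = 0 := by
        have : ¬ ∀ j, f j = false := fun h => hf (funext h)
        simp [extInit, VariableTimeAlgorithm.init, this]
      rw [h0, smul_zero, sub_zero]
      split_ifs with h
      · have : ψ false f = 0 := by
          refine hψ false f ?_
          by_contra hne
          refine hf (funext fun j => ?_)
          by_cases hjn : (j : ℕ) < n
          · exact h.2 j hjn
          · by_contra hj
            exact hne ⟨j, by omega, by simpa using hj⟩
        simp [this]
      · rfl
  · have h0 : extInit U true f = 0 := rfl
    simp [h0]

/-- The Dirichlet kernel `1 + 2 ∑_{l=1}^k cos (2 l θ)`. -/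
def dirichlet : ℕ → ℝ → ℝ
  | 0, _ => 1
  | k + 1, θ => dirichlet k θ + 2 * Real.cos (2 * (k + 1) * θ)

/-- The alternating version of the Dirichlet kernel. -/
def dirichletAlt : ℕ → ℝ → ℝ
  | 0, _ => 1
  | k + 1, θ => -dirichletAlt k θ + 2 * Real.cos (2 * (k + 1) * θ)

-- Product-to-sum formulas telescope. In the multiplied form there is no exceptional angle, so a
-- vanishing good part needs no separate treatment.
omit [CompleteSpace H] in
theorem dirichlet_mul_sin (k : ℕ) (θ : ℝ) :
    dirichlet k θ * Real.sin θ = Real.sin ((2 * k + 1) * θ) := by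
  induction k with
  | zero => simp [dirichlet]
  | succ k ih =>
    rw [dirichlet, add_mul, ih]
    have h1 : Real.sin ((2 * ((k + 1 : ℕ) : ℝ) + 1) * θ) =
        Real.sin (2 * (k + 1) * θ + θ) := by congr 1; push_cast; ring
    have h2 : Real.sin ((2 * (k : ℝ) + 1) * θ) = Real.sin (2 * (k + 1) * θ - θ) := by
      congr 1; ring
    rw [h1, h2, Real.sin_add, Real.sin_sub]
    ring

theorem dirichletAlt_mul_cos (k : ℕ) (θ : ℝ) :
    dirichletAlt k θ * Real.cos θ = Real.cos ((2 * k + 1) * θ) := by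
  induction k with
  | zero => simp [dirichletAlt]
  | succ k ih =>
    rw [dirichletAlt, add_mul, neg_mul, ih]
    have h1 : Real.cos ((2 * ((k + 1 : ℕ) : ℝ) + 1) * θ) =
        Real.cos (2 * (k + 1) * θ + θ) := by congr 1; push_cast; ring
    have h2 : Real.cos ((2 * (k : ℝ) + 1) * θ) = Real.cos (2 * (k + 1) * θ - θ) := by
      congr 1; ring
    rw [h1, h2, Real.cos_add, Real.cos_sub]
    ring

/-- Up to sign, the left side is the overlap of the start vector of the Grover plane with the state
after the reflection about the good part. -/
theorem dirichlet_combine (k : ℕ) (θ : ℝ) :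
    dirichletAlt k θ * Real.cos θ ^ 2 - dirichlet k θ * Real.sin θ ^ 2 =
      Real.cos (2 * (k + 1) * θ) := by
  have h1 := dirichlet_mul_sin k θ
  have h2 := dirichletAlt_mul_cos k θ
  have h3 : Real.cos (2 * (k + 1) * θ) = Real.cos ((2 * k + 1) * θ + θ) := by congr 1; ring
  rw [h3, Real.cos_add, ← h1, ← h2]
  ring

/-- Amplitude amplification: `k` Grover iterations after the circuit `c`. -/
def amplify (n : ℕ) (c : List (Op m)) : ℕ → List (Op m)
  | 0 => c
  | k + 1 => amplify n c k ++ (.reflGood n :: (invCircuit c ++ .reflInit n :: c))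

omit [CompleteSpace H] in
theorem Below.amplify {n : ℕ} (hn : n ≤ m) {c : List (Op m)} (hc : Below n c) (k : ℕ) :
    Below n (amplify n c k) := by
  induction k with
  | zero => exact hc
  | succ k ih =>
    refine ih.append ?_
    intro o ho
    simp only [List.mem_cons, List.mem_append] at ho
    rcases ho with rfl | ho | rfl | ho
    exacts [hn, hc.inv o ho, hn, hc o ho]

/-- Everything happens in the plane of `g` and `v - g`. If the coefficients are `D` and `A` up to
sign, the two reflections replace them, up to the opposite sign, by `D + 2 * cos` and `-A + 2 * cos`
at `2 * (k + 1) * θ`: the recursions that define the two kernels. -/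
theorem circuitIso_amplify {n : ℕ} (hn : n ≤ m) {c : List (Op m)} (hc : Below n c) (k : ℕ)
    {θ : ℝ} (hθ : Real.sin θ = ‖extProj P (circuitIso U hP c (extInit U))‖) :
    circuitIso U hP (amplify n c k) (extInit U) =
      ((-1) ^ k : ℂ) • ((dirichlet k θ : ℂ) • extProj P (circuitIso U hP c (extInit U)) +
        (dirichletAlt k θ : ℂ) • (circuitIso U hP c (extInit U) -
          extProj P (circuitIso U hP c (extInit U)))) := by
  set v := circuitIso U hP c (extInit U) with hv
  set g := extProj P v with hg
  induction k with
  | zero => simp [amplify, dirichlet, dirichletAlt, ← hv]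
  | succ k ih =>
    have hs : ExtSupp n (circuitIso U hP (amplify n c k) (extInit U)) :=
      (extSupp_init U n).circuit U hP (hc.amplify hn k)
    have hrefl : ∀ y : Ext m H, ExtSupp n y →
        circuitIso U hP (invCircuit c ++ .reflInit n :: c) y =
          y - (2 * inner ℂ v y) • v := by
      intro y hy
      rw [circuitIso_append, circuitIso_cons, reflInit_eq U hP (hy.circuit U hP hc.inv),
        map_sub, map_smul, circuitIso_inv, LinearIsometryEquiv.apply_symm_apply, ← hv]
      congr 3
      rw [hv, ← LinearIsometryEquiv.inner_map_map (circuitIso U hP c),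
        LinearIsometryEquiv.apply_symm_apply]
    have hs' := hs.op U hP (o := .reflGood n) hn
    rw [amplify, circuitIso_append, circuitIso_cons, hrefl _ hs', reflGood_eq U hP hs, ih]
    have e1 : inner ℂ v g = ((Real.sin θ ^ 2 : ℝ) : ℂ) := by
      rw [hg, inner_extProj hP, hθ]; push_cast; rfl
    have e2 : inner ℂ v v = (1 : ℂ) := by
      rw [inner_self_eq_norm_sq_to_K, hv, LinearIsometryEquiv.norm_map, norm_extInit]; simp
    have e3 : extProj P g = g := extProj_extProj hP v
    have e4 : ((Real.cos (2 * (k + 1) * θ) : ℝ) : ℂ) = (dirichletAlt k θ : ℂ) *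
        (1 - ((Real.sin θ ^ 2 : ℝ) : ℂ)) - (dirichlet k θ : ℂ) * ((Real.sin θ ^ 2 : ℝ) : ℂ) := by
      rw [← dirichlet_combine]
      push_cast
      linear_combination (dirichletAlt k θ : ℂ) * Complex.sin_sq_add_cos_sq θ
    simp only [map_smul, map_add, map_sub, e3, ← hg, sub_self, smul_zero, add_zero,
      inner_sub_right, inner_add_right, inner_smul_right, e1, e2]
    rw [dirichlet, dirichletAlt]
    simp only [Complex.ofReal_add, Complex.ofReal_neg, Complex.ofReal_mul, e4, pow_succ,
      Complex.ofReal_ofNat]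
    match_scalars <;> ring

/-- Amplification multiplies the good part by the Dirichlet kernel. -/
theorem extProj_amplify {n : ℕ} (hn : n ≤ m) {c : List (Op m)} (hc : Below n c) (k : ℕ)
    {θ : ℝ} (hθ : Real.sin θ = ‖extProj P (circuitIso U hP c (extInit U))‖) :
    extProj P (circuitIso U hP (amplify n c k) (extInit U)) =
      ((-1) ^ k * (dirichlet k θ : ℂ)) • extProj P (circuitIso U hP c (extInit U)) := by
  rw [circuitIso_amplify U hP hn hc k hθ]
  simp only [map_smul, map_add, map_sub, extProj_extProj hP, sub_self, smul_zero, add_zero,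
    smul_smul]

theorem norm_extProj_amplify {n : ℕ} (hn : n ≤ m) {c : List (Op m)} (hc : Below n c) (k : ℕ)
    {θ : ℝ} (hθ : Real.sin θ = ‖extProj P (circuitIso U hP c (extInit U))‖) :
    ‖extProj P (circuitIso U hP (amplify n c k) (extInit U))‖ ^ 2 =
      Real.sin ((2 * k + 1) * θ) ^ 2 := by
  rw [extProj_amplify U hP hn hc k hθ, norm_smul, ← hθ, ← dirichlet_mul_sin]
  simp [mul_pow]

/-- The steps `a + 1, …, a + l`. -/
def callSteps (m a : ℕ) : ℕ → List (Op m)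
  | 0 => []
  | l + 1 => callSteps m a l ++ if h : a + l < m then [.call ⟨a + l, h⟩] else []

omit [CompleteSpace H] in
theorem below_callSteps (a l : ℕ) : Below (a + l) (callSteps m a l) := by
  induction l with
  | zero => intro o ho; simp [callSteps] at ho
  | succ l ih =>
    refine (ih.mono (by omega)).append ?_
    intro o ho
    split_ifs at ho with h
    · obtain rfl := List.mem_singleton.1 ho
      simp only [Op.Below]
      omega
    · simp at ho

/-- Proportionality of good parts survives a step, because the good part after a step is determined
by the good part before it. The bad part of `v` may be arbitrary. -/
theorem goodProj_callSteps {a : ℕ} (l : ℕ) (hl : a + l ≤ m) {v : Ext m H} (hv : ExtSupp a v)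
    {γ : ℂ} (h : goodProj P (v true) = γ • goodProj P (U.stateAfter a)) :
    goodProj P (circuitIso U hP (callSteps m a l) v true) =
      γ • goodProj P (U.stateAfter (a + l)) := by
  induction l with
  | zero => exact h
  | succ l ih =>
    have hlt : a + l < m := by omega
    have hs := hv.mono (Nat.le_add_right a l) |>.circuit U hP (below_callSteps (m := m) a l)
    have h1 : U.stateAfter (a + (l + 1)) =
        stepOp ⟨a + l, hlt⟩ (U.unitary ⟨a + l, hlt⟩) (U.stateAfter (a + l)) := by
      rw [← add_assoc, VariableTimeAlgorithm.stateAfter, dif_pos hlt]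
    rw [callSteps, circuitIso_append, dif_pos hlt, h1,
      goodProj_stepOp hP hlt _ (suppBelow_stateAfter U), ← map_smul, ← stepIso_apply,
      ← map_smul, ← ih (by omega), stepIso_apply, ← goodProj_stepOp hP hlt _ (hs true)]
    rfl

/-- The rotation of the scaling qubit, applied to the initial state. -/
theorem goodProj_rot (x : ℝ) :
    goodProj P (circuitIso U hP [.rot x] (extInit U) true) =
      (Real.sin x : ℂ) • goodProj P (U.stateAfter 0) := by
  rw [← map_smul]
  congr 1
  refine (rotIso_apply x (extInit U) true).trans ?_
  simp [extInit, VariableTimeAlgorithm.stateAfter, rotation]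

end Circuits

/-! ### Weights of good states and the tail bound from the second moment of the running time. -/

section Probabilities

variable {m : ℕ} {H : Type u} [NormedAddCommGroup H] [InnerProductSpace ℂ H]

/-- The weight of the states that are not known to be bad after `n` steps. -/
def VariableTimeAlgorithm.goodProb (U : VariableTimeAlgorithm m H) (P : H →L[ℂ] H) (n : ℕ) : ℝ :=
  ‖goodProj P (U.stateAfter n)‖ ^ 2

theorem norm_stateAfter (U : VariableTimeAlgorithm m H) (n : ℕ) : ‖U.stateAfter n‖ = 1 := by
  induction n with
  | zero => exact norm_init U
  | succ n ih =>
    rw [VariableTimeAlgorithm.stateAfter]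
    split_ifs
    · rw [norm_stepOp, ih]
    · exact ih

theorem goodProb_zero (U : VariableTimeAlgorithm m H) (P : H →L[ℂ] H) : U.goodProb P 0 = 1 := by
  rw [VariableTimeAlgorithm.goodProb, VariableTimeAlgorithm.stateAfter, goodProj_init, norm_init,
    one_pow]

/-- In a stopped branch, the component is not changed any more, or it was zero before. -/
theorem stateAfter_succ_apply (U : VariableTimeAlgorithm m H) (n : ℕ) {f : Fin m → Bool}
    (hf : ∃ j, f j = true) :
    U.stateAfter (n + 1) f = U.stateAfter n f ∨ U.stateAfter n f = 0 := by
  by_cases h : ∃ j : Fin m, n ≤ j ∧ f j = true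
  · exact Or.inr (suppBelow_stateAfter U f h)
  · left
    obtain ⟨j, hj⟩ := hf
    have hjn : (j : ℕ) < n := by
      by_contra hlt
      exact h ⟨j, by omega, hj⟩
    rw [VariableTimeAlgorithm.stateAfter]
    split_ifs with hn
    · simp only [stepOp]
      rw [if_neg]
      intro h'
      rw [h' j hjn] at hj
      cases hj
    · rfl

theorem norm_stopProj_sq (ψ : Sys m H) :
    ‖stopProj ψ‖ ^ 2 = ∑ f, if ∃ j, f j = true then ‖ψ f‖ ^ 2 else 0 := by
  rw [PiLp.norm_sq_eq_of_L2]
  refine Finset.sum_congr rfl fun f _ => ?_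
  simp only [stopProj]
  split_ifs <;> simp

theorem norm_acceptProj_sq (P : H →L[ℂ] H) (ψ : Sys m H) :
    ‖acceptProj P ψ‖ ^ 2 = ∑ f, if ∃ j, f j = true then ‖P (ψ f)‖ ^ 2 else 0 := by
  rw [PiLp.norm_sq_eq_of_L2]
  refine Finset.sum_congr rfl fun f _ => ?_
  simp only [acceptProj]
  split_ifs <;> simp

theorem goodProb_eq (U : VariableTimeAlgorithm m H) (P : H →L[ℂ] H) (n : ℕ) :
    U.goodProb P n =
      ‖acceptProj P (U.stateAfter n)‖ ^ 2 + (1 - ‖stopProj (U.stateAfter n)‖ ^ 2) := by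
  have h := norm_stateAfter U n
  rw [← sq_eq_sq₀ (norm_nonneg _) zero_le_one, one_pow] at h
  rw [← h, norm_acceptProj_sq, norm_stopProj_sq, VariableTimeAlgorithm.goodProb,
    PiLp.norm_sq_eq_of_L2, PiLp.norm_sq_eq_of_L2, ← Finset.sum_sub_distrib,
    ← Finset.sum_add_distrib]
  refine Finset.sum_congr rfl fun f _ => ?_
  rw [goodProj_apply]
  split_ifs <;> simp

variable [CompleteSpace H]

theorem norm_starProjection_le {P : H →L[ℂ] H} (hP : IsStarProjection P) (x : H) :
    ‖P x‖ ≤ ‖x‖ := by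
  have h : ‖P x‖ ^ 2 = RCLike.re (inner ℂ x (P x)) := by
    rw [← starProjection_apply_apply hP x, ← starProjection_inner hP,
      starProjection_apply_apply hP, inner_self_eq_norm_sq]
  have h2 := re_inner_le_norm (𝕜 := ℂ) x (P x)
  rw [← h] at h2
  nlinarith [norm_nonneg (P x), norm_nonneg x]

theorem acceptProj_mono (U : VariableTimeAlgorithm m H) (P : H →L[ℂ] H) (n : ℕ) :
    ‖acceptProj P (U.stateAfter n)‖ ^ 2 ≤ ‖acceptProj P (U.stateAfter (n + 1))‖ ^ 2 := by
  rw [norm_acceptProj_sq, norm_acceptProj_sq]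
  refine Finset.sum_le_sum fun f _ => ?_
  split_ifs with hf
  · rcases stateAfter_succ_apply U n hf with h | h
    · rw [h]
    · rw [h, map_zero]; simp
  · rfl

theorem stopProj_mono (U : VariableTimeAlgorithm m H) (n : ℕ) :
    ‖stopProj (U.stateAfter n)‖ ^ 2 ≤ ‖stopProj (U.stateAfter (n + 1))‖ ^ 2 := by
  rw [norm_stopProj_sq, norm_stopProj_sq]
  refine Finset.sum_le_sum fun f _ => ?_
  split_ifs with hf
  · rcases stateAfter_succ_apply U n hf with h | h
    · rw [h]
    · rw [h]; simp
  · rfl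

/-- Newly stopped weight leaves the running part, and at most all of it returns as accepted weight.
-/
theorem goodProb_succ_le (U : VariableTimeAlgorithm m H) {P : H →L[ℂ] H}
    (hP : IsStarProjection P) (n : ℕ) : U.goodProb P (n + 1) ≤ U.goodProb P n := by
  have h : ‖acceptProj P (U.stateAfter (n + 1))‖ ^ 2 - ‖acceptProj P (U.stateAfter n)‖ ^ 2 ≤
      ‖stopProj (U.stateAfter (n + 1))‖ ^ 2 - ‖stopProj (U.stateAfter n)‖ ^ 2 := by
    simp only [norm_acceptProj_sq, norm_stopProj_sq, ← Finset.sum_sub_distrib]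
    refine Finset.sum_le_sum fun f _ => ?_
    split_ifs with hf
    · rcases stateAfter_succ_apply U n hf with h | h
      · rw [h]; simp
      · rw [h, map_zero]
        have := norm_starProjection_le hP (U.stateAfter (n + 1) f)
        simp only [norm_zero]
        nlinarith [norm_nonneg (P (U.stateAfter (n + 1) f))]
    · simp
  rw [goodProb_eq, goodProb_eq]
  linarith

theorem goodProb_antitone (U : VariableTimeAlgorithm m H) {P : H →L[ℂ] H}
    (hP : IsStarProjection P) : Antitone (U.goodProb P) :=
  antitone_nat_of_succ_le (goodProb_succ_le U hP)

theorem acceptProb_eq (U : VariableTimeAlgorithm m H) {P : H →L[ℂ] H}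
    (hP : IsStarProjection P) : U.acceptProb P = ‖acceptProj P (U.stateAfter m)‖ ^ 2 := by
  rw [norm_acceptProj_sq, VariableTimeAlgorithm.acceptProb, VariableTimeAlgorithm.final,
    PiLp.inner_apply, Complex.re_sum]
  refine Finset.sum_congr rfl fun f _ => ?_
  simp only [acceptProj]
  split_ifs
  · have h := inner_self_eq_norm_sq (𝕜 := ℂ) (P (U.stateAfter m f))
    rw [starProjection_inner hP, starProjection_apply_apply hP] at h
    exact h
  · simp

theorem norm_stopProj_final {U : VariableTimeAlgorithm m H} (hU : U.Halts) :
    ‖stopProj (U.stateAfter m)‖ ^ 2 = 1 := by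
  rw [VariableTimeAlgorithm.Halts, VariableTimeAlgorithm.final] at hU
  rw [hU, norm_stateAfter, one_pow]

theorem goodProb_last {U : VariableTimeAlgorithm m H} (hU : U.Halts) {P : H →L[ℂ] H}
    (hP : IsStarProjection P) : U.goodProb P m = U.acceptProb P := by
  rw [goodProb_eq, norm_stopProj_final hU, acceptProb_eq U hP]
  ring

theorem acceptProb_le_goodProb {U : VariableTimeAlgorithm m H} (hU : U.Halts) {P : H →L[ℂ] H}
    (hP : IsStarProjection P) {n : ℕ} (hn : n ≤ m) : U.acceptProb P ≤ U.goodProb P n := by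
  rw [← goodProb_last hU hP]
  exact goodProb_antitone U hP hn

/-- Accepted weight never decreases, so what is accepted by step `n` is at most `p`; the rest of the
good weight is still running. -/
theorem goodProb_le_tail {U : VariableTimeAlgorithm m H} {P : H →L[ℂ] H}
    (hP : IsStarProjection P) {n : ℕ} (hn : n ≤ m) :
    U.goodProb P n ≤ U.acceptProb P + (1 - ‖stopProj (U.stateAfter n)‖ ^ 2) := by
  rw [goodProb_eq, acceptProb_eq U hP]
  have : Monotone fun n => ‖acceptProj P (U.stateAfter n)‖ ^ 2 :=
    monotone_nat_of_le_succ (acceptProj_mono U P)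
  linarith [this hn]

/-- Markov's inequality for the square of the stopping time: the weight still running after step `n`
stops at times at least `x`. -/
theorem goodProb_le {U : VariableTimeAlgorithm m H} (hU : U.Halts) {P : H →L[ℂ] H}
    (hP : IsStarProjection P) (τ : StoppingTimes m) {T : ℝ} (hT : U.Tl2 τ ≤ T) {n : ℕ}
    (hn : n ≤ m) {x : ℝ} (hx : 0 < x) (hτ : ∀ i : Fin m, n ≤ i → x ≤ τ.time i.succ) :
    U.goodProb P n ≤ U.acceptProb P + T ^ 2 / x ^ 2 := by
  refine (goodProb_le_tail hP hn).trans (add_le_add_right ?_ _)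
  have hp : ∀ i, 0 ≤ U.pStop i := fun i => sub_nonneg.2 (stopProj_mono U i)
  have hT0 : 0 ≤ U.Tl2 τ := Real.sqrt_nonneg _
  have h1 : ∑ i : Fin m, U.pStop i * (τ.time i.succ : ℝ) ^ 2 ≤ T ^ 2 := by
    have := pow_le_pow_left₀ hT0 hT 2
    rwa [VariableTimeAlgorithm.Tl2, Real.sq_sqrt (Finset.sum_nonneg fun i _ =>
      mul_nonneg (hp i) (sq_nonneg _))] at this
  -- The computation halts, so the weight still running is the telescoping sum of the later stopping
  -- probabilities.
  have h2 : 1 - ‖stopProj (U.stateAfter n)‖ ^ 2 = ∑ i : Fin m, if n ≤ (i : ℕ) then U.pStop i else 0 := by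
    rw [← norm_stopProj_final hU]
    simp only [VariableTimeAlgorithm.pStop]
    rw [Fin.sum_univ_eq_sum_range (fun i => if n ≤ i then
      ‖stopProj (U.stateAfter (i + 1))‖ ^ 2 - ‖stopProj (U.stateAfter i)‖ ^ 2 else 0) m,
      ← Finset.sum_filter]
    have : (Finset.range m).filter (fun i => n ≤ i) = Finset.Ico n m := by
      ext i; simp; tauto
    rw [this, Finset.sum_Ico_sub (fun i => ‖stopProj (U.stateAfter i)‖ ^ 2) hn]
  rw [h2, le_div_iff₀ (by positivity)]
  refine le_trans ?_ h1
  rw [Finset.sum_mul]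
  refine Finset.sum_le_sum fun i _ => ?_
  split_ifs with h
  · exact mul_le_mul_of_nonneg_left (pow_le_pow_left₀ hx.le (hτ i h) 2) (hp i)
  · rw [zero_mul]
    exact mul_nonneg (hp i) (sq_nonneg _)

end Probabilities

/-! ### Measuring whether the result of a circuit is good. -/

section Flips

variable {m : ℕ} {H : Type u} [NormedAddCommGroup H] [InnerProductSpace ℂ H]

/-- Apply a list of instructions. -/
def applyList {w : ℕ} (l : List (Instr m w)) (k : Program m w) : Program m w :=
  l.foldr .apply k

/-- The number of elementary steps of a list of instructions. -/
def listCost {w : ℕ} (τ : StoppingTimes m) (l : List (Instr m w)) : ℕ := (l.map (Instr.cost τ)).sum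

theorem cost_applyList {w : ℕ} (τ : StoppingTimes m) (l : List (Instr m w)) (k : Program m w) :
    (applyList l k).cost τ = listCost τ l + k.cost τ := by
  induction l with
  | nil => simp [applyList, listCost]
  | cons g l ih =>
    simp only [applyList, listCost, List.foldr_cons, Program.cost, List.map_cons,
      List.sum_cons] at *
    omega

theorem weight_applyList {w : ℕ} (U : VariableTimeAlgorithm m H) (P : H →L[ℂ] H) (S : Set ℝ)
    (l : List (Instr m w)) (k : Program m w) (ψ : Mem m w H) :
    (applyList l k).weight U P S ψ = k.weight U P S (run U P l ψ) := by
  induction l generalizing ψ with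
  | nil => rfl
  | cons g l ih => exact ih _

/-- Run the circuit `c` on a fresh memory, test whether the result is good, and continue with `k`
and a fresh memory; `n` is the number of flags that the circuit uses. -/
def flip (n : ℕ) (c : List (Op m)) (k : Bool → Program m (m + 4)) : Program m (m + 4) :=
  applyList (notGate (wq m (m + 3)) (wq m (m + 2)) ++ c.flatMap Op.compile ++
      (cnot (wq m (m + 1)) (wq m 0) ++ andFlags m n)) <|
    .measure (wq m (m + 1)) fun a => if a = false then .restart (k false) else
      .measure (wq m n) fun b => if b then .restart (k true) else
        applyList (ctrlGate (wq m (m + 2)) (wq m (m + 3)) (fun _ => hadamard) ++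
            ([.reflProj (anc m (m + 3))] ++
              ctrlGate (wq m (m + 2)) (wq m (m + 3)) fun _ => hadamard)) <|
          .measure (wq m (m + 3)) fun a => .restart (k a)

theorem run_prepare (U : VariableTimeAlgorithm m H) (P : H →L[ℂ] H) :
    run U P (notGate (wq m (m + 3)) (wq m (m + 2))) (initMem (m + 4) U) =
      emb (baseContent m) (extInit U) := by
  apply ext_component
  intro z
  have hne : wq m (m + 3) ≠ wq m (m + 2) := wq_ne (by omega) (by omega) (by omega)
  have hne' : anc m (m + 2) ≠ anc m (m + 1) := by rw [Ne, anc_inj] <;> omega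
  rw [toggles_not U P hne, component_emb]
  have h1 : (∀ j, update z (wq m (m + 2)) (xor (z (wq m (m + 2))) true) (Sum.inr j) = false) ↔
      z ∘ Sum.inr = baseContent m (z (wq m (m + 1))) (z ∘ Sum.inl) ∧
        z (wq m (m + 1)) = false := by
    constructor
    · intro h
      have hs : z (wq m (m + 1)) = false := by
        have := h (anc m (m + 1))
        rwa [Function.update_of_ne (by simpa using hne'.symm)] at this
      refine ⟨?_, hs⟩
      ext j
      simp only [Function.comp_apply, hs, baseContent]
      by_cases hj : j = anc m (m + 2)
      · subst hj
        have := h (anc m (m + 2))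
        simpa [hne'] using this
      · have := h j
        rw [Function.update_of_ne (by simpa using hj)] at this
        rw [this]
        split_ifs <;> simp [hj]
    · rintro ⟨h, hs⟩ j
      have := congrFun h j
      rw [hs] at this
      by_cases hj : j = anc m (m + 2)
      · subst hj
        simp only [Function.comp_apply, baseContent, if_neg hne'] at this
        simp [this]
      · rw [Function.update_of_ne (by simpa using hj)]
        simpa [baseContent, hj] using this
  have h2 : ∀ c : Bool, (fun j => update z (wq m (m + 2)) c (Sum.inl j)) = z ∘ Sum.inl := by
    intro c; ext j; simp
  simp only [component, initMem, h1, h2, extInit]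
  by_cases h : z ∘ Sum.inr = baseContent m (z (wq m (m + 1))) (z ∘ Sum.inl) <;>
    cases hs : z (wq m (m + 1)) <;> simp_all

theorem norm_ext_sq (ψ : Ext m H) : ‖ψ‖ ^ 2 = ∑ b, ∑ f, ‖ψ b f‖ ^ 2 := by
  rw [PiLp.norm_sq_eq_of_L2]
  refine Finset.sum_congr rfl fun b _ => ?_
  rw [PiLp.norm_sq_eq_of_L2]

/-- Because the contents record the scaling qubit, distinct pairs `(b, f)` go to distinct basis
states. -/
theorem norm_emb {A : Content m} (hA : A.Ok) (ψ : Ext m H) : ‖emb A ψ‖ ^ 2 = ‖ψ‖ ^ 2 := by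
  rw [norm_ext_sq, PiLp.norm_sq_eq_of_L2]
  have h1 : ∀ x : Fin (m + 4) → Bool, ‖emb A ψ x‖ ^ 2 =
      ∑ f, ∑ b, if x = A b f then ‖ψ b f‖ ^ 2 else 0 := by
    intro x
    rw [PiLp.norm_sq_eq_of_L2]
    refine Finset.sum_congr rfl fun f _ => ?_
    rw [Finset.sum_eq_single (x (anc m (m + 1)))]
    · simp only [emb]
      split_ifs <;> simp
    · intro b _ hb
      rw [if_neg]
      rintro rfl
      exact hb (hA b f).symm
    · simp
  simp_rw [h1]
  rw [Finset.sum_comm]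
  simp_rw [Finset.sum_comm (γ := Fin (m + 4) → Bool), Finset.sum_ite_eq', Finset.mem_univ, if_true]
  rw [Finset.sum_comm]

theorem measured_emb (A : Content m) (i : ℕ) (a : Bool) (ψ : Ext m H) :
    measured (wq m i) a (emb A ψ) =
      emb A (extMk fun b f => if A b f (anc m i) = a then ψ b f else 0) := by
  apply ext_component
  intro z
  rw [measured, component_ofComponents, component_emb, component_emb]
  by_cases h : z ∘ Sum.inr = A (z (wq m (m + 1))) (z ∘ Sum.inl)
  · have h' := congrFun h (anc m i)
    simp only [Function.comp_apply] at h'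
    rw [if_pos h, if_pos h, extMk_apply, h']
  · simp [h]

/-- The Hadamard test of the projector. -/
theorem measured_hadamard (U : VariableTimeAlgorithm m H) (P : H →L[ℂ] H) {A : Content m}
    (hA : ∀ b f, A b f (anc m (m + 3)) = false) (a : Bool) (ψ : Ext m H) :
    measured (wq m (m + 3)) a (run U P (ctrlGate (wq m (m + 2)) (wq m (m + 3)) (fun _ => hadamard) ++
            ([.reflProj (anc m (m + 3))] ++
              ctrlGate (wq m (m + 2)) (wq m (m + 3)) fun _ => hadamard)) (emb A ψ)) =
      emb (fun b f => update (A b f) (anc m (m + 3)) a)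
        (extMk fun b f => if a then P (ψ b f) else ψ b f - P (ψ b f)) := by
  have hne : wq m (m + 2) ≠ wq m (m + 3) := wq_ne (by omega) (by omega) (by omega)
  have hns : wq m (m + 1) ≠ wq m (m + 3) := wq_ne (by omega) (by omega) (by omega)
  apply ext_component
  intro z
  obtain ⟨f, x, rfl⟩ : ∃ f x, z = Sum.elim f x :=
    ⟨z ∘ Sum.inl, z ∘ Sum.inr, (Sum.elim_comp_inl_inr z).symm⟩
  have hc : ∀ (φ : Mem m (m + 4) H) z, component (run U P [.reflProj (anc m (m + 3))] φ) z =
      if z (wq m (m + 3)) then component φ z - (2 : ℂ) • P (component φ z) else component φ z := by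
    intro φ z
    simp only [run_cons, run_nil, Instr.apply, component, controlled, onC]
    split_ifs <;> rfl
  have hs : ∀ c, update x (anc m (m + 3)) c (anc m (m + 1)) = x (anc m (m + 1)) := by
    intro c
    exact Function.update_of_ne (fun h => hns (congrArg Sum.inr h)) _ _
  have h1 : component (emb A ψ) (Sum.elim f (update x (anc m (m + 3)) true)) = 0 := by
    rw [component_emb, if_neg]
    intro h
    have := congrFun h (anc m (m + 3))
    rw [hA] at this
    simp only [Function.comp_apply, Sum.elim_inr, Function.update_self, reduceCtorEq] at this
  have h2 : component (emb A ψ) (Sum.elim f (update x (anc m (m + 3)) false)) =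
      if update x (anc m (m + 3)) false = A (x (anc m (m + 1))) f
      then ψ (x (anc m (m + 1))) f else 0 := by
    rw [component_emb]
    simp only [Sum.elim_comp_inl, Sum.elim_comp_inr, Sum.elim_inr, hs]
  have h3 : ((√2 : ℝ) : ℂ)⁻¹ * ((√2 : ℝ) : ℂ)⁻¹ = 1 / 2 := by
    rw [← mul_inv, ← Complex.ofReal_mul, Real.mul_self_sqrt (by norm_num)]; norm_num
  have h4 : ∀ c : Bool, (x = update (A (x (anc m (m + 1))) f) (anc m (m + 3)) c) ↔
      x (anc m (m + 3)) = c ∧ update x (anc m (m + 3)) false = A (x (anc m (m + 1))) f := by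
    intro c
    constructor
    · intro h
      generalize hB : A (x (anc m (m + 1))) f = B at h ⊢
      have hB' : B (anc m (m + 3)) = false := by rw [← hB]; exact hA _ _
      exact ⟨by rw [h, Function.update_self],
        by rw [h, Function.update_idem, ← hB', Function.update_eq_self]⟩
    · rintro ⟨h, h'⟩
      rw [← h', Function.update_idem, ← h, Function.update_eq_self]
  rw [measured, component_ofComponents, run_append, run_append, component_ctrlGate _ _ hne]
  simp only [hc, component_ctrlGate _ _ hne, Sum.update_elim_inr, Function.update_self,
    Function.update_idem, Fintype.sum_bool, Sum.elim_inr, h1, smul_zero, zero_add, h2, if_true,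
    Bool.false_eq_true, if_false]
  rw [component_emb]
  simp only [Sum.elim_comp_inl, Sum.elim_comp_inr, Sum.elim_inr, h4]
  by_cases hx : x (anc m (m + 3)) = a
  · by_cases hy : update x (anc m (m + 3)) false = A (x (anc m (m + 1))) f
    · simp only [hx, hy, if_true, and_self, extMk_apply]
      generalize ψ (x (anc m (m + 1))) f = y
      have e1 : hadamard.1 false false = ((√2 : ℝ) : ℂ)⁻¹ := rfl
      have e2 : hadamard.1 false true = ((√2 : ℝ) : ℂ)⁻¹ := rfl
      have e3 : hadamard.1 true false = ((√2 : ℝ) : ℂ)⁻¹ := rfl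
      have e4 : hadamard.1 true true = -((√2 : ℝ) : ℂ)⁻¹ := rfl
      cases a
      · simp only [e1, e2, e3, map_smul, Bool.false_eq_true, if_false]
        match_scalars <;>
          first | ring1 | linear_combination 2 * h3 | linear_combination -2 * h3
      · simp only [e1, e3, e4, map_smul, if_true]
        match_scalars <;> first | ring1 | linear_combination 2 * h3
    · simp [hy]
  · simp [hx]

variable [CompleteSpace H]

theorem norm_sq_add_norm_sq {P : H →L[ℂ] H} (hP : IsStarProjection P) (x : H) :
    ‖P x‖ ^ 2 + ‖x - P x‖ ^ 2 = ‖x‖ ^ 2 := by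
  have h : ‖P x‖ ^ 2 = RCLike.re (inner ℂ x (P x)) := by
    rw [← starProjection_apply_apply hP x, ← starProjection_inner hP,
      starProjection_apply_apply hP, inner_self_eq_norm_sq]
  rw [norm_sub_sq (𝕜 := ℂ), ← h]
  ring

/-- A flip is a Bernoulli experiment for the weight of the good states. -/
theorem prob_flip (U : VariableTimeAlgorithm m H) {P : H →L[ℂ] H} (hP : IsStarProjection P)
    (S : Set ℝ) {n : ℕ} (hn : n ≤ m) {c : List (Op m)} (hc : Below n c)
    (k : Bool → Program m (m + 4)) {q : ℝ}
    (hq : ‖extProj P (circuitIso U hP c (extInit U))‖ ^ 2 = q) :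
    (flip n c k).prob U P S = q * (k true).prob U P S + (1 - q) * (k false).prob U P S := by
  obtain ⟨A, h1, h2, h3⟩ := exists_computes_scaled (H := H) n hn
  have hs := (extSupp_init U n).circuit U hP hc
  have hv : ‖circuitIso U hP c (extInit U)‖ ^ 2 = 1 := by
    rw [LinearIsometryEquiv.norm_map, norm_extInit, one_pow]
  rw [Program.prob, flip, weight_applyList,
    run_append _ _ _ (cnot (wq m (m + 1)) (wq m 0) ++ andFlags m n),
    run_append _ _ _ (c.flatMap Op.compile), run_prepare,
    run_circuit U hP hc, (h1 U P).1]
  generalize circuitIso U hP c (extInit U) = v at *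
  have hA : A.Ok := fun b f => by
    rw [h3 b f _ (by omega) (by omega), baseContent_scale]
  have hAt : ∀ b f, A b f (anc m (m + 3)) = false := fun b f => by
    rw [h3 b f _ (by omega) (by omega), baseContent_test]
  have hA' : ∀ a, Content.Ok (fun b f => update (A b f) (anc m (m + 3)) a : Content m) := by
    intro a b f
    have : anc m (m + 1) ≠ anc m (m + 3) := by rw [Ne, anc_inj] <;> omega
    change update (A b f) (anc m (m + 3)) a (anc m (m + 1)) = b
    rw [Function.update_of_ne this, hA]
  simp only [Program.weight, if_true, Bool.true_eq_false, if_false, Bool.false_eq_true,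
    weight_applyList, measured_emb, measured_hadamard U P hAt]
  rw [norm_emb hA, norm_emb hA, norm_emb (hA' _), norm_emb (hA' _)]
  simp only [norm_ext_sq, Fintype.sum_bool, extMk_apply, hA _ _, h2, if_true,
    Bool.false_eq_true, if_false, Bool.true_and, Bool.false_and, reduceCtorEq, norm_zero,
    map_zero, sub_self]
  rw [norm_ext_sq, Fintype.sum_bool] at hv
  rw [norm_extProj, PiLp.norm_sq_eq_of_L2] at hq
  -- With the scaling qubit equal to `1`, success has two sources: no stop flag is seen, or the
  -- branch has stopped and the Hadamard test accepts.
  have hq' : q = ∑ f, ((if Running n f then ‖v true f‖ ^ 2 else 0) +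
      (if Running n f then 0 else ‖P (v true f)‖ ^ 2)) := by
    rw [← hq]
    refine Finset.sum_congr rfl fun f _ => ?_
    rw [goodProj_apply]
    by_cases hf : ∃ j : Fin m, n ≤ (j : ℕ) ∧ f j = true
    · simp [hs true f hf]
    · have : Running n f ↔ ¬ ∃ j, f j = true := by
        constructor
        · rintro h ⟨j, hj⟩
          by_cases hjn : (j : ℕ) < n
          · simp [h j hjn] at hj
          · exact hf ⟨j, by omega, hj⟩
        · intro h j _
          by_contra hj
          exact h ⟨j, by simpa using hj⟩
      by_cases h : Running n f
      · rw [if_pos h, if_pos h, if_neg (this.1 h), add_zero]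
      · rw [if_neg h, if_neg h, if_pos (by by_contra h'; exact h (this.2 h')), zero_add]
  -- Failure means that the scaling qubit is `0`, or that a stopped branch is rejected by the test.
  have hq'' : 1 - q = ∑ f, ‖v false f‖ ^ 2 +
      ∑ f, (if Running n f then 0 else ‖v true f - P (v true f)‖ ^ 2) := by
    rw [← hv, hq', add_comm, add_sub_assoc, ← Finset.sum_sub_distrib]
    congr 1
    refine Finset.sum_congr rfl fun f _ => ?_
    split_ifs
    · ring
    · rw [← norm_sq_add_norm_sq hP (v true f)]; ring
  rw [hq'', hq', Finset.sum_add_distrib]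
  have e1 : ∀ (p : Prop) [Decidable p] (y : H), ‖(if p then y else 0 : H)‖ ^ 2 =
      if p then ‖y‖ ^ 2 else 0 := by
    intro p _ y; split_ifs <;> simp
  have e2 : ∀ (p : Prop) [Decidable p] (y : H), ‖P (if p then 0 else y : H)‖ ^ 2 =
      if p then 0 else ‖P y‖ ^ 2 := by
    intro p _ y; split_ifs <;> simp
  have e3 : ∀ (p : Prop) [Decidable p] (y : H),
      ‖(if p then 0 else y : H) - P (if p then 0 else y : H)‖ ^ 2 =
      if p then 0 else ‖y - P y‖ ^ 2 := by
    intro p _ y; split_ifs <;> simp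
  simp only [decide_eq_true_eq, decide_eq_false_iff_not, e1, e2, e3, ite_not, ne_eq,
    OfNat.ofNat_ne_zero, not_false_eq_true, zero_pow, Finset.sum_const_zero, add_zero, zero_add,
    Program.prob]
  ring

end Flips

/-! ### Costs of circuits, reflections and flips. -/

section Costs

variable {m : ℕ} (τ : StoppingTimes m)

theorem listCost_append {w : ℕ} (l l' : List (Instr m w)) :
    listCost τ (l ++ l') = listCost τ l + listCost τ l' := by
  simp [listCost]

theorem listCost_ctrlGate {w : ℕ} (c t : Fin m ⊕ Fin w) (M : Bool → Matrix.unitaryGroup Bool ℂ) :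
    listCost τ (ctrlGate c t M) ≤ 1 := by
  rw [ctrlGate]
  split_ifs <;> simp [listCost, Instr.cost]

theorem listCost_cnot {w : ℕ} (c t : Fin m ⊕ Fin w) : listCost τ (cnot c t) ≤ 1 :=
  listCost_ctrlGate τ c t _

theorem listCost_notGate {w : ℕ} (c t : Fin m ⊕ Fin w) : listCost τ (notGate c t) ≤ 1 :=
  listCost_ctrlGate τ c t _

theorem listCost_toffoli {w : ℕ} (a b t : Fin m ⊕ Fin w) : listCost τ (toffoli a b t) ≤ 5 := by
  simp only [toffoli, listCost_append]
  have h1 := listCost_ctrlGate τ b t (fun x => if x then sqrtX else 1)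
  have h2 := listCost_ctrlGate τ b t (fun x => if x then sqrtX⁻¹ else 1)
  have h3 := listCost_ctrlGate τ a t (fun x => if x then sqrtX else 1)
  have h4 := listCost_cnot τ a b
  omega

theorem listCost_andFlags (k : ℕ) : listCost τ (andFlags m k) ≤ 6 * k := by
  induction k with
  | zero => simp [andFlags, listCost]
  | succ k ih =>
    rw [andFlags, listCost_append]
    split_ifs with h
    · rw [listCost_append]
      have h1 := listCost_toffoli τ (wq m k) (Sum.inl ⟨k, h⟩) (wq m (k + 1))
      have h2 := listCost_cnot τ (wq m k) (wq m (k + 1))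
      omega
    · simp only [listCost, List.map_nil, List.sum_nil] at *
      omega

theorem listCost_andFlagsInv (k : ℕ) : listCost τ (andFlagsInv m k) ≤ 6 * k := by
  induction k with
  | zero => simp [andFlagsInv, listCost]
  | succ k ih =>
    rw [andFlagsInv, listCost_append]
    split_ifs with h
    · rw [listCost_append]
      have h1 := listCost_toffoli τ (wq m k) (Sum.inl ⟨k, h⟩) (wq m (k + 1))
      have h2 := listCost_cnot τ (wq m k) (wq m (k + 1))
      omega
    · simp only [listCost, List.map_nil, List.sum_nil] at *
      omega

/-- The number of elementary steps of a circuit. -/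
def circuitCost (c : List (Op m)) : ℕ := listCost τ (c.flatMap Op.compile)

theorem circuitCost_append (c c' : List (Op m)) :
    circuitCost τ (c ++ c') = circuitCost τ c + circuitCost τ c' := by
  simp [circuitCost, listCost_append]

theorem circuitCost_cons (o : Op m) (c : List (Op m)) :
    circuitCost τ (o :: c) = listCost τ o.compile + circuitCost τ c := by
  simp [circuitCost, listCost_append]

theorem listCost_reflGood (n : ℕ) : listCost τ (Op.reflGood n).compile ≤ 12 * n + 6 := by
  simp only [Op.compile, listCost_append]
  have h1 := listCost_andFlags τ n
  have h2 := listCost_andFlagsInv τ n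
  have h3 := listCost_cnot τ (wq m (m + 1)) (wq m 0)
  have h4 := listCost_cnot τ (wq m (m + 1)) (wq m n)
  have h5 : listCost τ (zGate m n) ≤ 1 := listCost_ctrlGate τ _ _ _
  have h6 : listCost τ [Instr.reflProj (anc m n)] = 1 := rfl
  omega

theorem listCost_reflInit (n : ℕ) : listCost τ (Op.reflInit n).compile ≤ 12 * n + 5 := by
  simp only [Op.compile, listCost_append]
  have h1 := listCost_andFlags τ n
  have h2 := listCost_andFlagsInv τ n
  have h3 := listCost_cnot τ (wq m (m + 1)) (wq m 0)
  have h4 := listCost_notGate τ (wq m (m + 3)) (wq m 0)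
  have h6 : listCost τ [Instr.reflZero (anc m n)] = 1 := rfl
  omega

theorem circuitCost_invCircuit (c : List (Op m)) :
    circuitCost τ (invCircuit c) = circuitCost τ c := by
  have h : ∀ o : Op m, listCost τ o.inv.compile = listCost τ o.compile := by
    intro o
    cases o with
    | rot x =>
      simp only [Op.inv, Op.compile, ctrlGate]
      split_ifs <;> rfl
    | call i => rfl
    | callInv i => rfl
    | reflGood n => rfl
    | reflInit n => rfl
  induction c with
  | nil => rfl
  | cons o c ih =>
    rw [invCircuit] at *
    rw [List.map_cons, List.reverse_cons, circuitCost_append, ih, circuitCost_cons,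
      circuitCost_cons, h]
    simp [circuitCost, listCost, add_comm]

/-- `M` bounds the cost of the circuit `c`, together with the cost of reflections. -/
def Within (n : ℕ) (c : List (Op m)) (M : ℕ) : Prop := circuitCost τ c + (12 * n + 9) ≤ M

variable {τ}

/-- A Grover iteration uses the circuit twice, and its reflections cost at most `(12 * n + 6) + (12
* n + 5)`. The two extra copies of the margin `12 * n + 9` pay for them. -/
theorem Within.amplify {n : ℕ} {c : List (Op m)} {M : ℕ} (h : Within τ n c M) (k : ℕ) :
    Within τ n (amplify n c k) ((2 * k + 1) * M) := by
  induction k with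
  | zero => simpa [VarTime.amplify] using h
  | succ k ih =>
    rw [Within, VarTime.amplify, circuitCost_append, circuitCost_cons, circuitCost_append,
      circuitCost_cons, circuitCost_invCircuit]
    rw [Within] at h ih
    have h1 := listCost_reflGood τ n
    have h2 := listCost_reflInit τ n
    have h3 : (2 * (k + 1) + 1) * M = (2 * k + 1) * M + M + M := by ring
    omega

/-- Preparation, conjunction of flags, Hadamard test, measurements and restart add at most `6 * n +
9`, which explains the additive `9` in `Within`. -/
theorem cost_flip {n : ℕ} {c : List (Op m)} {M : ℕ} (h : Within τ n c M)
    {k : Bool → Program m (m + 4)} {X : ℕ} (hk : ∀ b, (k b).cost τ ≤ X) :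
    (flip n c k).cost τ ≤ M + X := by
  rw [flip, cost_applyList, listCost_append, listCost_append, listCost_append]
  have h1 := listCost_notGate τ (wq m (m + 3)) (wq m (m + 2))
  have h2 := listCost_cnot τ (wq m (m + 1)) (wq m 0)
  have h3 := listCost_andFlags τ n
  have h4 := listCost_ctrlGate τ (wq m (m + 2)) (wq m (m + 3)) (fun _ => hadamard)
  have h6 : listCost τ [Instr.reflProj (anc m (m + 3))] = 1 := rfl
  rw [Within, circuitCost] at h
  have := hk true
  have := hk false
  simp only [Program.cost, if_true, Bool.false_eq_true, if_false, cost_applyList,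
    listCost_append, h6, Bool.true_eq_false]
  omega

theorem circuitCost_callSteps (a l : ℕ) (h : a + l < m + 1) :
    circuitCost τ (callSteps m a l) ≤ τ.time ⟨a + l, h⟩ - τ.time ⟨a, by omega⟩ := by
  induction l with
  | zero => simp [callSteps, circuitCost, listCost]
  | succ l ih =>
    have hl : a + l < m := by omega
    rw [callSteps, circuitCost_append, dif_pos hl]
    have h1 := ih (by omega)
    have h2 : circuitCost τ [Op.call (⟨a + l, hl⟩ : Fin m)] =
        τ.time ⟨a + l + 1, by omega⟩ - τ.time ⟨a + l, by omega⟩ := rfl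
    have h3 : τ.time ⟨a, by omega⟩ ≤ τ.time ⟨a + l, by omega⟩ :=
      τ.strictMono.monotone (by simp)
    have h4 : τ.time ⟨a + l, by omega⟩ ≤ τ.time ⟨a + l + 1, by omega⟩ :=
      τ.strictMono.monotone (by simp)
    have h5 : τ.time ⟨a + (l + 1), h⟩ = τ.time ⟨a + l + 1, by omega⟩ := rfl
    omega

end Costs

/-! ### Repeated flips and a Chernoff bound for adaptive programs. -/

section Sampling

variable {m : ℕ}

/-- Repeat a flip `N` times, and continue with the number of successes, plus `j`. -/
def sample (n : ℕ) (c : List (Op m)) : ℕ → ℕ → (ℕ → Program m (m + 4)) → Program m (m + 4)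
  | 0, j, k => k j
  | N + 1, j, k => flip n c fun b => sample n c N (if b then j + 1 else j) k

theorem cost_sample {τ : StoppingTimes m} {n : ℕ} {c : List (Op m)} {M : ℕ}
    (h : Within τ n c M) {k : ℕ → Program m (m + 4)} {X : ℕ} (hk : ∀ j, (k j).cost τ ≤ X)
    (N j : ℕ) : (sample n c N j k).cost τ ≤ N * M + X := by
  induction N generalizing j with
  | zero => simpa [sample] using hk j
  | succ N ih =>
    have := cost_flip h (k := fun b => sample n c N (if b then j + 1 else j) k)
      (fun b => ih (if b then j + 1 else j))
    rw [sample, add_mul, one_mul]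
    omega

variable {H : Type u} [NormedAddCommGroup H] [InnerProductSpace ℂ H]
  (U : VariableTimeAlgorithm m H) {P : H →L[ℂ] H} {S : Set ℝ}

theorem weight_nonneg (P : H →L[ℂ] H) (S : Set ℝ) {w : ℕ} (A : Program m w) (ψ : Mem m w H) :
    0 ≤ A.weight U P S ψ := by
  induction A generalizing ψ with
  | output r => exact Set.indicator_nonneg (fun _ _ => sq_nonneg _) _
  | apply g k ih => exact ih _
  | measure q k ih => exact add_nonneg (ih _ _) (ih _ _)
  | restart k ih => exact mul_nonneg (sq_nonneg _) (ih _)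

theorem prob_nonneg (P : H →L[ℂ] H) (S : Set ℝ) {w : ℕ} (A : Program m w) :
    0 ≤ A.prob U P S := weight_nonneg U P S A _

theorem norm_initMem (w : ℕ) : ‖initMem w U‖ = 1 := by
  rw [← sq_eq_sq₀ (norm_nonneg _) zero_le_one, PiLp.norm_sq_eq_of_L2,
    Finset.sum_eq_single (fun _ => false)]
  · simp [initMem, norm_init]
  · intro f _ hf
    have : ¬ ∀ j, f j = false := fun h => hf (funext h)
    simp [initMem, this]
  · simp

theorem prob_output (P : H →L[ℂ] H) {w : ℕ} {r : ℝ} (hr : r ∈ S) :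
    (Program.output r : Program m w).prob U P S = 1 := by
  simp [Program.prob, Program.weight, hr, norm_initMem]

variable [CompleteSpace H] (hP : IsStarProjection P)

include hP

/-- Backward induction over the flips: averaging over one Bernoulli result multiplies each
exponential penalty by the moment generating function. Failure probabilities of the continuation are
thereby handled without describing the distribution of the count. -/
theorem le_prob_sample_of_exp {n : ℕ} (hn : n ≤ m) {c : List (Op m)} (hc : Below n c) {q : ℝ}
    (hq : ‖extProj P (circuitIso U hP c (extInit U))‖ ^ 2 = q) (hq1 : q ≤ 1)
    {k : ℕ → Program m (m + 4)} {V a b l : ℝ}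
    (hk : ∀ j : ℕ, V - a * Real.exp (l * j) - b * Real.exp (-l * j) ≤ (k j).prob U P S)
    (N j : ℕ) :
    V - a * Real.exp (l * j) * (1 - q + q * Real.exp l) ^ N -
      b * Real.exp (-l * j) * (1 - q + q * Real.exp (-l)) ^ N ≤ (sample n c N j k).prob U P S := by
  induction N generalizing j with
  | zero => simpa [sample] using hk j
  | succ N ih =>
    have hq0 : 0 ≤ q := by rw [← hq]; positivity
    rw [sample, prob_flip U hP S hn hc _ hq]
    have h1 := mul_le_mul_of_nonneg_left (ih (j + 1)) hq0
    have h2 := mul_le_mul_of_nonneg_left (ih j) (sub_nonneg.2 hq1)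
    simp only [if_true, Bool.false_eq_true, if_false]
    refine le_trans (le_of_eq ?_) (add_le_add h1 h2)
    push_cast
    rw [mul_add, mul_add, Real.exp_add, Real.exp_add, mul_one, mul_one]
    ring

/-- A Chernoff bound. -/
theorem le_prob_sample {n : ℕ} (hn : n ≤ m) {c : List (Op m)} (hc : Below n c) {q : ℝ}
    (hq : ‖extProj P (circuitIso U hP c (extInit U))‖ ^ 2 = q) (hq1 : q ≤ 1)
    {k : ℕ → Program m (m + 4)} {V η : ℝ} (hV : V ≤ 1) (hη : 0 < η) (hη1 : η ≤ 1) (N : ℕ)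
    (hk : ∀ j : ℕ, |j - N * q| ≤ N * η → V ≤ (k j).prob U P S) :
    V - 2 * Real.exp (-(N * η ^ 2 / 4)) ≤ (sample n c N 0 k).prob U P S := by
  have hq0 : 0 ≤ q := by rw [← hq]; positivity
  -- The coefficients make one penalty at least `1` as soon as the count leaves the window. The
  -- terminal bound is then at most `V - 1 ≤ 0` and holds trivially.
  have h := le_prob_sample_of_exp U hP hn hc hq hq1 (k := k) (V := V) (l := η / 2)
    (a := Real.exp (-(η / 2) * (N * q + N * η))) (b := Real.exp ((η / 2) * (N * q - N * η)))
    (S := S) (by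
      intro j
      by_cases hj : |j - N * q| ≤ N * η
      · have := hk j hj
        have e1 := Real.exp_pos (-(η / 2) * (N * q + N * η))
        have e2 := Real.exp_pos (η / 2 * j)
        have e3 := Real.exp_pos ((η / 2) * (N * q - N * η))
        have e4 := Real.exp_pos (-(η / 2) * j)
        nlinarith [mul_pos e1 e2, mul_pos e3 e4]
      · have h0 := prob_nonneg U P S (k j)
        rw [← Real.exp_add, ← Real.exp_add]
        have e1 := Real.exp_pos (-(η / 2) * (N * q + N * η) + η / 2 * j)
        have e2 := Real.exp_pos ((η / 2) * (N * q - N * η) + -(η / 2) * j)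
        rw [not_le, lt_abs] at hj
        rcases hj with hj | hj
        · have : 1 ≤ Real.exp (-(η / 2) * (N * q + N * η) + η / 2 * j) := by
            rw [Real.one_le_exp_iff]; nlinarith
          linarith
        · have : 1 ≤ Real.exp ((η / 2) * (N * q - N * η) + -(η / 2) * j) := by
            rw [Real.one_le_exp_iff]; nlinarith
          linarith) N 0
  refine le_trans ?_ h
  -- The estimate `exp l ≤ 1 + l + l ^ 2`, with `l ^ 2 = η ^ 2 / 4`, bounds the moment generating
  -- function.
  have key : ∀ l : ℝ, |l| = η / 2 →
      (1 - q + q * Real.exp l) ^ N ≤ Real.exp (N * (q * l + η ^ 2 / 4)) := by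
    intro l hl
    have h1 := Real.abs_exp_sub_one_sub_id_le (x := l) (by rw [hl]; linarith)
    have h2 : l ^ 2 = η ^ 2 / 4 := by rw [← sq_abs, hl]; ring
    have h3 : Real.exp l - 1 ≤ l + η ^ 2 / 4 := by rw [← h2]; linarith [(abs_le.1 h1).2]
    have h4 : 1 - q + q * Real.exp l ≤ Real.exp (q * l + η ^ 2 / 4) := by
      refine le_trans ?_ (Real.add_one_le_exp _)
      nlinarith [mul_le_mul_of_nonneg_left h3 hq0, sq_nonneg η]
    have h5 : 0 ≤ 1 - q + q * Real.exp l := by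
      have := Real.exp_pos l
      nlinarith
    rw [Real.exp_nat_mul]
    exact pow_le_pow_left₀ h5 h4 N
  have k1 := key (η / 2) (abs_of_pos (by linarith))
  have k2 := key (-(η / 2)) (by rw [abs_neg]; exact abs_of_pos (by linarith))
  have e1 := mul_le_mul_of_nonneg_left k1 (Real.exp_pos (-(η / 2) * (N * q + N * η))).le
  have e2 := mul_le_mul_of_nonneg_left k2 (Real.exp_pos ((η / 2) * (N * q - N * η))).le
  rw [← Real.exp_add] at e1 e2
  have f1 : -(η / 2) * (N * q + N * η) + N * (q * (η / 2) + η ^ 2 / 4) = -(N * η ^ 2 / 4) := by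
    ring
  have f2 : (η / 2) * (N * q - N * η) + N * (q * -(η / 2) + η ^ 2 / 4) = -(N * η ^ 2 / 4) := by
    ring
  rw [f1] at e1
  rw [f2] at e2
  simp only [Nat.cast_zero, mul_zero, Real.exp_zero, mul_one]
  linarith

end Sampling

/-! ### Choosing odd multiples of an angle so that `sin ^ 2` can be inverted. -/

section Angles

/-- On the intervals between consecutive multiples of `π / 2`, the values of `sin ^ 2` determine
the argument. -/
theorem sq_sin_sub_le {y z : ℝ} (n : ℕ) (hy : n * (Real.pi / 2) ≤ y)
    (hy' : y ≤ (n + 1) * (Real.pi / 2)) (hz : n * (Real.pi / 2) ≤ z)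
    (hz' : z ≤ (n + 1) * (Real.pi / 2)) :
    (2 / Real.pi * (y - z)) ^ 2 ≤ |Real.sin y ^ 2 - Real.sin z ^ 2| := by
  wlog hyz : z ≤ y generalizing y z
  · have := this hz hz' hy hy' (le_of_not_ge hyz)
    rw [abs_sub_comm]
    refine le_trans (le_of_eq ?_) this
    ring
  have hpi := Real.pi_pos
  have h1 : Real.sin y ^ 2 - Real.sin z ^ 2 = Real.sin (y + z) * Real.sin (y - z) := by
    rw [Real.sin_add, Real.sin_sub]
    linear_combination (-Real.sin y ^ 2) * Real.sin_sq_add_cos_sq z +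
      Real.sin z ^ 2 * Real.sin_sq_add_cos_sq y
  have h2 : |Real.sin (y + z)| = |Real.sin (y + z - n * Real.pi)| := by
    rw [Real.sin_sub_nat_mul_pi, abs_mul, abs_pow, abs_neg, abs_one, one_pow, one_mul]
  have h0 : 0 ≤ y - z := by linarith
  have h0' : y - z ≤ Real.pi / 2 := by linarith
  have h3 : 2 / Real.pi * (y - z) ≤ Real.sin (y - z) := Real.mul_le_sin h0 h0'
  -- Modulo `π`, the sum `y + z` lies between `y - z` and `π - (y - z)`. The difference of the
  -- squares is thus at least `sin (y - z) ^ 2`. The bound is only quadratic because `sin ^ 2` is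
  -- flat at the ends of a branch.
  have h4 : Real.sin (y - z) ≤ Real.sin (y + z - n * Real.pi) := by
    by_cases hh : y + z - n * Real.pi ≤ Real.pi / 2
    · exact Real.sin_le_sin_of_le_of_le_pi_div_two (by linarith) hh (by linarith)
    · rw [← Real.sin_pi_sub (y + z - n * Real.pi)]
      exact Real.sin_le_sin_of_le_of_le_pi_div_two (by linarith) (by linarith) (by linarith)
  have h5 : 0 ≤ 2 / Real.pi * (y - z) := by positivity
  rw [h1, abs_mul, h2, abs_of_nonneg (h5.trans (h3.trans h4)), abs_of_nonneg (h5.trans h3), sq]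
  exact mul_le_mul (h3.trans h4) h3 h5 (h5.trans (h3.trans h4))

/-- For an interval `[x, x + ω]`, there is a suitable odd multiple of its points. -/
theorem exists_window {x ω : ℝ} (hx : 0 ≤ x) (hx' : x ≤ 1 / 4) (hω : 0 < ω) (hω' : ω ≤ 1 / 4) :
    ∃ k n : ℕ, n * (Real.pi / 2) ≤ (2 * k + 1) * x ∧
      (2 * k + 1) * (x + ω) ≤ (n + 1) * (Real.pi / 2) ∧
      1 ≤ 48 * ((2 * k + 1) * ω) ∧ (2 * k + 1) * ω ≤ 2 := by
  have hpi := Real.pi_gt_d2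
  have hpi4 := Real.pi_lt_d2
  obtain ⟨X, hX⟩ : ∃ X, X = 1 / (16 * ω) := ⟨_, rfl⟩
  have hXω : X * ω = 1 / 16 := by rw [hX]; field_simp
  have hX4 : 1 / 4 ≤ X := by
    rw [hX, div_le_div_iff₀ (by norm_num) (by positivity)]; linarith
  -- If `X * x` is small, an odd number near `X` keeps the interval in the branch `n = 0`. Otherwise
  -- the left end is moved just past a multiple of `π / 2`.
  by_cases hc : X * x ≤ Real.pi / 16
  · obtain ⟨k, hk1, hk2⟩ : ∃ k : ℕ, (2 * k + 1 : ℝ) ≤ max 1 X ∧ X ≤ 3 * (2 * k + 1) := by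
      refine ⟨⌊(X - 1) / 2⌋₊, ?_, ?_⟩
      · by_cases h1 : 1 ≤ X
        · have := Nat.floor_le (show 0 ≤ (X - 1) / 2 by linarith)
          rw [max_eq_right h1]
          linarith
        · rw [Nat.floor_of_nonpos (by linarith)]
          simp
      · have := Nat.lt_floor_add_one ((X - 1) / 2)
        have h0 : (0 : ℝ) ≤ ⌊(X - 1) / 2⌋₊ := Nat.cast_nonneg _
        linarith
    have hr : (2 * k + 1 : ℝ) ≤ 4 * X := hk1.trans (max_le (by linarith) (by linarith))
    refine ⟨k, 0, ?_, ?_, ?_, ?_⟩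
    · simp; positivity
    · have e1 := mul_le_mul_of_nonneg_right hr hx
      have e2 := mul_le_mul_of_nonneg_right hr hω.le
      simp only [Nat.cast_zero, zero_add, one_mul]
      nlinarith
    · have := mul_le_mul_of_nonneg_right hk2 hω.le
      nlinarith
    · have e2 := mul_le_mul_of_nonneg_right hr hω.le
      nlinarith
  · rw [not_le] at hc
    have hx0 : 0 < x := by
      rcases hx.lt_or_eq with h | h
      · exact h
      · rw [← h] at hc; nlinarith
    obtain ⟨n, hn1, hn2⟩ : ∃ n : ℕ, X * x ≤ n * (Real.pi / 2) ∧
        n * (Real.pi / 2) ≤ X * x + Real.pi / 2 := by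
      refine ⟨⌈X * x / (Real.pi / 2)⌉₊, ?_, ?_⟩
      · have := Nat.le_ceil (X * x / (Real.pi / 2))
        rwa [div_le_iff₀ (by linarith)] at this
      · have := (Nat.ceil_lt_add_one (show 0 ≤ X * x / (Real.pi / 2) by positivity)).le
        have h2 := mul_le_mul_of_nonneg_right this (show 0 ≤ Real.pi / 2 by linarith)
        rwa [add_mul, one_mul, div_mul_cancel₀ _ (by linarith)] at h2
    have hn0 : 1 ≤ (n : ℝ) := by
      have : 0 < n := by
        rcases Nat.eq_zero_or_pos n with h | h
        · rw [h] at hn1; simp at hn1; linarith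
        · exact h
      exact_mod_cast this
    obtain ⟨Y, hY⟩ : ∃ Y, Y = n * (Real.pi / 2) / x := ⟨_, rfl⟩
    have hYx : Y * x = n * (Real.pi / 2) := by rw [hY]; field_simp
    have hY1 : 1 ≤ Y := by
      rw [hY, le_div_iff₀ hx0]
      nlinarith
    obtain ⟨k, hk1, hk2⟩ : ∃ k : ℕ, Y ≤ 2 * k + 1 ∧ (2 * k + 1 : ℝ) ≤ Y + 2 := by
      refine ⟨⌈(Y - 1) / 2⌉₊, ?_, ?_⟩
      · have := Nat.le_ceil ((Y - 1) / 2)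
        linarith
      · have := Nat.ceil_lt_add_one (show 0 ≤ (Y - 1) / 2 by linarith)
        linarith
    -- Here `X * x > π / 16`, so rounding up by at most `π / 2` costs at most `8 * X * x`.
    have hYX : Y ≤ 9 * X := by
      have : Y * x ≤ 9 * X * x := by rw [hYx]; nlinarith
      exact le_of_mul_le_mul_right this hx0
    have hXY : X ≤ Y := by
      have : X * x ≤ Y * x := by rw [hYx]; exact hn1
      exact le_of_mul_le_mul_right this hx0
    have e1 := mul_le_mul_of_nonneg_right hk1 hx
    have e2 := mul_le_mul_of_nonneg_right hk2 hx
    have e3 := mul_le_mul_of_nonneg_right (show (2 * k + 1 : ℝ) ≤ 17 * X by linarith) hω.le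
    have e4 := mul_le_mul_of_nonneg_right (hXY.trans hk1) hω.le
    -- The right end is at most `n * (π / 2) + 2 * x + 17 * X * ω ≤ n * (π / 2) + 25 / 16`, and `25
    -- / 16` is just below `π / 2`.
    refine ⟨k, n, ?_, ?_, ?_, ?_⟩ <;> nlinarith

/-- The number of Grover iterations for the interval `[x, x + ω]`. -/
def windowIter (x ω : ℝ) : ℕ :=
  if h : 0 ≤ x ∧ x ≤ 1 / 4 ∧ 0 < ω ∧ ω ≤ 1 / 4 then
    (exists_window h.1 h.2.1 h.2.2.1 h.2.2.2).choose else 0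

theorem windowIter_le {x ω : ℝ} (hω : 0 < ω) (hω' : ω ≤ 1 / 4) :
    (2 * windowIter x ω + 1) * ω ≤ 2 := by
  rw [windowIter]
  split_ifs with h
  · exact (exists_window h.1 h.2.1 h.2.2.1 h.2.2.2).choose_spec.choose_spec.2.2.2
  · simp; linarith

/-- The accuracy of the estimates of probabilities. -/
def sampleAcc : ℝ := 1 / 400000

open Classical in
/-- The next interval starts here, if `p` is the observed frequency. -/
def nextLow (x ω p : ℝ) : ℝ :=
  if h : ∃ θ, x ≤ θ ∧ θ ≤ x + ω ∧
      |Real.sin ((2 * windowIter x ω + 1) * θ) ^ 2 - p| ≤ sampleAcc then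
    max 0 (h.choose - ω / 4) else 0

/-- Any angle of the interval that is compatible with the observed frequency is within `ω / 4` of
the true one, so an interval of half the length around it still contains `θ`. -/
theorem nextLow_spec {x ω p θ : ℝ} (hx : 0 ≤ x) (hω : 0 < ω) (hω' : ω ≤ 1 / 4) (hθ : x ≤ θ)
    (hθ' : θ ≤ x + ω) (hθ4 : θ ≤ 1 / 4)
    (hp : |Real.sin ((2 * windowIter x ω + 1) * θ) ^ 2 - p| ≤ sampleAcc) :
    0 ≤ nextLow x ω p ∧ nextLow x ω p ≤ θ ∧ θ ≤ nextLow x ω p + ω / 2 := by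
  have h : ∃ θ, x ≤ θ ∧ θ ≤ x + ω ∧
      |Real.sin ((2 * windowIter x ω + 1) * θ) ^ 2 - p| ≤ sampleAcc := ⟨θ, hθ, hθ', hp⟩
  rw [nextLow, dif_pos h]
  obtain ⟨h1, h2, h3⟩ := h.choose_spec
  set θ' := h.choose
  have hpi := Real.pi_pos
  have hpi4 := Real.pi_lt_d2
  have hw : 0 ≤ x ∧ x ≤ 1 / 4 ∧ 0 < ω ∧ ω ≤ 1 / 4 := ⟨hx, hθ.trans hθ4, hω, hω'⟩
  obtain ⟨n, w1, w2, w3, -⟩ := (exists_window hw.1 hw.2.1 hw.2.2.1 hw.2.2.2).choose_spec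
  have hk : windowIter x ω = (exists_window hw.1 hw.2.1 hw.2.2.1 hw.2.2.2).choose := by
    rw [windowIter, dif_pos hw]
  rw [← hk] at w1 w2 w3
  obtain ⟨r, hr⟩ : ∃ r : ℝ, r = 2 * windowIter x ω + 1 := ⟨_, rfl⟩
  rw [← hr] at w1 w2 w3 h3 hp
  have hr0 : 0 < r := by rw [hr]; positivity
  have key := sq_sin_sub_le (y := r * θ) (z := r * θ') n
    (w1.trans (mul_le_mul_of_nonneg_left hθ hr0.le))
    ((mul_le_mul_of_nonneg_left hθ' hr0.le).trans w2)
    (w1.trans (mul_le_mul_of_nonneg_left h1 hr0.le))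
    ((mul_le_mul_of_nonneg_left h2 hr0.le).trans w2)
  have h4 : |Real.sin (r * θ) ^ 2 - Real.sin (r * θ') ^ 2| ≤ 2 * sampleAcc := by
    rw [abs_le] at *
    constructor <;> linarith [h3.1, h3.2, hp.1, hp.2]
  have h5 : |θ - θ'| ≤ ω / 4 := by
    rw [← abs_of_pos (show 0 < ω / 4 by linarith)]
    apply sq_le_sq.1
    have h6 : (2 / Real.pi) ^ 2 * (r * (θ - θ')) ^ 2 ≤ 2 * sampleAcc := by
      refine le_trans (le_of_eq ?_) (key.trans h4)
      ring
    have h7 : (2 / Real.pi) ^ 2 ≥ 2 / 5 := by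
      rw [ge_iff_le, div_pow, div_le_div_iff₀ (by norm_num) (by positivity)]
      nlinarith
    have h8 : (r * (θ - θ')) ^ 2 ≤ 5 * sampleAcc := by
      nlinarith [sq_nonneg (r * (θ - θ'))]
    have h9 : (1 / 48) ^ 2 ≤ (r * ω) ^ 2 := pow_le_pow_left₀ (by norm_num) (by linarith) 2
    -- This fixes `sampleAcc`: `5 * sampleAcc = 1 / 80000` lies below `(1 / 192) ^ 2`, the bound
    -- coming from `r * ω ≥ 1 / 48`.
    have h10 : r ^ 2 * (θ - θ') ^ 2 ≤ r ^ 2 * (ω / 4) ^ 2 := by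
      rw [← mul_pow]
      refine h8.trans ?_
      rw [sampleAcc]
      nlinarith
    exact le_of_mul_le_mul_left h10 (by positivity)
  rw [abs_le] at h5
  refine ⟨le_max_left _ _, max_le (hx.trans hθ) (by linarith), ?_⟩
  have := le_max_right 0 (θ' - ω / 4)
  linarith

end Angles

/-! ### Amplitude estimation by repeated halving of an interval. -/

section AmplitudeEstimation

variable {m : ℕ}

/-- The accuracy of an angle when `i` rounds are left. -/
def width (K i : ℕ) : ℝ := 2 ^ i / 2 ^ K / 4

theorem width_pos (K i : ℕ) : 0 < width K i := by rw [width]; positivity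

theorem width_succ (K i : ℕ) : width K (i + 1) = 2 * width K i := by
  rw [width, width, pow_succ]; ring

theorem width_le {K i : ℕ} (h : i ≤ K) : width K i ≤ 1 / 4 := by
  have : (2 : ℝ) ^ i / 2 ^ K ≤ 1 := by
    rw [div_le_one (by positivity)]
    exact pow_le_pow_right₀ (by norm_num) h
  rw [width]
  linarith

/-- The number of repetitions when `i` rounds are left. -/
def trials (δ : ℝ) (i : ℕ) : ℕ := ⌈4 / sampleAcc ^ 2 * Real.log (2 * 2 ^ i / δ)⌉₊

theorem two_mul_exp_trials {δ : ℝ} (hδ : 0 < δ) (i : ℕ) :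
    2 * Real.exp (-(trials δ i * sampleAcc ^ 2 / 4)) ≤ δ / 2 ^ i := by
  have hs : 0 < sampleAcc ^ 2 := by rw [sampleAcc]; norm_num
  have h1 : 4 / sampleAcc ^ 2 * Real.log (2 * 2 ^ i / δ) ≤ trials δ i := Nat.le_ceil _
  have h2 : Real.log (2 * 2 ^ i / δ) ≤ trials δ i * sampleAcc ^ 2 / 4 := by
    rw [div_mul_eq_mul_div, div_le_iff₀ hs] at h1
    linarith
  have h3 : Real.exp (-(trials δ i * sampleAcc ^ 2 / 4)) ≤ δ / (2 * 2 ^ i) := by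
    rw [← Real.exp_log (show 0 < δ / (2 * 2 ^ i) by positivity), Real.exp_le_exp]
    rw [show δ / (2 * 2 ^ i) = (2 * 2 ^ i / δ)⁻¹ by rw [inv_div], Real.log_inv]
    linarith
  calc _ ≤ 2 * (δ / (2 * 2 ^ i)) := by linarith
    _ = _ := by field_simp

theorem trials_pos {δ : ℝ} (hδ : 0 < δ) (hδ1 : δ ≤ 1) (i : ℕ) : 0 < trials δ i := by
  have hs : 0 < 4 / sampleAcc ^ 2 := by rw [sampleAcc]; norm_num
  refine Nat.ceil_pos.2 (mul_pos hs (Real.log_pos ?_))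
  rw [lt_div_iff₀ hδ]
  linarith [one_le_pow₀ (M₀ := ℝ) (a := 2) (by norm_num) (n := i)]

/-- The factor in the bound of the number of repetitions. -/
def trialsConst : ℝ := 4 / sampleAcc ^ 2 + 1

theorem trials_le {δ : ℝ} (hδ : 0 < δ) (hδ1 : δ ≤ 1) (i : ℕ) :
    (trials δ i : ℝ) ≤ trialsConst * (1 + Real.log (1 / δ) + i) := by
  have hs : 0 < 4 / sampleAcc ^ 2 := by rw [sampleAcc]; norm_num
  have hl : 0 ≤ Real.log (1 / δ) := Real.log_nonneg (by rw [le_div_iff₀ hδ]; linarith)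
  have hl2 : Real.log 2 ≤ 1 := by linarith [Real.log_two_lt_d9]
  have hl20 : 0 < Real.log 2 := Real.log_pos (by norm_num)
  have h1 : Real.log (2 * 2 ^ i / δ) = Real.log (1 / δ) + (i + 1) * Real.log 2 := by
    rw [show 2 * 2 ^ i / δ = (1 / δ) * 2 ^ (i + 1) by rw [pow_succ]; ring,
      Real.log_mul (by positivity) (by positivity), Real.log_pow]
    push_cast
    ring
  have h2 : Real.log (2 * 2 ^ i / δ) ≤ 1 + Real.log (1 / δ) + i := by
    rw [h1]
    have : (i + 1) * Real.log 2 ≤ (i + 1) * 1 :=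
      mul_le_mul_of_nonneg_left hl2 (by positivity)
    linarith
  have h3 : 0 ≤ Real.log (2 * 2 ^ i / δ) := by rw [h1]; positivity
  have h4 := (Nat.ceil_lt_add_one (mul_nonneg hs.le h3)).le
  rw [trials, trialsConst, add_mul, one_mul]
  have h5 := mul_le_mul_of_nonneg_left h2 hs.le
  have : (0 : ℝ) ≤ i := Nat.cast_nonneg i
  linarith

/-- Amplitude estimation: find an angle up to an error `width K 0`. -/
def estimate (n : ℕ) (c : List (Op m)) (δ : ℝ) (K : ℕ) :
    ℕ → ℝ → (ℝ → Program m (m + 4)) → Program m (m + 4)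
  | 0, x, k => k x
  | i + 1, x, k =>
    sample n (amplify n c (windowIter x (width K (i + 1)))) (trials δ (i + 1)) 0 fun j =>
      estimate n c δ K i (nextLow x (width K (i + 1)) (j / trials δ (i + 1))) k

/-- The round with `i` rounds left amplifies by at most `8 * 2 ^ K / 2 ^ i` and repeats of order `1
+ log (1 / δ) + i` times. The last factor is the closed form of the partial sums of `(1 + log (1 /
δ) + i) / 2 ^ i`, which stay below `3 + log (1 / δ)`: the most expensive rounds are the last ones,
and they repeat least. -/
theorem cost_estimate {τ : StoppingTimes m} {n : ℕ} {c : List (Op m)} {M : ℕ}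
    (h : Within τ n c M) {δ : ℝ} (hδ : 0 < δ) (hδ1 : δ ≤ 1) {k : ℝ → Program m (m + 4)} {X : ℝ}
    (hk : ∀ x, ((k x).cost τ : ℝ) ≤ X) (K i : ℕ) (hi : i ≤ K) (x : ℝ) :
    ((estimate n c δ K i x k).cost τ : ℝ) ≤ X + 8 * trialsConst * M * 2 ^ K *
      ((3 + Real.log (1 / δ)) - (3 + Real.log (1 / δ) + i) / 2 ^ i) := by
  induction i generalizing x with
  | zero => simpa [estimate] using hk x
  | succ i ih =>
    set w := windowIter x (width K (i + 1)) with hw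
    have ih' := ih (by omega)
    set Y := X + 8 * trialsConst * M * 2 ^ K *
      ((3 + Real.log (1 / δ)) - (3 + Real.log (1 / δ) + i) / 2 ^ i) with hY
    have hc : ∀ j : ℕ, (estimate n c δ K i (nextLow x (width K (i + 1)) (j / trials δ (i + 1)))
        k).cost τ ≤ ⌊Y⌋₊ := fun j => Nat.le_floor (ih' _)
    have hY0 : 0 ≤ Y := le_trans (Nat.cast_nonneg _) (ih' x)
    have h1 : ((estimate n c δ K (i + 1) x k).cost τ : ℝ) ≤
        trials δ (i + 1) * ((2 * w + 1) * M) + Y := by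
      have := cost_sample (h.amplify w) hc (trials δ (i + 1)) 0
      have h2 : ((estimate n c δ K (i + 1) x k).cost τ : ℝ) ≤
          ((trials δ (i + 1) * ((2 * w + 1) * M) + ⌊Y⌋₊ : ℕ) : ℝ) := by
        exact_mod_cast this
      refine h2.trans ?_
      push_cast
      linarith [Nat.floor_le hY0]
    have h2 : (2 * (w : ℝ) + 1) ≤ 8 * 2 ^ K / 2 ^ (i + 1) := by
      have := windowIter_le (x := x) (width_pos K (i + 1)) (width_le hi)
      rw [← hw, width] at this
      rw [le_div_iff₀ (by positivity)]
      have h3 : (2 * (w : ℝ) + 1) * 2 ^ (i + 1) =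
          4 * 2 ^ K * ((2 * w + 1) * (2 ^ (i + 1) / 2 ^ K / 4)) := by
        field_simp
      rw [h3]
      nlinarith [show (0 : ℝ) < 2 ^ K by positivity]
    have h3 := trials_le hδ hδ1 (i + 1)
    have h4 : (trials δ (i + 1) : ℝ) * ((2 * w + 1) * M) ≤
        trialsConst * (1 + Real.log (1 / δ) + (i + 1 : ℕ)) * (8 * 2 ^ K / 2 ^ (i + 1) * M) := by
      refine mul_le_mul h3 (mul_le_mul_of_nonneg_right h2 (Nat.cast_nonneg _)) (by positivity) ?_
      exact le_trans (Nat.cast_nonneg _) h3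
    refine h1.trans ((add_le_add_left h4 _).trans (le_of_eq ?_))
    rw [hY]
    push_cast
    field_simp
    ring

variable {H : Type u} [NormedAddCommGroup H] [InnerProductSpace ℂ H] [CompleteSpace H]
  (U : VariableTimeAlgorithm m H) {P : H →L[ℂ] H} {S : Set ℝ} (hP : IsStarProjection P)

-- The round with `i` rounds left fails with probability at most `δ / 2 ^ i`, and these sum to `δ *
-- (1 - 1 / 2 ^ i)`.
include hP in
theorem le_prob_estimate {n : ℕ} (hn : n ≤ m) {c : List (Op m)} (hc : Below n c) {θ : ℝ}
    (hθ : Real.sin θ = ‖extProj P (circuitIso U hP c (extInit U))‖) (hθ4 : θ ≤ 1 / 4)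
    {δ : ℝ} (hδ : 0 < δ) (hδ1 : δ ≤ 1) {V : ℝ} (hV : V ≤ 1) {k : ℝ → Program m (m + 4)} (K : ℕ)
    (hk : ∀ x, |x - θ| ≤ width K 0 → V ≤ (k x).prob U P S) (i : ℕ) (hi : i ≤ K) {x : ℝ}
    (hx : 0 ≤ x) (hxθ : x ≤ θ) (hθx : θ ≤ x + width K i) :
    V - δ * (1 - 1 / 2 ^ i) ≤ (estimate n c δ K i x k).prob U P S := by
  induction i generalizing x with
  | zero =>
    simp only [pow_zero, div_one, sub_self, mul_zero, sub_zero]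
    exact hk x (by rw [abs_le]; constructor <;> linarith [width_pos K 0])
  | succ i ih =>
    have hq := norm_extProj_amplify U hP hn hc (windowIter x (width K (i + 1))) hθ
    have hs : 0 < sampleAcc := by rw [sampleAcc]; norm_num
    have hV' : V - δ * (1 - 1 / 2 ^ i) ≤ 1 := by
      have : (1 : ℝ) / 2 ^ i ≤ 1 := by
        rw [div_le_one (by positivity)]; exact one_le_pow₀ (by norm_num)
      nlinarith
    have key := le_prob_sample U hP hn (hc.amplify hn (windowIter x (width K (i + 1)))) hq
      (Real.sin_sq_le_one _) (S := S) (k := fun j : ℕ =>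
        estimate n c δ K i (nextLow x (width K (i + 1)) (j / trials δ (i + 1))) k)
      (V := V - δ * (1 - 1 / 2 ^ i)) hV' hs (by rw [sampleAcc]; norm_num) (trials δ (i + 1)) (by
        intro j hj
        have hN : 0 < (trials δ (i + 1) : ℝ) := Nat.cast_pos.2 (trials_pos hδ hδ1 (i + 1))
        have hp : |Real.sin ((2 * windowIter x (width K (i + 1)) + 1) * θ) ^ 2 -
            j / trials δ (i + 1)| ≤ sampleAcc := by
          rw [abs_sub_comm, ← mul_le_mul_iff_right₀ hN, ← abs_of_pos hN, ← abs_mul, mul_sub,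
            abs_of_pos hN, mul_div_cancel₀ _ hN.ne']
          exact hj
        obtain ⟨h1, h2, h3⟩ := nextLow_spec hx (width_pos K (i + 1)) (width_le hi) hxθ hθx hθ4 hp
        refine ih (by omega) h1 h2 ?_
        rw [width_succ] at h3 ⊢
        linarith)
    refine le_trans ?_ key
    have h2 := two_mul_exp_trials hδ (i + 1)
    have h3 : δ / 2 ^ (i + 1) = δ * (1 / 2 ^ i) - δ * (1 / 2 ^ (i + 1)) := by
      field_simp
      ring
    linarith

end AmplitudeEstimation

/-! ### Size and stability of the Dirichlet kernel near zero. -/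

section DirichletKernel

theorem abs_cos_sub_cos_le (x y : ℝ) : |Real.cos x - Real.cos y| ≤ |x + y| * |x - y| / 2 := by
  rw [Real.cos_sub_cos, abs_mul, abs_mul, abs_neg, abs_of_pos (show (0 : ℝ) < 2 by norm_num)]
  have h1 : |Real.sin ((x + y) / 2)| ≤ |(x + y) / 2| := Real.abs_sin_le_abs
  have h2 : |Real.sin ((x - y) / 2)| ≤ |(x - y) / 2| := Real.abs_sin_le_abs
  rw [abs_div, abs_of_pos (show (0 : ℝ) < 2 by norm_num)] at h1 h2
  have := mul_le_mul h1 h2 (abs_nonneg _) (by positivity)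
  linarith

/-- Each cosine is even, so its increment carries the factor `|x + y|` besides `|x - y|`. For small
angles this makes the kernel stable to second order. The constant comes from `∑ 4 * l ^ 2 ≤ 4 * k ^
3`. -/
theorem abs_dirichlet_sub_le (k : ℕ) (x y : ℝ) :
    |dirichlet k x - dirichlet k y| ≤ 4 * k ^ 3 * (|x + y| * |x - y|) := by
  induction k with
  | zero => simp [dirichlet]
  | succ k ih =>
    have h1 := abs_cos_sub_cos_le (2 * (k + 1) * x) (2 * (k + 1) * y)
    rw [← mul_add, ← mul_sub, abs_mul _ (x + y), abs_mul _ (x - y),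
      abs_of_pos (show (0 : ℝ) < 2 * (k + 1) by positivity)] at h1
    have h2 : |dirichlet (k + 1) x - dirichlet (k + 1) y| ≤ |dirichlet k x - dirichlet k y| +
        2 * |Real.cos (2 * (k + 1) * x) - Real.cos (2 * (k + 1) * y)| := by
      rw [dirichlet, dirichlet, show ∀ a b c d : ℝ, a + 2 * b - (c + 2 * d) =
        (a - c) + 2 * (b - d) by intros; ring]
      refine (abs_add_le _ _).trans (le_of_eq ?_)
      rw [abs_mul, abs_of_pos (show (0 : ℝ) < 2 by norm_num)]
    have h3 : 0 ≤ |x + y| * |x - y| := by positivity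
    have hk : (0 : ℝ) ≤ k := Nat.cast_nonneg k
    have h4 : (4 * (k : ℝ) ^ 3 + 4 * (k + 1) ^ 2) * (|x + y| * |x - y|) ≤
        4 * (k + 1) ^ 3 * (|x + y| * |x - y|) := by
      refine mul_le_mul_of_nonneg_right ?_ h3
      nlinarith [mul_nonneg hk hk]
    push_cast
    nlinarith

theorem dirichlet_at_zero (k : ℕ) : dirichlet k 0 = 2 * k + 1 := by
  induction k with
  | zero => simp [dirichlet]
  | succ k ih =>
    rw [dirichlet, ih]
    simp
    ring

theorem le_dirichlet (k : ℕ) (x : ℝ) :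
    (2 * k + 1) * (1 - ((2 * k + 1) * x) ^ 2 / 2) ≤ dirichlet k x := by
  have h := abs_dirichlet_sub_le k 0 x
  rw [dirichlet_at_zero, zero_add, zero_sub, abs_neg, ← sq, sq_abs] at h
  have hk : (0 : ℝ) ≤ k := Nat.cast_nonneg k
  have h1 : 4 * (k : ℝ) ^ 3 * x ^ 2 ≤ (2 * k + 1) ^ 3 / 2 * x ^ 2 :=
    mul_le_mul_of_nonneg_right (by nlinarith [mul_nonneg hk hk, mul_nonneg hk (mul_nonneg hk hk)])
      (sq_nonneg x)
  have := le_of_abs_le h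
  nlinarith

/-- The number of Grover iterations that takes the angle `θ` to about `u`. -/
def amplifyIter (u θ : ℝ) : ℕ := ⌊(u / θ - 1) / 2⌋₊

/-- With `r = 2 * k + 1`, the amplified angle `r * θ'` is at least `u / 3`, and at most `u` unless
`k = 0`. The kernel is between `r * (1 - u ^ 2)` and about `r`, and its error is of order `r ^ 3 *
θ' * |θ' - θ|`, hence of relative order `(r * θ') ^ 2 * ε ≤ ε * u ^ 2`. -/
theorem amplifyIter_spec {u ε θ θ' : ℝ} (hu : 0 < u) (hu' : u ≤ 1 / 16) (hε : 0 < ε)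
    (hε' : ε ≤ 1 / 32) (hθ : 0 ≤ θ) (hsin : Real.sin θ ≤ 11 / 10 * u) (hθ4 : θ ≤ 1 / 4)
    (hθ' : 0 < θ') (h : |θ' - θ| ≤ ε * θ' / 8) :
    (2 * amplifyIter u θ' + 1) * (1 - u ^ 2) ≤ dirichlet (amplifyIter u θ') θ ∧
    u / 5 ≤ dirichlet (amplifyIter u θ') θ * Real.sin θ ∧
    dirichlet (amplifyIter u θ') θ * Real.sin θ ≤ 11 / 10 * u ∧
    |dirichlet (amplifyIter u θ') θ' - dirichlet (amplifyIter u θ') θ| ≤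
      ε * u ^ 2 / 2 * dirichlet (amplifyIter u θ') θ := by
  have hpi := Real.pi_gt_d2
  have hpi4 := Real.pi_lt_d2
  obtain ⟨h1, h2⟩ := abs_le.1 h
  have hεθ : ε * θ' ≤ θ' / 32 := by nlinarith
  have hεθ0 : 0 < ε * θ' := by positivity
  obtain ⟨k, hk⟩ : ∃ k, k = amplifyIter u θ' := ⟨_, rfl⟩
  rw [← hk]
  -- Rounding down gives `u / θ' < 2 * k + 3`, which is at most `3 * (2 * k + 1)`.
  have hk3 : u ≤ 3 * ((2 * k + 1) * θ') := by
    have h3 := Nat.lt_floor_add_one ((u / θ' - 1) / 2)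
    have h4 : u / θ' ≤ 3 * (2 * k + 1) := by
      have : (0 : ℝ) ≤ k := Nat.cast_nonneg k
      rw [hk] at this ⊢
      rw [amplifyIter] at this ⊢
      linarith
    rw [div_le_iff₀ hθ'] at h4
    linarith
  have hlow : ∀ x : ℝ, u / 3 * (255 / 256) ≤ x → x ≤ Real.pi / 2 → u / 5 ≤ Real.sin x := by
    intro x hx hx'
    have h3 := Real.mul_le_sin (by nlinarith : 0 ≤ x) hx'
    have h4 : 0.63 ≤ 2 / Real.pi := by
      rw [le_div_iff₀ (by linarith)]; linarith
    have : 0.63 * x ≤ 2 / Real.pi * x := mul_le_mul_of_nonneg_right h4 (by nlinarith)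
    linarith
  -- Without iterations the angle may already exceed `u`; the upper bound is then the hypothesis on
  -- `sin θ`.
  rcases Nat.eq_zero_or_pos k with h0 | h0
  · subst h0
    simp only [dirichlet, Nat.cast_zero, mul_zero, zero_add, one_mul, sub_self, abs_zero]
      at hk3 ⊢
    refine ⟨by nlinarith, hlow _ (by linarith) (by linarith), hsin, by positivity⟩
  · have hu1 : (2 * k + 1) * θ' ≤ u := by
      have h3 : (k : ℝ) ≤ (u / θ' - 1) / 2 := by
        have : 0 ≤ (u / θ' - 1) / 2 := by
          by_contra! hc
          rw [hk, amplifyIter, Nat.floor_of_nonpos hc.le] at h0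
          exact lt_irrefl _ h0
        rw [hk]
        exact Nat.floor_le this
      have h4 : 2 * (k : ℝ) + 1 ≤ u / θ' := by linarith
      rwa [le_div_iff₀ hθ'] at h4
    obtain ⟨r, hr⟩ : ∃ r : ℝ, r = 2 * k + 1 := ⟨_, rfl⟩
    have hD := le_dirichlet k θ
    have hDD := abs_dirichlet_sub_le k θ' θ
    have hDs := dirichlet_mul_sin k θ
    rw [← hr] at hk3 hu1 hD hDs ⊢
    have hr0 : 0 < r := by rw [hr]; positivity
    have hrθ : r * θ ≤ r * θ' * (257 / 256) := by
      have := mul_le_mul_of_nonneg_left (show θ ≤ θ' * (257 / 256) by linarith) hr0.le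
      linarith
    have hrθ' : r * θ' * (255 / 256) ≤ r * θ := by
      have := mul_le_mul_of_nonneg_left (show θ' * (255 / 256) ≤ θ by linarith) hr0.le
      linarith
    have hrθu : r * θ ≤ 257 / 256 * u := by linarith
    have hrθ0 : 0 ≤ r * θ := by positivity
    have hsq : (r * θ) ^ 2 ≤ (257 / 256 * u) ^ 2 := pow_le_pow_left₀ hrθ0 hrθu 2
    have hDr : r * (1 - u ^ 2) ≤ dirichlet k θ := by
      refine le_trans (mul_le_mul_of_nonneg_left ?_ hr0.le) hD
      nlinarith
    refine ⟨hDr, ?_, ?_, ?_⟩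
    · rw [hDs]
      exact hlow _ (by linarith) (by linarith)
    · rw [hDs]
      have := Real.sin_le hrθ0
      linarith
    · have hDr2 : r * (255 / 256) ≤ dirichlet k θ :=
        le_trans (mul_le_mul_of_nonneg_left (by nlinarith) hr0.le) hDr
      have e1 : |θ' + θ| * |θ' - θ| ≤ (θ' * (513 / 256)) * (ε * θ' / 8) := by
        refine mul_le_mul ?_ h (abs_nonneg _) (by positivity)
        rw [abs_of_nonneg (by linarith)]
        linarith
      have e2 : 4 * (k : ℝ) ^ 3 ≤ r ^ 3 / 2 := by
        have hk0 : (0 : ℝ) ≤ k := Nat.cast_nonneg k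
        rw [hr]
        nlinarith [mul_nonneg hk0 hk0, mul_nonneg hk0 (mul_nonneg hk0 hk0)]
      have e3 : (r * θ') ^ 2 ≤ u ^ 2 := pow_le_pow_left₀ (by positivity) hu1 2
      calc _ ≤ _ := hDD
        _ ≤ r ^ 3 / 2 * ((θ' * (513 / 256)) * (ε * θ' / 8)) :=
          mul_le_mul e2 e1 (by positivity) (by positivity)
        _ = 513 / 4096 * ε * r * (r * θ') ^ 2 := by ring
        _ ≤ 513 / 4096 * ε * r * u ^ 2 := mul_le_mul_of_nonneg_left e3 (by positivity)
        _ = ε * u ^ 2 / 2 * (r * (513 / 2048)) := by ring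
        _ ≤ _ := mul_le_mul_of_nonneg_left (by linarith) (by positivity)

end DirichletKernel

/-! ### Grouping the steps by doubling times. -/

section Levels

variable {m : ℕ} (τ : StoppingTimes m)

/-- The number of steps that end before time `2 ^ (j - 1)`; for `j = 0`, no steps. -/
def level : ℕ → ℕ
  | 0 => 0
  | j + 1 => (Finset.univ.filter fun i : Fin m => τ.time i.succ ≤ 2 ^ j).card

theorem level_le (j : ℕ) : level τ j ≤ m := by
  cases j with
  | zero => exact Nat.zero_le _
  | succ j => exact (Finset.card_filter_le _ _).trans (by simp)

theorem le_time (i : Fin (m + 1)) : (i : ℕ) ≤ τ.time i := by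
  obtain ⟨i, hi⟩ := i
  induction i with
  | zero => exact Nat.zero_le _
  | succ i ih =>
    have h1 := ih (by omega)
    have h2 : τ.time ⟨i, by omega⟩ < τ.time ⟨i + 1, hi⟩ := τ.strictMono (by simp)
    simp only at *
    omega

theorem lt_level_iff (j : ℕ) (i : Fin m) : (i : ℕ) < level τ (j + 1) ↔ τ.time i.succ ≤ 2 ^ j := by
  have hmono : ∀ a b : Fin m, a ≤ b → τ.time a.succ ≤ τ.time b.succ := fun a b h =>
    τ.strictMono.monotone (Fin.succ_le_succ_iff.2 h)
  constructor
  · intro h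
    by_contra hc
    have h1 : (Finset.univ.filter fun i : Fin m => τ.time i.succ ≤ 2 ^ j) ⊆ Finset.Iio i := by
      intro b hb
      rw [Finset.mem_filter] at hb
      rw [Finset.mem_Iio]
      by_contra hbi
      exact hc ((hmono i b (not_lt.1 hbi)).trans hb.2)
    have h2 := Finset.card_le_card h1
    rw [Fin.card_Iio] at h2
    rw [level] at h
    omega
  · intro h
    have h1 : Finset.Iic i ⊆ Finset.univ.filter fun i : Fin m => τ.time i.succ ≤ 2 ^ j := by
      intro b hb
      rw [Finset.mem_Iic] at hb
      rw [Finset.mem_filter]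
      exact ⟨Finset.mem_univ _, (hmono b i hb).trans h⟩
    have h2 := Finset.card_le_card h1
    rw [Fin.card_Iic] at h2
    rw [level]
    omega

theorem time_level_le (j : ℕ) (h : level τ (j + 1) < m + 1) :
    τ.time ⟨level τ (j + 1), h⟩ ≤ 2 ^ j := by
  rcases Nat.eq_zero_or_pos (level τ (j + 1)) with h0 | h0
  · have : (⟨level τ (j + 1), h⟩ : Fin (m + 1)) = 0 := Fin.ext (by simpa using h0)
    rw [this, τ.time_zero]
    exact Nat.zero_le _
  · have h1 := (lt_level_iff τ j ⟨level τ (j + 1) - 1, by omega⟩).1 (by simp only; omega)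
    have : (⟨level τ (j + 1), h⟩ : Fin (m + 1)) =
        Fin.succ ⟨level τ (j + 1) - 1, by omega⟩ := Fin.ext (by simp; omega)
    rw [this]
    exact h1

/-- Stopping times are distinct positive integers, so at most `2 ^ j` of them are at most `2 ^ j`.
Inspecting the flags therefore costs no more than the steps themselves, up to a constant. -/
theorem level_succ_le (j : ℕ) : level τ (j + 1) ≤ 2 ^ j :=
  (le_time τ ⟨level τ (j + 1), Nat.lt_succ_of_le (level_le τ _)⟩).trans (time_level_le τ j _)

theorem level_mono (j : ℕ) : level τ j ≤ level τ (j + 1) := by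
  cases j with
  | zero => exact Nat.zero_le _
  | succ j =>
    refine Finset.card_le_card fun i hi => ?_
    rw [Finset.mem_filter] at *
    exact ⟨hi.1, hi.2.trans (Nat.pow_le_pow_right (by norm_num) (by omega))⟩

theorem level_eq {j : ℕ} (h : τ.Tmax ≤ 2 ^ j) : level τ (j + 1) = m := by
  refine le_antisymm (level_le τ _) ?_
  by_contra! hc
  exact absurd ((lt_level_iff τ j ⟨level τ (j + 1), hc⟩).2
    ((τ.strictMono.monotone (Fin.le_last _)).trans h)) (lt_irrefl _)

/-- The circuit that continues the computation from time `2 ^ (j - 1)` to time `2 ^ j`. -/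
def extend (j : ℕ) (c : List (Op m)) : List (Op m) :=
  c ++ callSteps m (level τ j) (level τ (j + 1) - level τ j)

theorem below_extend {j : ℕ} {c : List (Op m)} (hc : Below (level τ j) c) :
    Below (level τ (j + 1)) (extend τ j c) := by
  have h := below_callSteps (m := m) (level τ j) (level τ (j + 1) - level τ j)
  rw [Nat.add_sub_cancel' (level_mono τ j)] at h
  exact (hc.mono (level_mono τ j)).append h

/-- The constant is `22 = 1 + 12 + 9`: the calls, the flags of the reflections, and the fixed
overhead. -/
theorem within_extend {j M : ℕ} {c : List (Op m)} (hc : circuitCost τ c ≤ M) :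
    Within τ (level τ (j + 1)) (extend τ j c) (M + 22 * 2 ^ j) := by
  have h1 := level_mono τ j
  have h2 := level_le τ (j + 1)
  have h := circuitCost_callSteps (τ := τ) (level τ j) (level τ (j + 1) - level τ j) (by omega)
  simp only [Nat.add_sub_cancel' h1] at h
  have h3 := time_level_le τ j (by omega)
  have h4 := level_succ_le τ j
  have h5 : 1 ≤ 2 ^ j := Nat.one_le_two_pow
  rw [Within, extend, circuitCost_append]
  omega

variable {H : Type u} [NormedAddCommGroup H] [InnerProductSpace ℂ H] [CompleteSpace H]
  (U : VariableTimeAlgorithm m H) {P : H →L[ℂ] H} (hP : IsStarProjection P)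

theorem goodProj_extend {j : ℕ} {c : List (Op m)} (hc : Below (level τ j) c) {γ : ℂ}
    (h : goodProj P (circuitIso U hP c (extInit U) true) =
      γ • goodProj P (U.stateAfter (level τ j))) :
    goodProj P (circuitIso U hP (extend τ j c) (extInit U) true) =
      γ • goodProj P (U.stateAfter (level τ (j + 1))) := by
  have h1 := level_mono τ j
  have h2 := level_le τ (j + 1)
  have := goodProj_callSteps U hP (a := level τ j) (level τ (j + 1) - level τ j) (by omega)
    (((extSupp_init U 0).mono (Nat.zero_le _)).circuit U hP hc) h
  rw [Nat.add_sub_cancel' h1] at this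
  rw [extend, circuitIso_append]
  exact this

end Levels

/-! ### The chain of stages: correctness and cost. -/

section Stages

variable {m : ℕ} (τ : StoppingTimes m)

/-- The number of rounds of amplitude estimation that the budget `B` allows for a circuit of
cost `M`. -/
def rounds (B M : ℕ) : ℕ := Nat.log 2 (B / M)

theorem mul_two_pow_rounds_le {B M : ℕ} (h : M ≤ B) (hM : 0 < M) : M * 2 ^ rounds B M ≤ B := by
  have h1 : B / M ≠ 0 := (Nat.div_pos h hM).ne'
  have := Nat.mul_le_mul_left M (Nat.pow_log_le_self 2 h1)
  exact this.trans (Nat.mul_div_le B M)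

theorem lt_mul_two_pow_rounds {B M : ℕ} (hM : 0 < M) : B < M * (2 * 2 ^ rounds B M) := by
  have h1 : B / M < 2 ^ (rounds B M + 1) := Nat.lt_pow_succ_log_self (by norm_num) _
  rw [Nat.div_lt_iff_lt_mul hM] at h1
  rw [pow_succ] at h1
  linarith

/-- Extend the circuit `c` up to time `2 ^ j`, and estimate its angle if this is possible with
the budget `B`. -/
def stage (ε δ : ℝ) (B j : ℕ) (c : List (Op m)) (M : ℕ) (k : ℝ → Program m (m + 4)) :
    Program m (m + 4) :=
  if B < M + 22 * 2 ^ j then .output 0 else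
    estimate (level τ (j + 1)) (extend τ j c) δ (rounds B (M + 22 * 2 ^ j))
      (rounds B (M + 22 * 2 ^ j)) 0 fun θ =>
        if ε * θ < 2 / 2 ^ rounds B (M + 22 * 2 ^ j) then .output 0 else k θ

/-- The number of rounds is chosen so that circuit cost times `2 ^ rounds` is at most `B`, which
makes the bound independent of the circuit. -/
theorem cost_stage {ε δ : ℝ} (hδ : 0 < δ) (hδ1 : δ ≤ 1) (B : ℕ) {j M : ℕ} {c : List (Op m)}
    (hc : circuitCost τ c ≤ M) {k : ℝ → Program m (m + 4)} {X : ℝ} (hX : 0 ≤ X)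
    (hk : ∀ x, ((k x).cost τ : ℝ) ≤ X) :
    ((stage τ ε δ B j c M k).cost τ : ℝ) ≤
      X + 8 * trialsConst * B * (3 + Real.log (1 / δ)) := by
  have hl : 0 ≤ Real.log (1 / δ) := Real.log_nonneg (by rw [le_div_iff₀ hδ]; linarith)
  have ht : 0 ≤ trialsConst := by rw [trialsConst, sampleAcc]; norm_num
  rw [stage]
  split_ifs with h
  · simp only [Program.cost, Nat.cast_zero]
    positivity
  · have h1 := cost_estimate (within_extend τ (j := j) hc) hδ hδ1
      (k := fun θ => if ε * θ < 2 / 2 ^ rounds B (M + 22 * 2 ^ j) then .output 0 else k θ)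
      (X := X) (fun x => by
        split_ifs
        · simpa [Program.cost] using hX
        · exact hk x) (rounds B (M + 22 * 2 ^ j)) (rounds B (M + 22 * 2 ^ j)) le_rfl 0
    refine h1.trans (add_le_add_right ?_ _)
    have h2 : ((M + 22 * 2 ^ j : ℕ) : ℝ) * 2 ^ rounds B (M + 22 * 2 ^ j) ≤ B := by
      exact_mod_cast mul_two_pow_rounds_le (not_lt.1 h) (by positivity)
    have h3 : 3 + Real.log (1 / δ) - (3 + Real.log (1 / δ) + (rounds B (M + 22 * 2 ^ j) : ℕ)) /
        2 ^ rounds B (M + 22 * 2 ^ j) ≤ 3 + Real.log (1 / δ) := sub_le_self _ (by positivity)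
    calc _ ≤ 8 * trialsConst * ((M + 22 * 2 ^ j : ℕ) : ℝ) * 2 ^ rounds B (M + 22 * 2 ^ j) *
          (3 + Real.log (1 / δ)) := mul_le_mul_of_nonneg_left h3 (by positivity)
      _ = 8 * trialsConst * (((M + 22 * 2 ^ j : ℕ) : ℝ) * 2 ^ rounds B (M + 22 * 2 ^ j)) *
          (3 + Real.log (1 / δ)) := by ring
      _ ≤ _ := by
        refine mul_le_mul_of_nonneg_right ?_ (by linarith)
        exact mul_le_mul_of_nonneg_left h2 (by positivity)

/-- `n + 1` stages, beginning with stage `j`.  The circuit `c` scales the good part of the state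
by a factor close to `b`, and costs at most `M`. -/
def stages (u ε δ t : ℝ) (B : ℕ) : ℕ → ℕ → List (Op m) → ℝ → ℕ → Program m (m + 4)
  | 0, j, c, b, M => stage τ ε δ B j c M fun θ =>
      .output (if 2 / t ^ 2 ≤ (Real.sin θ / b) ^ 2 then (Real.sin θ / b) ^ 2 else 0)
  | n + 1, j, c, b, M => stage τ ε δ B j c M fun θ =>
      stages u ε δ t B n (j + 1)
        (amplify (level τ (j + 1)) (extend τ j c) (amplifyIter u θ))
        (b * dirichlet (amplifyIter u θ) θ) ((2 * amplifyIter u θ + 1) * (M + 22 * 2 ^ j))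

theorem cost_stages (u ε t : ℝ) {δ : ℝ} (hδ : 0 < δ) (hδ1 : δ ≤ 1) (B n : ℕ) {j M : ℕ}
    {c : List (Op m)} (hc : circuitCost τ c ≤ M) (b : ℝ) :
    ((stages τ u ε δ t B n j c b M).cost τ : ℝ) ≤
      (n + 1) * (8 * trialsConst * B * (3 + Real.log (1 / δ))) := by
  have hl : 0 ≤ Real.log (1 / δ) := Real.log_nonneg (by rw [le_div_iff₀ hδ]; linarith)
  have ht : 0 ≤ trialsConst := by rw [trialsConst, sampleAcc]; norm_num
  induction n generalizing j M c b with
  | zero =>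
    rw [stages]
    refine (cost_stage τ hδ hδ1 B hc le_rfl fun x => ?_).trans (le_of_eq ?_)
    · simp [Program.cost]
    · simp
  | succ n ih =>
    rw [stages]
    refine (cost_stage τ hδ hδ1 B hc
      (X := (n + 1) * (8 * trialsConst * B * (3 + Real.log (1 / δ)))) (by positivity)
      fun x => ih ?_ _).trans (le_of_eq ?_)
    · have := (within_extend τ (j := j) hc).amplify (amplifyIter u x)
      rw [Within] at this
      omega
    · push_cast
      ring

variable {H : Type u} [NormedAddCommGroup H] [InnerProductSpace ℂ H] [CompleteSpace H]
  (U : VariableTimeAlgorithm m H) {P : H →L[ℂ] H} {S : Set ℝ} (hP : IsStarProjection P)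

-- If the test `ε * θ' ≥ 2 / 2 ^ K` passes, the absolute error `1 / (4 * 2 ^ K)` is at most `ε * θ'
-- / 8`. If it fails, either `0` is an admissible output or the budget makes `ε * θ * 2 ^ K ≥ 8`,
-- which excludes failure.
include hP in
theorem le_prob_stage {ε δ : ℝ} (hε : 0 < ε) (hε' : ε ≤ 1) (hδ : 0 < δ) (hδ1 : δ ≤ 1)
    {B j M : ℕ} {c : List (Op m)}
    (hc : Below (level τ j) c) {θ : ℝ}
    (hθ : Real.sin θ = ‖extProj P (circuitIso U hP (extend τ j c) (extInit U))‖) (hθ0 : 0 ≤ θ)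
    (hθ4 : θ ≤ 1 / 4) {V : ℝ} (hV : V ≤ 1) {k : ℝ → Program m (m + 4)}
    (hk : ∀ θ', 0 < θ' → |θ' - θ| ≤ ε * θ' / 8 → V ≤ (k θ').prob U P S)
    (hS : 0 ∈ S ∨ 16 * ((M + 22 * 2 ^ j : ℕ) : ℝ) ≤ ε * θ * B) :
    V - δ ≤ (stage τ ε δ B j c M k).prob U P S := by
  have hM : 0 < M + 22 * 2 ^ j := by positivity
  rw [stage]
  generalize M + 22 * 2 ^ j = N at *
  have hN0 : (0 : ℝ) < N := by exact_mod_cast hM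
  split_ifs with h
  · rcases hS with hS | hS
    · rw [prob_output U P hS]
      linarith
    · exfalso
      have h1 : (B : ℝ) < N := by exact_mod_cast h
      have h2 : ε * θ ≤ 1 := by nlinarith
      have : ε * θ * B ≤ 1 * B := mul_le_mul_of_nonneg_right h2 (Nat.cast_nonneg _)
      linarith
  · set K := rounds B N with hK
    have h2K : (0 : ℝ) < 2 ^ K := by positivity
    have := le_prob_estimate U hP (level_le τ (j + 1)) (below_extend τ hc) hθ hθ4 hδ hδ1 hV
      (S := S) (k := fun θ => if ε * θ < 2 / 2 ^ K then .output 0 else k θ) K (by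
        intro x hx
        have hx' : |x - θ| ≤ 1 / 2 ^ K / 4 := by simpa [width] using hx
        split_ifs with hxK
        · rcases hS with hS | hS
          · rw [prob_output U P hS]
            exact hV
          · exfalso
            have h1 : (B : ℝ) < N * (2 * 2 ^ K) := by
              exact_mod_cast lt_mul_two_pow_rounds (B := B) hM
            have hεθ : 0 ≤ ε * θ := by positivity
            have h2 : 16 * (N : ℝ) ≤ ε * θ * (N * (2 * 2 ^ K)) :=
              hS.trans (mul_le_mul_of_nonneg_left h1.le hεθ)
            have h3 : 8 ≤ ε * θ * 2 ^ K := by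
              have : N * 8 ≤ N * (ε * θ * 2 ^ K) := by linarith
              exact le_of_mul_le_mul_left this hN0
            rw [lt_div_iff₀ h2K] at hxK
            have h4 : ε * (θ - x) * 2 ^ K ≤ 1 / 4 := by
              have h5 : θ - x ≤ 1 / 2 ^ K / 4 := by linarith [(abs_le.1 hx').1]
              calc ε * (θ - x) * 2 ^ K ≤ ε * (1 / 2 ^ K / 4) * 2 ^ K := by gcongr
                _ = ε * (1 / 4) := by field_simp
                _ ≤ _ := by linarith
            linarith
        · rw [not_lt, div_le_iff₀ h2K] at hxK
          have hx0 : 0 < x := by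
            by_contra! hx0
            have : ε * x * 2 ^ K ≤ 0 :=
              mul_nonpos_of_nonpos_of_nonneg (mul_nonpos_of_nonneg_of_nonpos hε.le hx0) h2K.le
            linarith
          refine hk x hx0 (hx'.trans ?_)
          rw [div_div, div_le_div_iff₀ (by positivity) (by norm_num)]
          linarith) K le_rfl (x := 0) le_rfl hθ0 (by
            rw [width, div_self (by positivity)]; linarith)
    refine le_trans ?_ this
    have h1 : 0 ≤ δ * (1 / 2 ^ K) := by positivity
    linarith

/-- The norm of the part of the state that may be accepted, at the beginning of stage `j`. -/
def amplitude (P : H →L[ℂ] H) (j : ℕ) : ℝ := ‖goodProj P (U.stateAfter (level τ j))‖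

theorem amplitude_nonneg (P : H →L[ℂ] H) (j : ℕ) : 0 ≤ amplitude τ U P j := norm_nonneg _

theorem amplitude_sq (P : H →L[ℂ] H) (j : ℕ) :
    amplitude τ U P j ^ 2 = U.goodProb P (level τ j) := rfl

include hP in
theorem amplitude_succ_le (j : ℕ) : amplitude τ U P (j + 1) ≤ amplitude τ U P j := by
  have := goodProb_antitone U hP (level_mono τ j)
  rw [← amplitude_sq, ← amplitude_sq] at this
  exact (pow_le_pow_iff_left₀ (norm_nonneg _) (norm_nonneg _) two_ne_zero).1 this

/-- The bound of the normalised cost of the circuits. -/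
def costSum (u : ℝ) (P : H →L[ℂ] H) (j : ℕ) : ℝ :=
  5 / u * (1 + ∑ i ∈ Finset.range j, 2 ^ i * amplitude τ U P i)

/-- The conditions at the beginning of stage `j`, where `γ` is the exact scaling factor. -/
structure IsStage (u ε : ℝ) (j : ℕ) (c : List (Op m)) (b : ℝ) (M : ℕ) (γ : ℂ) : Prop where
  below : Below (level τ j) c
  good : goodProj P (circuitIso U hP c (extInit U) true) =
    γ • goodProj P (U.stateAfter (level τ j))
  lower : u / 5 ≤ ‖γ‖ * amplitude τ U P j
  upper : ‖γ‖ * amplitude τ U P j ≤ 11 / 10 * u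
  scale : |b - ‖γ‖| ≤ j * (ε * u ^ 2) * ‖γ‖
  cost : M * (1 - u ^ 2) ^ j ≤ 22 * ‖γ‖ * costSum τ U u P j

namespace IsStage

variable {τ U hP} {u ε b : ℝ} {j M : ℕ} {c : List (Op m)} {γ : ℂ}

theorem norm_pos (h : IsStage τ U hP u ε j c b M γ) (hu : 0 < u) : 0 < ‖γ‖ := by
  rcases (norm_nonneg γ).lt_or_eq with h0 | h0
  · exact h0
  · have := h.lower
    rw [← h0] at this
    linarith

theorem norm_extProj_extend (h : IsStage τ U hP u ε j c b M γ) :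
    ‖extProj P (circuitIso U hP (extend τ j c) (extInit U))‖ =
      ‖γ‖ * amplitude τ U P (j + 1) := by
  rw [norm_extProj, goodProj_extend τ U hP h.below h.good, norm_smul, amplitude]

/-- By `lower`, `1 ≤ (5 / u) * ‖γ‖ * a_j`, so the additional cost `22 * 2 ^ j` is charged to the new
term of `costSum`. -/
theorem cost_extend (h : IsStage τ U hP u ε j c b M γ) (hu : 0 < u) (hu1 : u ≤ 1) :
    ((M + 22 * 2 ^ j : ℕ) : ℝ) * (1 - u ^ 2) ^ j ≤ 22 * ‖γ‖ * costSum τ U u P (j + 1) := by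
  have h1 : (1 - u ^ 2) ^ j ≤ 1 := pow_le_one₀ (by nlinarith) (by nlinarith)
  have h2 : (22 * 2 ^ j : ℝ) * (1 - u ^ 2) ^ j ≤ 22 * 2 ^ j * 1 :=
    mul_le_mul_of_nonneg_left h1 (by positivity)
  have h3 : 1 ≤ 5 / u * (‖γ‖ * amplitude τ U P j) := by
    rw [div_mul_eq_mul_div, le_div_iff₀ hu]
    linarith [h.lower]
  have h4 : costSum τ U u P (j + 1) = costSum τ U u P j + 5 / u * (2 ^ j * amplitude τ U P j) := by
    rw [costSum, costSum, Finset.sum_range_succ]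
    ring
  have h5 : (22 * 2 ^ j : ℝ) * 1 ≤ 22 * 2 ^ j * (5 / u * (‖γ‖ * amplitude τ U P j)) :=
    mul_le_mul_of_nonneg_left h3 (by positivity)
  have h6 := h.cost
  rw [h4]
  push_cast
  linarith

/-- All invariants scale with the kernel: the circuit cost by `2 * k + 1`, and `‖γ‖` by at least `(2
* k + 1) * (1 - u ^ 2)`, which explains the power of `1 - u ^ 2` in `cost`. The tracked factor uses
the kernel at the estimated angle, the exact one at the true angle. -/
theorem next (h : IsStage τ U hP u ε j c b M γ) (hu : 0 < u) (hu' : u ≤ 1 / 16) (hε : 0 < ε)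
    (hε' : ε ≤ 1 / 32) (hj : j * u ^ 2 ≤ 1) {θ : ℝ} (hθ0 : 0 ≤ θ) (hθ4 : θ ≤ 1 / 4)
    (hθ : Real.sin θ = ‖γ‖ * amplitude τ U P (j + 1)) {θ' : ℝ} (hθ' : 0 < θ')
    (hθθ' : |θ' - θ| ≤ ε * θ' / 8) :
    IsStage τ U hP u ε (j + 1)
      (amplify (level τ (j + 1)) (extend τ j c) (amplifyIter u θ'))
      (b * dirichlet (amplifyIter u θ') θ') ((2 * amplifyIter u θ' + 1) * (M + 22 * 2 ^ j))
      ((-1) ^ amplifyIter u θ' * (dirichlet (amplifyIter u θ') θ : ℂ) * γ) := by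
  have hγ := h.norm_pos hu
  have hsin : Real.sin θ ≤ 11 / 10 * u := by
    rw [hθ]
    exact (mul_le_mul_of_nonneg_left (amplitude_succ_le τ U hP j) hγ.le).trans h.upper
  obtain ⟨h1, h2, h3, h4⟩ := amplifyIter_spec hu hu' hε hε' hθ0 hsin hθ4 hθ' hθθ'
  have hcost := h.cost_extend hu (by linarith)
  have hext := h.norm_extProj_extend
  generalize amplifyIter u θ' = k at *
  have hu2 : 0 < 1 - u ^ 2 := by nlinarith
  have hD : 0 < dirichlet k θ := lt_of_lt_of_le (by positivity) h1
  have hn : ‖(-1) ^ k * (dirichlet k θ : ℂ) * γ‖ = dirichlet k θ * ‖γ‖ := by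
    rw [norm_mul, norm_mul, norm_pow, norm_neg, norm_one, one_pow, one_mul, Complex.norm_real,
      Real.norm_of_nonneg hD.le]
  refine ⟨(below_extend τ h.below).amplify (level_le τ _) k, ?_, ?_, ?_, ?_, ?_⟩
  · have := extProj_amplify U hP (level_le τ (j + 1)) (below_extend τ h.below) k
      (θ := θ) (hθ.trans hext.symm)
    have h5 := congrArg (fun ψ : Ext m H => ψ true) this
    simp only [PiLp.smul_apply, extProj_true] at h5
    rw [h5, goodProj_extend τ U hP h.below h.good, smul_smul]
  · rw [hn, mul_assoc, ← hθ]
    exact h2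
  · rw [hn, mul_assoc, ← hθ]
    exact h3
  · rw [hn]
    have h5 := h.scale
    have h6 : |b * dirichlet k θ' - dirichlet k θ * ‖γ‖| ≤
        |b - ‖γ‖| * |dirichlet k θ'| + ‖γ‖ * |dirichlet k θ' - dirichlet k θ| := by
      rw [← abs_mul, ← abs_of_pos hγ, ← abs_mul, abs_of_pos hγ]
      refine le_trans (le_of_eq ?_) (abs_add_le _ _)
      congr 1
      ring
    have h7 : |dirichlet k θ'| ≤ dirichlet k θ * (1 + ε * u ^ 2 / 2) := by
      have := abs_add_le (dirichlet k θ' - dirichlet k θ) (dirichlet k θ)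
      rw [sub_add_cancel, abs_of_pos hD] at this
      linarith
    have h8 : |b - ‖γ‖| * |dirichlet k θ'| ≤
        (j * (ε * u ^ 2) * ‖γ‖) * (dirichlet k θ * (1 + ε * u ^ 2 / 2)) :=
      mul_le_mul h5 h7 (abs_nonneg _) (by positivity)
    have h9 : ‖γ‖ * |dirichlet k θ' - dirichlet k θ| ≤
        ‖γ‖ * (ε * u ^ 2 / 2 * dirichlet k θ) := mul_le_mul_of_nonneg_left h4 hγ.le
    -- The new error is `ε * u ^ 2 / 2`; the cross term fits into the other half because `j * u ^ 2
    -- ≤ 1`.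
    have h10 : j * (ε * u ^ 2) * (1 + ε * u ^ 2 / 2) + ε * u ^ 2 / 2 ≤
        (j + 1) * (ε * u ^ 2) := by
      have : (j * u ^ 2) * ε ≤ 1 * ε := mul_le_mul_of_nonneg_right hj hε.le
      have h11 : (j * u ^ 2) * ε * (ε * u ^ 2 / 2) ≤ 1 * (ε * u ^ 2 / 2) :=
        mul_le_mul_of_nonneg_right (by linarith) (by positivity)
      linarith
    have h11 := mul_le_mul_of_nonneg_right h10 (show 0 ≤ dirichlet k θ * ‖γ‖ by positivity)
    push_cast
    linarith
  · rw [hn]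
    have h5 : 0 ≤ 22 * ‖γ‖ * costSum τ U u P (j + 1) := le_trans (by positivity) hcost
    calc (((2 * k + 1) * (M + 22 * 2 ^ j) : ℕ) : ℝ) * (1 - u ^ 2) ^ (j + 1)
        = ((2 * k + 1) * (1 - u ^ 2)) *
            (((M + 22 * 2 ^ j : ℕ) : ℝ) * (1 - u ^ 2) ^ j) := by push_cast; ring
      _ ≤ dirichlet k θ * (22 * ‖γ‖ * costSum τ U u P (j + 1)) :=
          mul_le_mul h1 hcost (by positivity) hD.le
      _ = _ := by ring

end IsStage

/-- At time `0` nothing has stopped and the good amplitude is `1`; the rotation by `arcsin u` scales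
it exactly to `u`. -/
theorem IsStage.start {u ε : ℝ} (hu : 0 < u) (hu1 : u ≤ 1) :
    IsStage τ U hP u ε 0 [.rot (Real.arcsin u)] u 1 (u : ℂ) := by
  have h1 : amplitude τ U P 0 = 1 := by
    have : amplitude τ U P 0 ^ 2 = 1 := by rw [amplitude_sq, level, goodProb_zero]
    exact (pow_eq_one_iff_of_nonneg (amplitude_nonneg τ U P 0) two_ne_zero).1 this
  have h2 : ‖(u : ℂ)‖ = u := by rw [Complex.norm_real, Real.norm_of_nonneg hu.le]
  refine ⟨?_, ?_, ?_, ?_, ?_, ?_⟩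
  · intro o ho
    rw [List.mem_singleton] at ho
    rw [ho]
    trivial
  · rw [goodProj_rot, Real.sin_arcsin (by linarith) hu1, level]
  · rw [h1, h2]; linarith
  · rw [h1, h2]; linarith
  · rw [h2]; simp
  · rw [h2, costSum]
    simp
    field_simp
    norm_num

-- The factor `704 = 16 * 2 * 22` combines the margin asked by `le_prob_stage`, the bound `(1 - u ^
-- 2) ^ j ≥ 1 / 2`, and the constant in `cost`. The unknown `‖γ‖` cancels between cost and
-- amplitude, so the budget condition mentions only the algorithm `U`.
include hP in
theorem le_prob_stages {u ε δ t : ℝ} (hu : 0 < u) (hu' : u ≤ 1 / 16) (hε : 0 < ε)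
    (hε' : ε ≤ 1 / 32) (hδ : 0 < δ) (hδ1 : δ ≤ 1) {L B : ℕ} (huL : L * u ^ 2 ≤ 1 / 16)
    (hS : 0 ∈ S ∨ ∀ j < L, 704 * costSum τ U u P (j + 1) ≤ ε * B * amplitude τ U P (j + 1))
    (hfin : ∀ x, |x - amplitude τ U P L ^ 2| ≤ 4 * ε * amplitude τ U P L ^ 2 →
      (if 2 / t ^ 2 ≤ x then x else 0) ∈ S)
    {n j M : ℕ} (hnj : j + n + 1 = L) {c : List (Op m)} {b : ℝ} {γ : ℂ}
    (h : IsStage τ U hP u ε j c b M γ) :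
    1 - (n + 1) * δ ≤ (stages τ u ε δ t B n j c b M).prob U P S := by
  have main : ∀ {j M : ℕ} (hjL : j < L) {c : List (Op m)} {b : ℝ} {γ : ℂ}
      (h : IsStage τ U hP u ε j c b M γ), j * u ^ 2 ≤ 1 / 16 ∧
      ∃ θ, 0 ≤ θ ∧ θ ≤ 1 / 4 ∧ Real.sin θ = ‖γ‖ * amplitude τ U P (j + 1) ∧
      ∀ {V : ℝ} (_ : V ≤ 1) {k : ℝ → Program m (m + 4)}
        (_ : ∀ θ', 0 < θ' → |θ' - θ| ≤ ε * θ' / 8 → V ≤ (k θ').prob U P S),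
        V - δ ≤ (stage τ ε δ B j c M k).prob U P S := by
    intro j M hjL c b γ h
    have hγ := h.norm_pos hu
    have hju : j * u ^ 2 ≤ 1 / 16 := by
      have : (j : ℝ) ≤ L := by exact_mod_cast hjL.le
      exact (mul_le_mul_of_nonneg_right this (sq_nonneg u)).trans huL
    have ha := amplitude_nonneg τ U P (j + 1)
    have hup : ‖γ‖ * amplitude τ U P (j + 1) ≤ 11 / 10 * u :=
      (mul_le_mul_of_nonneg_left (amplitude_succ_le τ U hP j) hγ.le).trans h.upper
    have hsin := Real.sin_arcsin (x := ‖γ‖ * amplitude τ U P (j + 1))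
      (by linarith [mul_nonneg hγ.le ha]) (by linarith)
    have hθ0 := Real.arcsin_nonneg.2 (mul_nonneg hγ.le ha)
    have hθpi := Real.arcsin_le_pi_div_two (‖γ‖ * amplitude τ U P (j + 1))
    generalize Real.arcsin (‖γ‖ * amplitude τ U P (j + 1)) = θ at *
    have hθ4 : θ ≤ 1 / 4 := by
      have h1 := Real.mul_le_sin hθ0 hθpi
      rw [hsin, div_mul_eq_mul_div, div_le_iff₀ Real.pi_pos] at h1
      have h2 := mul_le_mul_of_nonneg_right hup Real.pi_pos.le
      have := Real.pi_lt_d2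
      have := Real.pi_pos
      nlinarith
    refine ⟨hju, θ, hθ0, hθ4, hsin, ?_⟩
    intro V hV k hk
    refine le_prob_stage τ U hP hε (by linarith) hδ hδ1 h.below
      (hsin.trans h.norm_extProj_extend.symm) hθ0 hθ4 hV hk (hS.imp_right fun hS => ?_)
    have h1 := h.cost_extend hu (by linarith)
    -- Bernoulli's inequality with `j * u ^ 2 ≤ 1 / 16`.
    have h2 : 1 / 2 ≤ (1 - u ^ 2) ^ j := by
      have := one_add_mul_le_pow (a := -u ^ 2) (by nlinarith) j
      rw [← sub_eq_add_neg] at this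
      linarith
    have h3 := mul_le_mul_of_nonneg_left h2 (Nat.cast_nonneg (α := ℝ) (M + 22 * 2 ^ j))
    have h4 := mul_le_mul_of_nonneg_left (hS j hjL) hγ.le
    have h5 : ε * B * Real.sin θ ≤ ε * B * θ :=
      mul_le_mul_of_nonneg_left (Real.sin_le hθ0) (by positivity)
    rw [hsin] at h5
    linarith
  induction n generalizing j M c b γ with
  | zero =>
    obtain ⟨hju, θ, hθ0, hθ4, hsin, key⟩ := main (by omega) h
    have hγ := h.norm_pos hu
    rw [stages]
    refine le_trans (by simp) (key le_rfl fun θ' hθ' hθθ' => ?_)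
    rw [prob_output U P]
    refine hfin _ ?_
    rw [← hnj, add_zero]
    have ha := amplitude_nonneg τ U P (j + 1)
    generalize amplitude τ U P (j + 1) = a at *
    have hb : |b - ‖γ‖| ≤ ε / 16 * ‖γ‖ := by
      refine h.scale.trans (mul_le_mul_of_nonneg_right ?_ hγ.le)
      have := mul_le_mul_of_nonneg_left hju hε.le
      linarith
    have hb0 : ‖γ‖ * (1 - ε / 16) ≤ b := by linarith [(abs_le.1 hb).1]
    have hb1 : 0 < b := lt_of_lt_of_le (mul_pos hγ (by linarith)) hb0
    -- The error `ε * θ' / 8` of the angle becomes relative to `sin θ` through `θ' ≤ 10 / 9 * θ` and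
    -- `5 / 9 * θ ≤ sin θ`.
    have hs : |Real.sin θ' - Real.sin θ| ≤ ε / 4 * Real.sin θ := by
      have h1 : |Real.sin θ' - Real.sin θ| ≤ |θ' - θ| := by
        have := Real.lipschitzWith_sin.dist_le_mul θ' θ
        rwa [Real.dist_eq, Real.dist_eq, NNReal.coe_one, one_mul] at this
      have h2 : θ' ≤ θ * (10 / 9) := by
        have := (abs_le.1 hθθ').2
        nlinarith
      have h3 := Real.mul_le_sin hθ0 (by linarith [Real.pi_gt_d2])
      have h4 : 5 / 9 * θ ≤ Real.sin θ := by
        refine le_trans (mul_le_mul_of_nonneg_right ?_ hθ0) h3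
        rw [le_div_iff₀ Real.pi_pos]
        linarith [Real.pi_lt_d2]
      have h5 := mul_le_mul_of_nonneg_left (show θ' / 8 ≤ Real.sin θ / 4 by linarith) hε.le
      linarith
    -- The true amplitude is `a = sin θ / ‖γ‖`; the relative errors `ε / 4` of the numerator and `ε
    -- / 16` of the denominator add up to less than `ε / 2`.
    have hx : |Real.sin θ' / b - a| ≤ ε / 2 * a := by
      have h1 : Real.sin θ' / b - a =
          ((Real.sin θ' - Real.sin θ) - a * (b - ‖γ‖)) / b := by
        rw [hsin]
        field_simp
        ring
      rw [h1, abs_div, abs_of_pos hb1, div_le_iff₀ hb1]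
      have h2 := abs_sub (Real.sin θ' - Real.sin θ) (a * (b - ‖γ‖))
      rw [abs_mul, abs_of_nonneg ha] at h2
      have h3 := mul_le_mul_of_nonneg_left hb ha
      have h4 := mul_le_mul_of_nonneg_left hb0 (show 0 ≤ ε / 2 * a by positivity)
      rw [hsin] at hs h2
      have h5 : 0 ≤ ε * a * ‖γ‖ * (1 / 32 - ε) :=
        mul_nonneg (by positivity) (by linarith)
      have h6 : 0 ≤ ε * a * ‖γ‖ := by positivity
      rw [hsin]
      nlinarith
    generalize Real.sin θ' / b = x at *
    rw [sq_sub_sq, abs_mul]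
    have h1 : |x + a| ≤ 3 * a := by
      have := abs_add_le (x - a) (2 * a)
      rw [abs_of_nonneg (show 0 ≤ 2 * a by linarith)] at this
      rw [show x + a = x - a + 2 * a by ring]
      nlinarith
    have := mul_le_mul h1 hx (abs_nonneg _) (by positivity)
    have h2 : 0 ≤ ε * a ^ 2 := by positivity
    nlinarith
  | succ n ih =>
    obtain ⟨hju, θ, hθ0, hθ4, hsin, key⟩ := main (by omega) h
    rw [stages]
    have h1 : 0 ≤ ((n : ℝ) + 1) * δ := by positivity
    refine le_trans (le_of_eq ?_) (key (V := 1 - (n + 1) * δ) (by linarith)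
      fun θ' hθ' hθθ' => ih (by omega) (h.next hu hu' hε hε' (by linarith) hθ0 hθ4 hsin hθ' hθθ'))
    push_cast
    ring

end Stages

/-! ### Choice of the cutoff, the number of stages and the budget. -/

section Parameters

variable {m : ℕ} (τ : StoppingTimes m) {H : Type u} [NormedAddCommGroup H]
  [InnerProductSpace ℂ H] [CompleteSpace H] {U : VariableTimeAlgorithm m H} {P : H →L[ℂ] H}

theorem acceptProb_nonneg (U : VariableTimeAlgorithm m H) (hP : IsStarProjection P) :
    0 ≤ U.acceptProb P := by
  rw [acceptProb_eq U hP]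
  positivity

theorem acceptProb_le_amplitude_sq (hU : U.Halts) (hP : IsStarProjection P) (j : ℕ) :
    U.acceptProb P ≤ amplitude τ U P j ^ 2 :=
  acceptProb_le_goodProb hU hP (level_le τ j)

theorem amplitude_succ_sq_le (hU : U.Halts) (hP : IsStarProjection P) {T : ℝ} (hT : U.Tl2 τ ≤ T)
    (j : ℕ) : amplitude τ U P (j + 1) ^ 2 ≤ U.acceptProb P + T ^ 2 / (2 ^ j) ^ 2 := by
  refine goodProb_le hU hP τ hT (level_le τ _) (by positivity) fun i hi => ?_
  have := (lt_level_iff τ j i).not.1 (not_lt.2 hi)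
  exact_mod_cast (not_le.1 this).le

theorem amplitude_le (hU : U.Halts) (hP : IsStarProjection P) {T : ℝ} (hT : U.Tl2 τ ≤ T)
    (hT1 : 1 ≤ T) (j : ℕ) :
    amplitude τ U P j ≤ Real.sqrt (U.acceptProb P) + 2 * T / 2 ^ j := by
  have hs := Real.sqrt_nonneg (U.acceptProb P)
  refine (pow_le_pow_iff_left₀ (amplitude_nonneg τ U P j) (by positivity) two_ne_zero).1 ?_
  cases j with
  | zero =>
    rw [amplitude_sq, level, goodProb_zero, pow_zero, div_one]
    nlinarith
  | succ j =>
    refine (amplitude_succ_sq_le τ hU hP hT j).trans ?_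
    have h1 : 2 * T / 2 ^ (j + 1) = T / 2 ^ j := by rw [pow_succ]; field_simp
    have h2 : 0 ≤ T / 2 ^ j := by positivity
    have h3 := Real.sq_sqrt (acceptProb_nonneg U hP)
    rw [h1, ← div_pow]
    nlinarith

/-- The two parts of `amplitude_le` behave differently under the weights `2 ^ i`: the part `√p`
gives a geometric sum, and the tail contributes `2 * T` per stage. The initial `1` is absorbed by `L
* T`. -/
theorem costSum_le (hU : U.Halts) (hP : IsStarProjection P) {T : ℝ} (hT : U.Tl2 τ ≤ T)
    (hT1 : 1 ≤ T) {L : ℕ} (hL : 0 < L) {u : ℝ} (hu : 0 < u) {j : ℕ} (hj : j ≤ L) :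
    costSum τ U u P j ≤
      5 / u * (2 ^ L * Real.sqrt (U.acceptProb P) + 3 * L * T) := by
  refine mul_le_mul_of_nonneg_left ?_ (by positivity)
  have hs := Real.sqrt_nonneg (U.acceptProb P)
  have hL1 : (1 : ℝ) ≤ L := by exact_mod_cast hL
  have h1 : ∑ i ∈ Finset.range j, 2 ^ i * amplitude τ U P i ≤
      ∑ i ∈ Finset.range j, (2 ^ i * Real.sqrt (U.acceptProb P) + 2 * T) := by
    refine Finset.sum_le_sum fun i _ => ?_
    refine (mul_le_mul_of_nonneg_left (amplitude_le τ hU hP hT hT1 i)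
      (by positivity)).trans (le_of_eq ?_)
    field_simp
  have h2 : ∑ i ∈ Finset.range j, (2 : ℝ) ^ i ≤ 2 ^ L := by
    rw [geom_sum_eq (by norm_num)]
    have : (2 : ℝ) ^ j ≤ 2 ^ L := pow_le_pow_right₀ (by norm_num) hj
    norm_num
    linarith
  rw [Finset.sum_add_distrib, ← Finset.sum_mul, Finset.sum_const, Finset.card_range,
    nsmul_eq_mul] at h1
  have h3 := mul_le_mul_of_nonneg_right h2 hs
  have h4 : (j : ℝ) * (2 * T) ≤ L * (2 * T) :=
    mul_le_mul_of_nonneg_right (by exact_mod_cast hj) (by linarith)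
  nlinarith

/-- The maximal time of the steps that have to be taken into account. -/
def cutoff (t T ε : ℝ) : ℝ := min (τ.Tmax : ℝ) (t * T * ε ^ (-(1 / 2) : ℝ))

/-- The index of the last stage. -/
def lastStage (t T ε : ℝ) : ℕ := Nat.clog 2 ⌈2 * cutoff τ t T ε⌉₊

/-- The budget for an application of amplitude estimation. -/
def budget (t T ε : ℝ) : ℕ :=
  ⌈1802240 / ε * ((lastStage τ t T ε + 1 : ℕ) * (2 ^ (lastStage τ t T ε + 1) +
    2 * (lastStage τ t T ε + 1 : ℕ) * (t * T)))⌉₊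

variable {t T ε : ℝ}

theorem two_mul_cutoff_le : 2 * cutoff τ t T ε ≤ 2 ^ lastStage τ t T ε := by
  have h1 := Nat.le_ceil (2 * cutoff τ t T ε)
  have h2 := Nat.le_pow_clog (b := 2) (by norm_num) ⌈2 * cutoff τ t T ε⌉₊
  exact h1.trans (by exact_mod_cast h2)

theorem one_le_cutoff (hm : 2 ≤ τ.Tmax) (ht : 1 < t) (hT : 1 < T) (hε : 0 < ε) (hε1 : ε < 1) :
    1 ≤ cutoff τ t T ε := by
  refine le_min (by exact_mod_cast (by omega : 1 ≤ τ.Tmax)) ?_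
  have := Real.one_le_rpow_of_pos_of_le_one_of_nonpos hε hε1.le
    (show (-(1 / 2) : ℝ) ≤ 0 by norm_num)
  exact one_le_mul_of_one_le_of_one_le (one_le_mul_of_one_le_of_one_le ht.le hT.le) this

theorem two_pow_lastStage_le (h : 1 ≤ cutoff τ t T ε) :
    (2 : ℝ) ^ lastStage τ t T ε ≤ 6 * cutoff τ t T ε := by
  have h1 : 1 < ⌈2 * cutoff τ t T ε⌉₊ := Nat.lt_ceil.2 (by push_cast; linarith)
  have h2 := Nat.pow_pred_clog_lt_self (b := 2) (by norm_num) h1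
  have h3 : 0 < lastStage τ t T ε := Nat.clog_pos (by norm_num) h1
  have h4 := (Nat.ceil_lt_add_one (show 0 ≤ 2 * cutoff τ t T ε by linarith)).le
  have h5 : (2 : ℝ) ^ (lastStage τ t T ε - 1) ≤ 2 * cutoff τ t T ε + 1 :=
    le_trans (by exact_mod_cast h2.le) h4
  obtain ⟨k, hk⟩ : ∃ k, lastStage τ t T ε = k + 1 := ⟨_, (Nat.succ_pred_eq_of_pos h3).symm⟩
  rw [hk, Nat.add_sub_cancel] at h5
  rw [hk, pow_succ]
  linarith

/-- Either the last stage reaches `Tmax`, and the good weight is exactly `p`, or `2 ^ lastStage ≥ 2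
* t * T / √ε`, and the tail bound gives the error. -/
theorem amplitude_lastStage_sq_le (hU : U.Halts) (hP : IsStarProjection P) (hT : U.Tl2 τ ≤ T)
    (ht : 0 < t) (hε : 0 < ε) :
    amplitude τ U P (lastStage τ t T ε + 1) ^ 2 ≤ U.acceptProb P + ε / (4 * t ^ 2) := by
  have h1 := two_mul_cutoff_le τ (t := t) (T := T) (ε := ε)
  by_cases h : τ.Tmax ≤ 2 ^ lastStage τ t T ε
  · rw [amplitude_sq, level_eq τ h, goodProb_last hU hP]
    have : 0 ≤ ε / (4 * t ^ 2) := by positivity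
    linarith
  · refine (amplitude_succ_sq_le τ hU hP hT _).trans (add_le_add_right ?_ _)
    have hT0 : 0 ≤ T := le_trans (Real.sqrt_nonneg _) hT
    have h2 : (2 : ℝ) ^ lastStage τ t T ε < τ.Tmax := by exact_mod_cast not_le.1 h
    have hx : 0 ≤ t * T * ε ^ (-(1 / 2) : ℝ) := by positivity
    have h3 : cutoff τ t T ε = t * T * ε ^ (-(1 / 2) : ℝ) := by
      rw [cutoff, min_eq_right]
      by_contra! hc
      rw [cutoff, min_eq_left hc.le] at h1
      linarith [Nat.cast_nonneg (α := ℝ) τ.Tmax]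
    rw [h3] at h1
    have h4 := pow_le_pow_left₀ (by positivity) h1 2
    have h5 : (ε ^ (-(1 / 2) : ℝ)) ^ 2 = ε⁻¹ := by
      rw [← Real.rpow_natCast, ← Real.rpow_mul hε.le, ← Real.rpow_neg_one]
      norm_num
    rw [mul_pow, mul_pow, mul_pow, h5] at h4
    rw [div_le_div_iff₀ (by positivity) (by positivity)]
    calc T ^ 2 * (4 * t ^ 2) = ε * (2 ^ 2 * (t ^ 2 * T ^ 2 * ε⁻¹)) := by
            field_simp
            norm_num
      _ ≤ _ := mul_le_mul_of_nonneg_left h4 hε.le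

/-- With `s = 1 / t ^ 2`, the truncation error is at most `ε * s / 4` and the sampling error at most
`ε * q / 8`. An estimate of at least `2 * s` forces `p` to be comparable with `s`, which makes the
truncation error relative; `p ≥ 4 * s` always passes the threshold, and `2 * p < s` never does. -/
theorem estimate_spec {p q x : ℝ} (ht : 0 < t) (hε : 0 < ε) (hε1 : ε < 1) (hp : 0 ≤ p)
    (hpq : p ≤ q) (hqp : q ≤ p + ε / (4 * t ^ 2)) (hx : |x - q| ≤ 4 * (ε / 32) * q) :
    (if 2 / t ^ 2 ≤ x then x else 0) ∈ {r : ℝ | r ≤ 2 * p ∧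
      (2 ≤ t * Real.sqrt p → |r - p| ≤ ε * p) ∧ (t * Real.sqrt (2 * p) < 1 → r = 0)} := by
  obtain ⟨s, hs⟩ : ∃ s, s = 1 / t ^ 2 := ⟨_, rfl⟩
  have hs0 : 0 < s := by rw [hs]; positivity
  have e1 : 2 / t ^ 2 = 2 * s := by rw [hs]; ring
  have e2 : ε / (4 * t ^ 2) = ε * s / 4 := by rw [hs]; field_simp
  have e3 : 2 ≤ t * Real.sqrt p → 4 * s ≤ p := by
    intro h
    have := pow_le_pow_left₀ (by norm_num) h 2
    rw [mul_pow, Real.sq_sqrt hp] at this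
    rw [hs, mul_one_div, div_le_iff₀ (by positivity)]
    linarith
  have e4 : t * Real.sqrt (2 * p) < 1 → 2 * p < s := by
    intro h
    have := pow_lt_pow_left₀ h (by positivity) two_ne_zero
    rw [mul_pow, Real.sq_sqrt (by positivity)] at this
    rw [hs, lt_div_iff₀ (by positivity)]
    linarith
  rw [e1]
  rw [e2] at hqp
  have hq : 0 ≤ q := hp.trans hpq
  obtain ⟨h1, h2⟩ := abs_le.1 hx
  have f1 : ε * s ≤ s := by nlinarith
  have f2 : ε * q ≤ q := by nlinarith
  have f3 : 0 ≤ ε * q := by positivity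
  split_ifs with h
  · refine ⟨by linarith, fun hc => ?_, fun hc => ?_⟩
    · have h3 := e3 hc
      have f4 : ε * (4 * s) ≤ ε * p := mul_le_mul_of_nonneg_left h3 hε.le
      have f5 : ε * q ≤ ε * (2 * p) := mul_le_mul_of_nonneg_left (by linarith) hε.le
      rw [abs_le]
      constructor <;> linarith
    · have h3 := e4 hc
      linarith
  · refine ⟨by linarith, fun hc => ?_, fun hc => rfl⟩
    have h3 := e3 hc
    linarith

/-- The variable-time amplitude estimation algorithm. -/
def amplitudeEstimation : EstimationAlgorithm := fun m τ t T ε δ =>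
  ⟨m + 4, stages τ (1 / (16 * (lastStage τ t T ε + 1 : ℕ))) (ε / 32)
    (δ / (lastStage τ t T ε + 1 : ℕ)) t (budget τ t T ε) (lastStage τ t T ε) 0
    [.rot (Real.arcsin (1 / (16 * (lastStage τ t T ε + 1 : ℕ))))]
    (1 / (16 * (lastStage τ t T ε + 1 : ℕ))) 1⟩

theorem le_prob_amplitudeEstimation {δ : ℝ} (ht : 1 < t) (hT1 : 1 < T) (hε : 0 < ε)
    (hε1 : ε < 1) (hδ : 0 < δ) (hδ1 : δ < 1) (hP : IsStarProjection P) (hU : U.Halts)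
    (hT : U.Tl2 τ ≤ T) :
    1 - δ ≤ (amplitudeEstimation m τ t T ε δ).2.prob U P
      {r : ℝ | r ≤ 2 * U.acceptProb P ∧
        (2 ≤ t * Real.sqrt (U.acceptProb P) → |r - U.acceptProb P| ≤ ε * U.acceptProb P) ∧
        (t * Real.sqrt (2 * U.acceptProb P) < 1 → r = 0)} := by
  have hp := acceptProb_nonneg U hP
  have hs := Real.sqrt_nonneg (U.acceptProb P)
  have hq := amplitude_lastStage_sq_le τ hU hP hT (t := t) (by linarith) hε
  rw [amplitudeEstimation]
  have hB : 1802240 / ε * ((lastStage τ t T ε + 1 : ℕ) * (2 ^ (lastStage τ t T ε + 1) +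
    2 * (lastStage τ t T ε + 1 : ℕ) * (t * T))) ≤ budget τ t T ε := Nat.le_ceil _
  generalize budget τ t T ε = B at *
  obtain ⟨L, hL⟩ : ∃ L, L = lastStage τ t T ε + 1 := ⟨_, rfl⟩
  rw [← hL] at hq hB ⊢
  generalize lastStage τ t T ε = J at *
  have hL0 : 0 < L := by omega
  have hL1 : (1 : ℝ) ≤ L := by exact_mod_cast hL0
  have hu : (0 : ℝ) < 1 / (16 * L) := by positivity
  have hu' : (1 : ℝ) / (16 * L) ≤ 1 / 16 := by
    rw [div_le_div_iff₀ (by positivity) (by norm_num)]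
    linarith
  have key := le_prob_stages τ U (P := P) hP (S := {r : ℝ | r ≤ 2 * U.acceptProb P ∧
        (2 ≤ t * Real.sqrt (U.acceptProb P) → |r - U.acceptProb P| ≤ ε * U.acceptProb P) ∧
        (t * Real.sqrt (2 * U.acceptProb P) < 1 → r = 0)})
      (ε := ε / 32) (δ := δ / L) (t := t) (L := L) (B := B) hu hu'
      (by positivity) (by linarith) (by positivity)
      (by rw [div_le_one (by positivity)]; linarith) (by
        rw [div_pow, mul_div_assoc', div_le_div_iff₀ (by positivity) (by norm_num)]
        nlinarith) (by
        -- If `t * √p < 2`, the output `0` satisfies all requirements, so only the other case has to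
        -- be covered by the budget.
        by_cases hc : 2 ≤ t * Real.sqrt (U.acceptProb P)
        · right
          intro j hj
          have h1 := costSum_le τ hU hP hT hT1.le hL0 hu (j := j + 1) hj
          have h2 : Real.sqrt (U.acceptProb P) ≤ amplitude τ U P (j + 1) := by
            rw [Real.sqrt_le_left (amplitude_nonneg τ U P _)]
            exact acceptProb_le_amplitude_sq τ hU hP _
          generalize Real.sqrt (U.acceptProb P) = s at *
          have h3 : 5 / (1 / (16 * L)) * (2 ^ L * s + 3 * L * T) ≤
              80 * (L * (2 ^ L + 2 * L * (t * T))) * s := by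
            -- Here `t * s ≥ 2` trades the term in `T` for a multiple of `s`, so `s` can be
            -- cancelled against the amplitude.
            have h4 : L * (3 * L * T) ≤ L * (2 * L * (t * T) * s) := by
              have : L * (2 * L * T) * 2 ≤ L * (2 * L * T) * (t * s) :=
                mul_le_mul_of_nonneg_left hc (by positivity)
              have h5 : 0 ≤ L * (L * T) := by positivity
              linarith
            have h5 : 5 / (1 / (16 * (L : ℝ))) = 80 * L := by field_simp; norm_num
            rw [h5]
            linarith
          -- The constants are `704 * 80 = 56320` and `32 * 56320 = 1802240`, the latter being the
          -- factor in `budget`.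
          have h4 : 56320 * (L * (2 ^ L + 2 * L * (t * T))) ≤ ε / 32 * B := by
            have := mul_le_mul_of_nonneg_left hB (show 0 ≤ ε / 32 by positivity)
            refine le_trans (le_of_eq ?_) this
            field_simp
            norm_num
          have h5 := mul_le_mul_of_nonneg_right h4 hs
          have h6 := mul_le_mul_of_nonneg_left h2 (show 0 ≤ ε / 32 * B by positivity)
          linarith
        · left
          exact ⟨by linarith, fun h => absurd h hc, fun _ => rfl⟩)
      (fun x hx => estimate_spec (by linarith) hε hε1 hp
        (acceptProb_le_amplitude_sq τ hU hP L) hq hx)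
      (n := J) (by omega) (IsStage.start τ U hP hu (by linarith))
  refine le_trans (le_of_eq ?_) key
  rw [hL]
  push_cast
  field_simp

/-- The factor in the bound of the time complexity. -/
def costConst : ℝ := 17080 * 1802240 * trialsConst

theorem cost_amplitudeEstimation {δ : ℝ} (hm : 2 ≤ τ.Tmax) (ht : 1 < t) (hT : 1 < T)
    (hε : 0 < ε) (hε1 : ε < 1) (hδ : 0 < δ) (hδ1 : δ < 1) :
    (((amplitudeEstimation m τ t T ε δ).2.cost τ : ℕ) : ℝ) ≤
      costConst * ((min (τ.Tmax : ℝ) (t * T * ε ^ (-(1 / 2) : ℝ)) + t * T) * ε⁻¹ *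
        Real.logb 2 τ.Tmax ^ 4 * max 1 (Real.logb 2 (Real.logb 2 τ.Tmax / δ))) := by
  have hc1 := one_le_cutoff τ hm ht hT hε hε1
  have h2J := two_pow_lastStage_le τ hc1
  have htc : 0 ≤ trialsConst := by rw [trialsConst, sampleAcc]; norm_num
  have hcm : cutoff τ t T ε ≤ τ.Tmax := min_le_left _ _
  have hm' : (2 : ℝ) ≤ τ.Tmax := by exact_mod_cast hm
  have hB : (budget τ t T ε : ℝ) ≤ 1802240 / ε * ((lastStage τ t T ε + 1 : ℕ) *
      (2 ^ (lastStage τ t T ε + 1) + 2 * (lastStage τ t T ε + 1 : ℕ) * (t * T))) + 1 :=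
    (Nat.ceil_lt_add_one (by positivity)).le
  have hlam : 1 ≤ Real.logb 2 τ.Tmax := by
    rw [Real.le_logb_iff_rpow_le (by norm_num) (by linarith), Real.rpow_one]
    exact hm'
  have hJ : (lastStage τ t T ε : ℝ) ≤ 3 + Real.logb 2 τ.Tmax := by
    have h1 : Real.logb 2 ((2 : ℝ) ^ lastStage τ t T ε) ≤ Real.logb 2 (2 ^ 3 * τ.Tmax) :=
      Real.logb_le_logb_of_le (by norm_num) (by positivity) (by linarith)
    rw [Real.logb_mul (by norm_num) (by positivity), Real.logb_pow, Real.logb_pow,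
      Real.logb_self_eq_one (by norm_num)] at h1
    push_cast at h1
    linarith
  rw [amplitudeEstimation]
  have hcost : circuitCost τ [.rot (Real.arcsin (1 / (16 * (lastStage τ t T ε + 1 : ℕ))))] ≤ 1 := by
    rw [circuitCost]
    simpa [Op.compile] using listCost_ctrlGate τ _ _ _
  change _ ≤ costConst * ((cutoff τ t T ε + t * T) * _ * _ * _)
  generalize cutoff τ t T ε = c at *
  generalize budget τ t T ε = B at *
  generalize lastStage τ t T ε = J at *
  generalize Real.logb 2 τ.Tmax = l at *
  have hl0 : 0 < l := by linarith
  obtain ⟨L, hL⟩ : ∃ L, L = J + 1 := ⟨_, rfl⟩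
  have hL1 : (1 : ℝ) ≤ L := by exact_mod_cast (by omega : 1 ≤ L)
  have key := cost_stages τ (1 / (16 * (J + 1 : ℕ))) (ε / 32) t (δ := δ / (J + 1 : ℕ))
    (by positivity) (by
      rw [← hL, div_le_one (by positivity)]; linarith) B J (j := 0) hcost (1 / (16 * (J + 1 : ℕ)))
  refine key.trans ?_
  have hLJ : (J : ℝ) + 1 = L := by rw [hL]; push_cast; ring
  rw [hLJ]
  rw [← hL] at hB ⊢
  -- From `L ≤ 4 + l` and `l ≥ 1`.
  have hLl : (L : ℝ) ≤ 5 * l := by linarith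
  have h2L : (2 : ℝ) ^ L ≤ 12 * c := by rw [hL, pow_succ]; linarith
  have htT : 1 ≤ t * T := one_le_mul_of_one_le_of_one_le ht.le hT.le
  have hW : 1 ≤ (c + t * T) * ε⁻¹ * l ^ 2 := by
    refine one_le_mul_of_one_le_of_one_le (one_le_mul_of_one_le_of_one_le (by linarith) ?_)
      (one_le_pow₀ hlam)
    exact (one_le_inv₀ hε).2 hε1.le
  -- The factor `61` is `5 * 12` plus one for the rounding up of the budget.
  have hB' : (B : ℝ) ≤ 61 * 1802240 * ((c + t * T) * ε⁻¹ * l ^ 2) := by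
    have h1 : (L : ℝ) * (2 ^ L + 2 * L * (t * T)) ≤ 60 * ((c + t * T) * l ^ 2) := by
      have h2 : 2 ^ L + 2 * L * (t * T) ≤ 12 * (c + t * T) * l := by
        have h3 : (2 * L) * (t * T) ≤ (2 * (5 * l)) * (t * T) :=
          mul_le_mul_of_nonneg_right (by linarith) (by linarith)
        have h4 : 12 * c * 1 ≤ 12 * c * l := mul_le_mul_of_nonneg_left hlam (by linarith)
        have h5 : 0 ≤ l * (t * T) := by positivity
        linarith
      refine (mul_le_mul hLl h2 (by positivity) (by positivity)).trans (le_of_eq ?_)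
      ring
    have h2 := mul_le_mul_of_nonneg_left h1 (show 0 ≤ 1802240 / ε by positivity)
    have h3 : 1802240 / ε * (60 * ((c + t * T) * l ^ 2)) =
        60 * 1802240 * ((c + t * T) * ε⁻¹ * l ^ 2) := by
      field_simp
    linarith
  have hlog : 3 + Real.log (1 / (δ / L)) ≤ 7 * max 1 (Real.logb 2 (l / δ)) := by
    have h1 : Real.log (1 / (δ / L)) ≤ Real.log (8 * (l / δ)) := by
      refine Real.log_le_log (by positivity) ?_
      rw [one_div_div, ← mul_div_assoc]
      exact div_le_div_of_nonneg_right (by linarith) hδ.le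
    have h2 : 1 ≤ l / δ := by rw [le_div_iff₀ hδ]; linarith
    have h3 : Real.log 8 ≤ 3 := by
      rw [show (8 : ℝ) = 2 ^ 3 by norm_num, Real.log_pow]
      have := Real.log_two_lt_d9
      push_cast
      linarith
    have h4 : Real.log (l / δ) ≤ Real.logb 2 (l / δ) := by
      rw [Real.logb, le_div_iff₀ (Real.log_pos (by norm_num))]
      have := Real.log_nonneg h2
      have := Real.log_two_lt_d9
      nlinarith
    rw [Real.log_mul (by norm_num) (by positivity)] at h1
    have h5 := le_max_left 1 (Real.logb 2 (l / δ))
    have h6 := le_max_right 1 (Real.logb 2 (l / δ))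
    linarith
  have hlog0 : 0 ≤ 3 + Real.log (1 / (δ / L)) := by
    have : 0 ≤ Real.log (1 / (δ / L)) := by
      refine Real.log_nonneg ?_
      rw [one_div_div, le_div_iff₀ hδ]
      linarith
    linarith
  generalize max 1 (Real.logb 2 (l / δ)) = N at *
  have hN : 0 ≤ N := by linarith
  calc (L : ℝ) * (8 * trialsConst * B * (3 + Real.log (1 / (δ / L))))
      ≤ (5 * l) * (8 * trialsConst * (61 * 1802240 * ((c + t * T) * ε⁻¹ * l ^ 2)) *
          (7 * N)) := by gcongr
    _ = costConst * ((c + t * T) * ε⁻¹ * l ^ 3 * N) := by rw [costConst]; ring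
    -- The algorithm needs only the third power of the logarithm; `l ≥ 1` weakens it to the fourth.
    _ ≤ _ := by
      have h1 : l ^ 3 ≤ l ^ 4 := pow_le_pow_right₀ hlam (by norm_num)
      have h2 : 0 ≤ costConst := by rw [costConst]; positivity
      have h3 : 0 ≤ c + t * T := by linarith
      gcongr

end Parameters
end VarTime

end

/-- Variable-time amplitude estimation.  The conditions `t ≥ 2 / √p` and `t < 1 / √(2 p)` are
written without division, so that for `p = 0` the first one fails and the second one holds. -/
theorem mainTheorem6 :
    ∃ (alg : VarTime.EstimationAlgorithm) (C : ℝ), 0 < C ∧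
      ∀ (m : ℕ) (τ : VarTime.StoppingTimes m) (t T ε δ : ℝ),
        2 ≤ τ.Tmax → 1 < t → 1 < T → 0 < ε → ε < 1 → 0 < δ → δ < 1 →
        (((alg m τ t T ε δ).2.cost τ : ℕ) : ℝ) ≤
            C * ((min (τ.Tmax : ℝ) (t * T * ε ^ (-(1 / 2) : ℝ)) + t * T) * ε⁻¹ *
              Real.logb 2 τ.Tmax ^ 4 * max 1 (Real.logb 2 (Real.logb 2 τ.Tmax / δ))) ∧
        ∀ (H : Type u) [NormedAddCommGroup H] [InnerProductSpace ℂ H] [CompleteSpace H]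
          (U : VarTime.VariableTimeAlgorithm m H) (P : H →L[ℂ] H),
          IsStarProjection P → U.Halts → U.Tl2 τ ≤ T →
          1 - δ ≤ (alg m τ t T ε δ).2.prob U P
            {r : ℝ | r ≤ 2 * U.acceptProb P ∧
              (2 ≤ t * Real.sqrt (U.acceptProb P) →
                |r - U.acceptProb P| ≤ ε * U.acceptProb P) ∧
              (t * Real.sqrt (2 * U.acceptProb P) < 1 → r = 0)} := by
  refine ⟨VarTime.amplitudeEstimation, VarTime.costConst, ?_,
    fun m τ t T ε δ hm ht hT hε hε1 hδ hδ1 =>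
      ⟨VarTime.cost_amplitudeEstimation τ hm ht hT hε hε1 hδ hδ1, ?_⟩⟩
  · rw [VarTime.costConst, VarTime.trialsConst, VarTime.sampleAcc]
    norm_num
  · intro H _ _ _ U P hP hU hUT
    exact VarTime.le_prob_amplitudeEstimation τ ht hT hε hε1 hδ hδ1 hP hU hUT
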